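/- **Theorem (The fixed suborbifold of $\mathsf{L}\mathsf{G}$ under the natural $S^1$-action).** Let $\mathsf{G}$ be an orbifold groupoid: a groupoid whose sets of objects $\mathsf{G}_0$ and arrows $\mathsf{G}_1$ are (Hausdorff, paracompact) smooth manifolds, whose structure maps are smooth, whose source and target maps $s,t\colon \mathsf{G}_1\to\mathsf{G}_0$ are local diffeomorphisms, and whose anchor $(s,t)\colon \mathsf{G}_1\to\mathsf{G}_0\times\mathsf{G}_0$ is proper. (Components of a manifold may have different dimensions.) *Inertia groupoid.* $\wedge\mathsf{G}$ has as objects the $v\in\mathsf{G}_1$ with $s(v)=t(v)$ and as arrows $v\to w$ the $\alpha\in\mathsf{G}_1$ with $v\cdot\alpha=\alpha\cdot w$ (composition is written in the order in which arrows are traversed); objects and arrows carry the smooth structure (diffeology) of subspaces of $\mathsf{G}_1$ and $\mathsf{G}_1^3$ (via $(v,w,\alpha)$). *Loop groupoid.* For an open cover $W=(W_i)_{i\in\mathbb{N}}$ of $S^1$ let $S^1_W$ be the groupoid with objects $\coprod_i W_i$ and arrows $\coprod_{i,j}W_i\cap W_j$. The objects of $\mathsf{L}\mathsf{G}$ are the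 pairs of an open cover $W$ and a smooth functor $\Psi\colon S^1_W\to\mathsf{G}$; the arrows $(W,\Psi)\to(W',\Psi')$ are the smooth natural transformations between the restrictions of $\Psi$ and $\Psi'$ to the common refinement $(W_i\cap W'_j)_{i,j}$. A family of objects over $\mathbb{R}^n$ is smooth if its covers form an open cover of $\mathbb{R}^n\times S^1$ and its functors form a smooth functor from the groupoid of that cover to $\mathsf{G}$; a family of arrows is smooth if its sources and targets are smooth families and the transformations depend smoothly on the parameter and the point of the circle. This makes $\mathsf{L}\mathsf{G}$ a diffeological groupoid. The circle acts on it by rotation, $(\theta\cdot\Psi)(z)=\Psi(\theta z)$, with the covers rotated accordingly. The fixed suborbifold $(\mathsf{L}\mathsf{G})^{S^1}$ is the full subgroupoid, with the subspace smooth structure, on the loops $\Psi$ whose isomorphism class is fixed, i.e. such that $\theta\cdot\Psi\cong\Psi$ in $\mathsf{L}\mathsf{G}$ for every $\theta\in S^1$. *Conclusion.* $\wedge\mathsf{G}$ is again an orbifold groupoid, and $$\wedge\mathsf{G}=(\mathsf{L}\mathsf{G})^{S^1}$$ as orbifolds, that is, up to Morita equivalence. More precisely, let $\iota\colon\wedge\mathsf{G}\to\mathsf{L}\mathsf{G}$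 be the functor that sends $v$ to the constant loop at $s(v)=t(v)$ with holonomy $v$: on the cover of $S^1$ by $S^1\smallsetminus\{1\}$ and $S^1\smallsetminus\{-1\}$ it is constant on objects, and its value on the arrow from the first arc to the second is $v$ over the lower half circle and the identity over the upper half circle; and $\iota$ sends $\alpha\colon v\to w$ to the transformation with constant value $\alpha$ on each arc. Then every $\iota(v)$ lies in $(\mathsf{L}\mathsf{G})^{S^1}$, and $\iota\colon\wedge\mathsf{G}\to(\mathsf{L}\mathsf{G})^{S^1}$ is a Morita morphism. Here a smooth functor $\Phi\colon\mathsf{H}\to\mathsf{K}$ is a Morita morphism if the square formed by $\Phi_1\colon\mathsf{H}_1\to\mathsf{K}_1$, $\Phi_0\times\Phi_0$ and the two anchor maps is cartesian and $s\circ\pi_2\colon \mathsf{H}_0\,{}_{\Phi_0}\!\times_{t}\mathsf{K}_1\to\mathsf{K}_0$ is a surjective local diffeomorphism. -/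

import Mathlib

open CategoryTheory Diffeology
open scoped ContDiff Topology

universe v u

noncomputable section

namespace Orb

/-! ### Diffeologies on subsets, products and the circle -/

/-- The parameter spaces `ℝⁿ` of plots. -/
abbrev Param (n : ℕ) : Type := EuclideanSpace ℝ (Fin n)

/-- The coarsest diffeology making `f : X → Y` smooth: a map into `X` is a plot iff its composite
with `f` is a plot of `Y`. For the inclusion of a subset this is the subspace diffeology. -/
@[reducible] def inducedDiffeology {X Y : Type*} (f : X → Y) (_d : DiffeologicalSpace Y) :
    DiffeologicalSpace X where
  plots n := {p | IsPlot (f ∘ p)}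
  constant_plots x := isPlot_const (x := f x)
  plot_reparam hp hf := isPlot_reparam (X := Y) hp hf
  locality {_ p} hp := DiffeologicalSpace.locality (p := f ∘ p) hp

instance instDiffeologySubtype {X : Type*} [d : DiffeologicalSpace X] (s : X → Prop) :
    DiffeologicalSpace {x // s x} := inducedDiffeology Subtype.val d

/-- The product diffeology: plots are pairs of plots. -/
instance instDiffeologyProd {X Y : Type*} [DiffeologicalSpace X] [DiffeologicalSpace Y] :
    DiffeologicalSpace (X × Y) where
  plots n := {p | IsPlot (fun u => (p u).1) ∧ IsPlot (fun u => (p u).2)}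
  constant_plots x := ⟨isPlot_const (x := x.1), isPlot_const (x := x.2)⟩
  plot_reparam hp hf := ⟨isPlot_reparam hp.1 hf, isPlot_reparam hp.2 hf⟩
  locality hp := by
    constructor
    · refine DiffeologicalSpace.locality fun x => ?_
      obtain ⟨s, hs, hx, h⟩ := hp x
      exact ⟨s, hs, hx, fun hf hf' => (h hf hf').1⟩
    · refine DiffeologicalSpace.locality fun x => ?_
      obtain ⟨s, hs, hx, h⟩ := hp x
      exact ⟨s, hs, hx, fun hf hf' => (h hf hf').2⟩

/-- The circle as a smooth subspace of `ℂ`. -/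
instance instDiffeologyCircle : DiffeologicalSpace Circle :=
  inducedDiffeology (fun z : Circle => (z : ℂ)) (NormedSpace.toDiffeology ℂ)

/-! ### Smooth manifolds and local diffeomorphisms -/

/-- Local diffeomorphisms: around every point, `f` restricts to a diffeomorphism between open
subsets. Open subsets are those of the D-topology, which for a manifold is its usual topology. -/
def IsEtale {X Y : Type*} [DiffeologicalSpace X] [DiffeologicalSpace Y] (f : X → Y) : Prop :=
  DSmooth f ∧ ∀ x : X, ∃ (U : Set X) (V : Set Y), IsOpen[dTopology] U ∧ IsOpen[dTopology] V ∧
    x ∈ U ∧ ∃ φ : {x // x ∈ U} ≃ {y // y ∈ V},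
      DSmooth φ ∧ DSmooth φ.symm ∧ ∀ a, (φ a : Y) = f a

/-- Smooth manifolds as diffeological spaces: Hausdorff, paracompact, and every point has an open
neighbourhood diffeomorphic to an open subset of some `ℝᵏ`. As is needed for inertia groupoids,
different components may have different dimensions. -/
structure IsSmoothManifold (X : Type*) [DiffeologicalSpace X] : Prop where
  hausdorff : @T2Space X dTopology
  paracompact : @ParacompactSpace X dTopology
  chart : ∀ x : X, ∃ (k : ℕ) (U : Set X) (V : Set (Param k)), IsOpen[dTopology] U ∧ IsOpen V ∧
    x ∈ U ∧ ∃ φ : {x // x ∈ U} ≃ {y // y ∈ V}, DSmooth φ ∧ DSmooth φ.symm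

open scoped Manifold in
/-- The diffeology of a smooth manifold: plots are the smooth maps from `ℝⁿ`. -/
@[reducible] def manifoldDiffeology (k : ℕ) (M : Type*) [TopologicalSpace M]
    [ChartedSpace (EuclideanSpace ℝ (Fin k)) M] : DiffeologicalSpace M :=
  .ofCorePlotsOn {
    isPlotOn := fun {n s} _ p => ContMDiffOn (𝓡 n) (𝓡 k) ∞ p s
    isPlotOn_congr := fun _ _ _ h => contMDiffOn_congr h
    isPlot_const := fun _ => contMDiffOn_const
    isPlotOn_reparam := fun _ _ _ h hp hf => hp.comp hf.contMDiffOn h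
    locality := fun _ _ h x hx => by
      obtain ⟨v, hv, hxv, hv'⟩ := h x hx
      exact ((hv' x hxv).contMDiffAt (hv.mem_nhds hxv)).contMDiffWithinAt }

open scoped Manifold in
/-- Hausdorff, paracompact smooth manifolds are smooth manifolds in the sense of
`IsSmoothManifold`. -/
theorem isSmoothManifold_of_isManifold (k : ℕ) (M : Type*) [t : TopologicalSpace M]
    [ChartedSpace (EuclideanSpace ℝ (Fin k)) M] [IsManifold (𝓡 k) ∞ M] [T2Space M]
    [ParacompactSpace M] : @IsSmoothManifold M (manifoldDiffeology k M) := by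
  let _ := manifoldDiffeology k M
  have plot_iff : ∀ {n : ℕ} {p : Param n → M}, IsPlot p ↔ ContMDiff (𝓡 n) (𝓡 k) ∞ p :=
    contMDiffOn_univ
  have top : (dTopology : TopologicalSpace M) = t := by
    refine TopologicalSpace.ext_iff.2 fun s => ?_
    rw [isOpen_iff_preimages_plots]
    refine ⟨fun h => isOpen_iff_mem_nhds.2 fun x hx => ?_,
      fun h n p hp => h.preimage (plot_iff.1 hp).continuous⟩
    let c := chartAt (EuclideanSpace ℝ (Fin k)) x
    obtain ⟨ε, hε, hb⟩ := Metric.isOpen_iff.1 c.open_target (c x) (mem_chart_target _ x)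
    let e := OpenPartialHomeomorph.univBall (E := Param k) (c x) ε
    have ht : e.target = Metric.ball (c x) ε := OpenPartialHomeomorph.univBall_target _ hε
    have hes : e.source = Set.univ := OpenPartialHomeomorph.univBall_source _ _
    have he : ∀ y, e y ∈ c.target := fun y => hb (ht ▸ e.map_source (hes ▸ Set.mem_univ y))
    have hp : IsPlot (c.symm ∘ e) := plot_iff.2 <|
      (contMDiffOn_chart_symm (I := 𝓡 k) (n := ∞) (x := x)).comp_contMDiff
        (OpenPartialHomeomorph.contDiff_univBall.contMDiff) he
    have h0 := h k _ hp
    have h1 := (e.isOpen_inter_preimage_symm h0)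
    have h2 := c.isOpen_inter_preimage h1
    refine Filter.mem_of_superset (h2.mem_nhds ⟨mem_chart_source _ x, ?_, ?_⟩) ?_
    · exact ht ▸ Metric.mem_ball_self hε
    · change c.symm (e (e.symm (c x))) ∈ s
      rw [e.right_inv (ht ▸ Metric.mem_ball_self hε), c.left_inv (mem_chart_source _ x)]
      exact hx
    · rintro y ⟨hy, hy1, hy2⟩
      change c.symm (e (e.symm (c y))) ∈ s at hy2
      rwa [e.right_inv hy1, c.left_inv hy] at hy2
  refine ⟨by rw [top]; infer_instance, by rw [top]; infer_instance, fun x => ?_⟩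
  let c := chartAt (EuclideanSpace ℝ (Fin k)) x
  refine ⟨k, c.source, c.target, by rw [top]; exact c.open_source, c.open_target,
    mem_chart_source _ x, c.toHomeomorphSourceTarget.toEquiv, fun n p hp => ?_, fun n p hp => ?_⟩
  · have hp' : ContMDiff (𝓡 n) (𝓡 k) ∞ (fun a => (p a : M)) := plot_iff.1 hp
    have := (contMDiffOn_chart (I := 𝓡 k) (n := ∞) (x := x)).comp_contMDiff hp' fun a => (p a).2
    exact this.contDiff
  · have hp' : IsPlot (fun a => (p a : Param k)) := hp
    exact plot_iff.2 <| (contMDiffOn_chart_symm (I := 𝓡 k) (n := ∞) (x := x)).comp_contMDiff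
      hp'.contDiff.contMDiff fun a => (p a).2

/-! ### Smooth groupoids -/

/-- The set `G₁` of all arrows of a category (`G₀` is the type of objects itself). -/
structure Arr (C : Type u) [Category.{v} C] where
  src : C
  tgt : C
  hom : src ⟶ tgt

/-- A groupoid whose sets of objects and arrows are diffeological spaces and whose structure maps
source, target, unit, inverse and composition are smooth. Smoothness of the composition, a map
on the fibre product `G₁ ×_{G₀} G₁`, is spelled out on plots of the fibre product. -/
class DiffeologicalGroupoid (C : Type u) extends Groupoid.{v} C where
  obDiffeology : DiffeologicalSpace C
  arrDiffeology : DiffeologicalSpace (Arr C)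
  smooth_src : DSmooth (Arr.src : Arr C → C)
  smooth_tgt : DSmooth (Arr.tgt : Arr C → C)
  smooth_id : DSmooth (fun x : C => Arr.mk x x (𝟙 x))
  smooth_inv : DSmooth (fun f : Arr C => Arr.mk f.tgt f.src (Groupoid.inv f.hom))
  smooth_comp : ∀ {n : ℕ} {x y z : Param n → C} (f : ∀ a, x a ⟶ y a) (g : ∀ a, y a ⟶ z a),
    IsPlot (fun a => Arr.mk (x a) (y a) (f a)) → IsPlot (fun a => Arr.mk (y a) (z a) (g a)) →
      IsPlot (fun a => Arr.mk (x a) (z a) (f a ≫ g a))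

attribute [reducible, instance] DiffeologicalGroupoid.obDiffeology DiffeologicalGroupoid.arrDiffeology

/-- Orbifold groupoids: objects and arrows form smooth manifolds, source and target are local
diffeomorphisms, and the anchor `(s, t) : G₁ → G₀ × G₀` is proper. -/
structure IsOrbifoldGroupoid (C : Type u) [DiffeologicalGroupoid.{v} C] : Prop where
  manifold_ob : IsSmoothManifold C
  manifold_arr : IsSmoothManifold (Arr C)
  etale_src : IsEtale (Arr.src : Arr C → C)
  etale_tgt : IsEtale (Arr.tgt : Arr C → C)
  proper : @IsProperMap (Arr C) (C × C) dTopology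
    (@instTopologicalSpaceProd C C dTopology dTopology) (fun f => (f.src, f.tgt))

section Functors

variable {C : Type*} [DiffeologicalGroupoid C] {D : Type*} [DiffeologicalGroupoid D]

/-- The map on arrows underlying a functor. -/
def mapArr (Φ : C ⥤ D) (f : Arr C) : Arr D := ⟨Φ.obj f.src, Φ.obj f.tgt, Φ.map f.hom⟩

/-- Morita morphisms `Φ : C → D`: smooth functors for which the square formed by `Φ₁`, `Φ₀ × Φ₀`
and the anchor maps is cartesian and
`s ∘ π₂ : C₀ ×_{Φ₀, t} D₁ → D₀` is a surjective local diffeomorphism. -/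
structure IsMorita (Φ : C ⥤ D) : Prop where
  smooth_obj : DSmooth Φ.obj
  smooth_arr : DSmooth (mapArr Φ)
  cartesian : ∀ {n : ℕ} (x y : Param n → C) (g : Param n → Arr D), IsPlot x → IsPlot y → IsPlot g →
    (∀ a, (g a).src = Φ.obj (x a)) → (∀ a, (g a).tgt = Φ.obj (y a)) →
      ∃! f : Param n → Arr C, IsPlot f ∧
        ∀ a, (f a).src = x a ∧ (f a).tgt = y a ∧ mapArr Φ (f a) = g a
  surjective : Function.Surjective
    (fun q : {q : C × Arr D // Φ.obj q.1 = q.2.tgt} => q.1.2.src)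
  etale : IsEtale (fun q : {q : C × Arr D // Φ.obj q.1 = q.2.tgt} => q.1.2.src)

end Functors

/-! ### Full subgroupoids -/

/-- The full subgroupoid on the objects satisfying `P`, with the subspace diffeologies. -/
def FullSub {C : Type u} (P : C → Prop) : Type u := {x : C // P x}

namespace FullSub

variable {C : Type u} [DiffeologicalGroupoid.{v} C] (P : C → Prop)

instance : Groupoid.{v} (FullSub P) where
  Hom x y := x.1 ⟶ y.1
  id x := 𝟙 x.1
  comp f g := CategoryStruct.comp (obj := C) f g
  id_comp f := Category.id_comp (obj := C) f
  comp_id f := Category.comp_id (obj := C) f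
  assoc f g h := Category.assoc (obj := C) f g h
  inv f := Groupoid.inv (obj := C) f
  inv_comp f := Groupoid.inv_comp (obj := C) f
  comp_inv f := Groupoid.comp_inv (obj := C) f

/-- The inclusion on arrows. -/
def arrVal (f : Arr (FullSub P)) : Arr C := ⟨f.src.1, f.tgt.1, f.hom⟩

instance : DiffeologicalGroupoid.{v} (FullSub P) where
  obDiffeology := inducedDiffeology Subtype.val inferInstance
  arrDiffeology := inducedDiffeology (arrVal P) inferInstance
  smooth_src n _ hp := DiffeologicalGroupoid.smooth_src n _ hp
  smooth_tgt n _ hp := DiffeologicalGroupoid.smooth_tgt n _ hp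
  smooth_id n _ hp := DiffeologicalGroupoid.smooth_id (C := C) n _ hp
  smooth_inv n _ hp := DiffeologicalGroupoid.smooth_inv (C := C) n _ hp
  smooth_comp f g hf hg := DiffeologicalGroupoid.smooth_comp (C := C) f g hf hg

/-- A functor taking values in objects satisfying `P` factors through the full subgroupoid. -/
def lift {D : Type*} [Category D] (Φ : D ⥤ C) (h : ∀ x, P (Φ.obj x)) : D ⥤ FullSub P where
  obj x := ⟨Φ.obj x, h x⟩
  map f := Φ.map f
  map_id x := Φ.map_id x
  map_comp f g := Φ.map_comp f g

end FullSub

/-! ### The inertia groupoid -/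

/-- Objects of the inertia groupoid `∧G`: arrows `v` of `G` with equal source and target. -/
structure Inertia (G : Type u) [Category.{v} G] where
  pt : G
  loop : pt ⟶ pt

namespace Inertia

variable {G : Type u}

/-- An object of `∧G` as an element of `G₁`. -/
def toArr [Category.{v} G] (x : Inertia G) : Arr G := ⟨x.pt, x.pt, x.loop⟩

/-- Arrows `v ⟶ w` of `∧G`: arrows `α` of `G` with `v · α = α · w`. -/
@[ext] structure Hom [Category.{v} G] (x y : Inertia G) where
  hom : x.pt ⟶ y.pt
  comm : x.loop ≫ hom = hom ≫ y.loop

variable [DiffeologicalGroupoid.{v} G]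

instance : Groupoid.{v} (Inertia G) where
  Hom := Hom
  id x := ⟨𝟙 x.pt, by simp⟩
  comp f g := ⟨f.hom ≫ g.hom, by rw [← Category.assoc, f.comm, Category.assoc, g.comm,
    Category.assoc]⟩
  id_comp f := Hom.ext (Category.id_comp f.hom)
  comp_id f := Hom.ext (Category.comp_id f.hom)
  assoc f g h := Hom.ext (Category.assoc f.hom g.hom h.hom)
  inv f := ⟨Groupoid.inv f.hom, by
    rw [Groupoid.inv_eq_inv, IsIso.eq_inv_comp, ← Category.assoc, ← f.comm, Category.assoc,
      IsIso.hom_inv_id, Category.comp_id]⟩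
  inv_comp f := Hom.ext (Groupoid.inv_comp f.hom)
  comp_inv f := Hom.ext (Groupoid.comp_inv f.hom)

/-- An arrow `α : v ⟶ w` of `∧G` as a triple `((v, w), α)` of elements of `G₁`. -/
def arrTriple (f : Arr (Inertia G)) : (Arr G × Arr G) × Arr G :=
  ((f.src.toArr, f.tgt.toArr), ⟨f.src.pt, f.tgt.pt, f.hom.hom⟩)

/-- `(∧G)₀` is a subspace of `G₁`, and `(∧G)₁` is a subspace of `G₁ × G₁ × G₁`. -/
instance : DiffeologicalGroupoid.{v} (Inertia G) where
  obDiffeology := inducedDiffeology toArr inferInstance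
  arrDiffeology := inducedDiffeology arrTriple inferInstance
  smooth_src _ _ hp := hp.1.1
  smooth_tgt _ _ hp := hp.1.2
  smooth_id n _ hp := ⟨⟨hp, hp⟩, DiffeologicalGroupoid.smooth_id n _
    (DiffeologicalGroupoid.smooth_src n _ hp)⟩
  smooth_inv n _ hp := ⟨⟨hp.1.2, hp.1.1⟩, DiffeologicalGroupoid.smooth_inv n _ hp.2⟩
  smooth_comp f g hf hg := ⟨⟨hf.1.1, hg.1.2⟩,
    DiffeologicalGroupoid.smooth_comp (fun a => (f a).hom) (fun a => (g a).hom) hf.2 hg.2⟩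

end Inertia

/-! ### Open covers of the circle and loops -/

/-- An open cover of the circle, indexed by `ℕ` (members may be empty). -/
structure CircleCover where
  U : ℕ → Set Circle
  isOpen : ∀ i, IsOpen (U i)
  cover : ∀ z, ∃ i, z ∈ U i

/-- Objects of the groupoid `S¹_W` of an open cover `W`: pairs `(z, i)` with `z ∈ W i`. -/
structure CechOb (W : CircleCover) where
  idx : ℕ
  pt : Circle
  mem : pt ∈ W.U idx

/-- The groupoid `S¹_W` of an open cover: one arrow `(z, i) ⟶ (z, j)` for `z ∈ W i ∩ W j`, and no
others. -/
instance (W : CircleCover) : Groupoid.{0} (CechOb W) where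
  Hom x y := PLift (x.pt = y.pt)
  id _ := ⟨rfl⟩
  comp f g := ⟨f.down.trans g.down⟩
  inv f := ⟨f.down.symm⟩
  id_comp _ := rfl
  comp_id _ := rfl
  assoc _ _ _ := rfl
  inv_comp _ := rfl
  comp_inv _ := rfl

/-- The arrow `(z, i) ⟶ (z, j)` of `S¹_W`. -/
def CechOb.arrow {W : CircleCover} {x y : CechOb W} (h : x.pt = y.pt) : x ⟶ y := ⟨h⟩

/-- Objects of the loop groupoid `LG`: an open cover `W` of the circle with a smooth functor
`S¹_W → G`. The objects of `S¹_W` are the disjoint union of the `W i`, and its arrows are the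
disjoint union of the `W i ∩ W j`. -/
structure Loop (G : Type u) [DiffeologicalGroupoid.{v} G] where
  W : CircleCover
  F : CechOb W ⥤ G
  smooth_obj : ∀ i, DSmooth (fun z : {z : Circle // z ∈ W.U i} => F.obj ⟨i, z.1, z.2⟩)
  smooth_map : ∀ i j, DSmooth (fun z : {z : Circle // z ∈ W.U i ∧ z ∈ W.U j} =>
    (⟨_, _, F.map (CechOb.arrow (x := ⟨i, z.1, z.2.1⟩) (y := ⟨j, z.1, z.2.2⟩) rfl)⟩ : Arr G))

namespace Loop

variable {G : Type u} [DiffeologicalGroupoid.{v} G]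

/-- Arrows of the loop groupoid: smooth natural transformations between the restrictions of two
functors `S¹_W → G` and `S¹_W' → G` to the common refinement formed by the `W i ∩ W' j`. -/
@[ext] structure Hom (L M : Loop G) where
  app : ∀ (x : CechOb L.W) (y : CechOb M.W), x.pt = y.pt → (L.F.obj x ⟶ M.F.obj y)
  natural : ∀ (x x' : CechOb L.W) (y y' : CechOb M.W) (h : x.pt = y.pt) (h' : x'.pt = y'.pt)
    (f : x ⟶ x') (g : y ⟶ y'), L.F.map f ≫ app x' y' h' = app x y h ≫ M.F.map g
  smooth : ∀ i j, DSmooth (fun z : {z : Circle // z ∈ L.W.U i ∧ z ∈ M.W.U j} =>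
    (⟨_, _, app ⟨i, z.1, z.2.1⟩ ⟨j, z.1, z.2.2⟩ rfl⟩ : Arr G))

/-- Smooth families of loops over `ℝⁿ`: the covers form an open cover of `ℝⁿ × S¹`, and the
functors form a smooth functor from the groupoid of this cover to `G`. -/
def IsSmoothFamily {n : ℕ} (L : Param n → Loop G) : Prop :=
  (∀ i, IsOpen {q : Param n × Circle | q.2 ∈ (L q.1).W.U i}) ∧
  (∀ i, DSmooth (fun q : {q : Param n × Circle // q.2 ∈ (L q.1).W.U i} =>
    (L q.1.1).F.obj ⟨i, q.1.2, q.2⟩)) ∧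
  (∀ i j, DSmooth
    (fun q : {q : Param n × Circle // q.2 ∈ (L q.1).W.U i ∧ q.2 ∈ (L q.1).W.U j} =>
      (⟨_, _, (L q.1.1).F.map
        (CechOb.arrow (x := ⟨i, q.1.2, q.2.1⟩) (y := ⟨j, q.1.2, q.2.2⟩) rfl)⟩ : Arr G)))

/-- The pullback of a loop along a smooth self-map `φ` of the circle: the cover consists of the
`φ⁻¹ (W i)`, and the functor is the composite of `S¹_{φ⁻¹ W} → S¹_W` with the given one. -/
def pullback (φ : {φ : Circle → Circle // DSmooth φ ∧ Continuous φ}) (L : Loop G) : Loop G where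
  W :=
    { U := fun i => φ.1 ⁻¹' L.W.U i
      isOpen := fun i => (L.W.isOpen i).preimage φ.2.2
      cover := fun z => L.W.cover (φ.1 z) }
  F :=
    { obj := fun x => L.F.obj ⟨x.idx, φ.1 x.pt, x.mem⟩
      map := fun f => L.F.map (CechOb.arrow (congrArg φ.1 f.down))
      map_id := fun _ => L.F.map_id _
      map_comp := fun _ _ => L.F.map_comp _ _ }
  smooth_obj i n p hp := L.smooth_obj i n
    (fun a => ⟨φ.1 (p a).1, (p a).2⟩) (φ.2.1 n _ hp)
  smooth_map i j n p hp := L.smooth_map i j n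
    (fun a => ⟨φ.1 (p a).1, (p a).2⟩) (φ.2.1 n _ hp)

/-- Rotations of the circle. -/
def rot (θ : Circle) : {φ : Circle → Circle // DSmooth φ ∧ Continuous φ} :=
  ⟨fun z => θ * z, fun _ p hp => by
    let _ := NormedSpace.toDiffeology ℂ
    change ContDiff ℝ ∞ (fun a => ((θ * p a : Circle) : ℂ))
    have hp' : ContDiff ℝ ∞ (fun a => (p a : ℂ)) := hp
    simpa using contDiff_const.mul hp', by fun_prop⟩

theorem pullback_id (h) (L : Loop G) : L.pullback ⟨id, h⟩ = L := rfl

theorem pullback_pullback (φ ψ : {φ : Circle → Circle // DSmooth φ ∧ Continuous φ}) (L : Loop G) :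
    (L.pullback φ).pullback ψ =
      L.pullback ⟨φ.1 ∘ ψ.1, φ.2.1.comp ψ.2.1, φ.2.2.comp ψ.2.2⟩ := rfl

/-- The action of `S¹` on loops by rotation: `(θ • γ)(z) = γ(θ z)`. -/
instance : MulAction Circle (Loop G) where
  smul θ L := L.pullback (rot θ)
  one_smul L := by
    change L.pullback (rot 1) = L
    have : rot 1 = ⟨id, dSmooth_id, continuous_id⟩ := Subtype.ext (funext fun z => one_mul z)
    rw [this]; rfl
  mul_smul θ η L := by
    change L.pullback (rot (θ * η)) = (L.pullback (rot η)).pullback (rot θ)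
    rw [pullback_pullback]
    congr 1
    exact Subtype.ext (funext fun z => by simp [rot, mul_comm θ η, mul_assoc])

/-! The groupoid structure on loops. -/

/-- Some object of `S¹_W` over `z`. -/
def someOb (L : Loop G) (z : Circle) : CechOb L.W :=
  ⟨(L.W.cover z).choose, z, (L.W.cover z).choose_spec⟩

/-- Composites of natural transformations on common refinements, computed at any member of the
middle cover (see `compApp_eq`). -/
def compApp {L M N : Loop G} (f : Hom L M) (g : Hom M N) (x : CechOb L.W) (z : CechOb N.W)
    (h : x.pt = z.pt) : L.F.obj x ⟶ N.F.obj z :=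
  f.app x (M.someOb x.pt) rfl ≫ g.app (M.someOb x.pt) z h

theorem compApp_eq {L M N : Loop G} (f : Hom L M) (g : Hom M N) (x : CechOb L.W) (z : CechOb N.W)
    (h : x.pt = z.pt) (y : CechOb M.W) (hy : x.pt = y.pt) :
    compApp f g x z h = f.app x y hy ≫ g.app y z (hy.symm.trans h) := by
  have h1 := f.natural x x (M.someOb x.pt) y rfl hy (𝟙 x) (CechOb.arrow hy)
  have h2 := g.natural (M.someOb x.pt) y z z h (hy.symm.trans h) (CechOb.arrow hy) (𝟙 z)
  rw [L.F.map_id, Category.id_comp] at h1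
  rw [N.F.map_id, Category.comp_id] at h2
  rw [compApp, ← h2, h1, Category.assoc]

theorem plot_continuous {m : ℕ} {z : Param m → Circle} (hz : IsPlot z) : Continuous z := by
  let _ := NormedSpace.toDiffeology ℂ
  have : ContDiff ℝ ∞ (fun a => (z a : ℂ)) := hz
  exact continuous_induced_rng.2 this.continuous

/-- Composites depend smoothly on parameters. -/
theorem isPlot_compApp {m : ℕ} (L M N : Param m → Loop G) (f : ∀ a, Hom (L a) (M a))
    (g : ∀ a, Hom (M a) (N a)) (z : Param m → Circle) (i k : ℕ)
    (hi : ∀ a, z a ∈ (L a).W.U i) (hk : ∀ a, z a ∈ (N a).W.U k)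
    (hM : ∀ j, IsOpen {a | z a ∈ (M a).W.U j})
    (hf : ∀ (j r : ℕ) (c : Param r → Param m), ContDiff ℝ ∞ c →
      ∀ hj : ∀ b, z (c b) ∈ (M (c b)).W.U j,
      IsPlot (fun b => (⟨_, _, (f (c b)).app ⟨i, z (c b), hi (c b)⟩ ⟨j, z (c b), hj b⟩ rfl⟩ : Arr G)))
    (hg : ∀ (j r : ℕ) (c : Param r → Param m), ContDiff ℝ ∞ c →
      ∀ hj : ∀ b, z (c b) ∈ (M (c b)).W.U j,
      IsPlot (fun b =>
        (⟨_, _, (g (c b)).app ⟨j, z (c b), hj b⟩ ⟨k, z (c b), hk (c b)⟩ rfl⟩ : Arr G))) :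
    IsPlot (fun a =>
      (⟨_, _, compApp (f a) (g a) ⟨i, z a, hi a⟩ ⟨k, z a, hk a⟩ rfl⟩ : Arr G)) := by
  refine DiffeologicalSpace.locality fun a => ?_
  obtain ⟨j, hj⟩ := (M a).W.cover (z a)
  refine ⟨_, hM j, hj, fun {r c} hc hc' => ?_⟩
  have := DiffeologicalGroupoid.smooth_comp _ _ (hf j r c hc' hc) (hg j r c hc' hc)
  refine (congrArg IsPlot (funext fun b => ?_)).mp this
  exact congrArg (Arr.mk _ _) (compApp_eq (f (c b)) (g (c b)) _ _ rfl ⟨j, z (c b), hc b⟩ rfl).symm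

instance : Groupoid.{v} (Loop G) where
  Hom := Hom
  id L :=
    { app := fun _ _ h => L.F.map (CechOb.arrow h)
      natural := fun _ _ _ _ _ _ _ _ => by rw [← L.F.map_comp, ← L.F.map_comp]; rfl
      smooth := L.smooth_map }
  comp {L M N} f g :=
    { app := compApp f g
      natural := fun x x' y y' h h' p q => by
        have h1 := f.natural x x' (M.someOb x.pt) (M.someOb x.pt) rfl p.down.symm p (𝟙 _)
        have h2 := g.natural (M.someOb x.pt) (M.someOb x.pt) y y' h (p.down.trans h') (𝟙 _) q
        rw [M.F.map_id, Category.comp_id] at h1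
        rw [M.F.map_id, Category.id_comp] at h2
        rw [compApp_eq f g x' y' h' (M.someOb x.pt) p.down.symm, ← Category.assoc, h1, h2, compApp,
          Category.assoc]
      smooth := fun i k m p hp => by
        refine isPlot_compApp (fun _ => L) (fun _ => M) (fun _ => N) (fun _ => f) (fun _ => g)
          (fun a => (p a).1) i k (fun a => (p a).2.1) (fun a => (p a).2.2)
          (fun j => (M.W.isOpen j).preimage (plot_continuous hp)) ?_ ?_
        · intro j r c hc hj
          exact f.smooth i j r (fun b => ⟨(p (c b)).1, (p (c b)).2.1, hj b⟩) (isPlot_reparam hp hc)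
        · intro j r c hc hj
          exact g.smooth j k r (fun b => ⟨(p (c b)).1, hj b, (p (c b)).2.2⟩)
            (isPlot_reparam hp hc) }
  inv {L M} f :=
    { app := fun y x h => Groupoid.inv (f.app x y h.symm)
      natural := fun y y' x x' h h' q p => by
        rw [Groupoid.inv_eq_inv, Groupoid.inv_eq_inv, IsIso.eq_inv_comp, ← Category.assoc,
          IsIso.comp_inv_eq]
        exact (f.natural x x' y y' h.symm h'.symm p q).symm
      smooth := fun i j m p hp => DiffeologicalGroupoid.smooth_inv m _
        (f.smooth j i m (fun a => ⟨(p a).1, (p a).2.2, (p a).2.1⟩) hp) }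
  id_comp {L M} f := Hom.ext <| by
    funext x y h
    refine (compApp_eq _ f x y h x rfl).trans ?_
    change L.F.map (𝟙 x) ≫ _ = _
    rw [L.F.map_id, Category.id_comp]
  comp_id {L M} f := Hom.ext <| by
    funext x y h
    refine (compApp_eq f _ x y h y h).trans ?_
    change _ ≫ M.F.map (𝟙 y) = _
    rw [M.F.map_id, Category.comp_id]
  assoc {K L M N} f g k := Hom.ext <| by
    funext x y h
    let l := L.someOb x.pt
    let m := M.someOb x.pt
    refine (compApp_eq _ k x y h m rfl).trans (Eq.trans ?_ (compApp_eq f _ x y h l rfl).symm)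
    change compApp f g x m rfl ≫ _ = _ ≫ compApp g k l y h
    rw [compApp_eq f g x m rfl l rfl, compApp_eq g k l y h m rfl, Category.assoc]
  inv_comp {L M} f := Hom.ext <| by
    funext x y h
    obtain ⟨l, hl⟩ : ∃ l : CechOb L.W, x.pt = l.pt := ⟨L.someOb x.pt, rfl⟩
    refine (compApp_eq _ f x y h l hl).trans ?_
    have := f.natural l l x y hl.symm (hl.symm.trans h) (𝟙 l) (CechOb.arrow h)
    rw [L.F.map_id, Category.id_comp] at this
    change Groupoid.inv (f.app l x hl.symm) ≫ f.app l y _ = M.F.map (CechOb.arrow h)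
    rw [this, Groupoid.inv_eq_inv, IsIso.inv_hom_id_assoc]
  comp_inv {L M} f := Hom.ext <| by
    funext x y h
    obtain ⟨l, hl⟩ : ∃ l : CechOb M.W, x.pt = l.pt := ⟨M.someOb x.pt, rfl⟩
    refine (compApp_eq f _ x y h l hl).trans ?_
    have := f.natural x y l l hl (h.symm.trans hl) (CechOb.arrow h) (𝟙 l)
    rw [M.F.map_id, Category.comp_id] at this
    change f.app x l hl ≫ Groupoid.inv (f.app y l _) = L.F.map (CechOb.arrow h)
    rw [← this, Groupoid.inv_eq_inv, Category.assoc, IsIso.hom_inv_id, Category.comp_id]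

/-- Rotation by `θ` as a functor of the loop groupoid to itself. -/
def rotation (θ : Circle) : Loop G ⥤ Loop G where
  obj L := θ • L
  map {L M} f :=
    { app := fun x y h => Hom.app (L := L) (M := M) f ⟨x.idx, θ * x.pt, x.mem⟩
        ⟨y.idx, θ * y.pt, y.mem⟩ (congrArg (θ * ·) h)
      natural := fun _ _ _ _ _ _ p q => Hom.natural (L := L) (M := M) f _ _ _ _ _ _
        (CechOb.arrow (congrArg (θ * ·) p.down)) (CechOb.arrow (congrArg (θ * ·) q.down))
      smooth := fun i j n p hp => Hom.smooth (L := L) (M := M) f i j n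
        (fun a => ⟨θ * (p a).1, (p a).2⟩) ((rot θ).2.1 n _ hp) }
  map_id _ := rfl
  map_comp {L M N} f g := Hom.ext <| by
    funext x y h
    exact compApp_eq (L := L) (M := M) (N := N) f g _ _ _
      ⟨((θ • M).someOb x.pt).idx, θ * x.pt, ((θ • M).someOb x.pt).mem⟩ rfl

/-! The smooth structure on the loop groupoid. -/

theorem IsSmoothFamily.locality {n : ℕ} {p : Param n → Loop G}
    (hp : ∀ x, ∃ s, IsOpen s ∧ x ∈ s ∧ ∀ {m : ℕ} {f : Param m → Param n},
      (∀ y, f y ∈ s) → ContDiff ℝ ∞ f → IsSmoothFamily (p ∘ f)) : IsSmoothFamily p := by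
  refine ⟨fun i => isOpen_iff_mem_nhds.2 fun q hq => ?_, fun i m r hr => ?_, fun i j m r hr => ?_⟩
  · obtain ⟨s, hs, hqs, h⟩ := hp q.1
    obtain ⟨ε, hε, hb⟩ := Metric.isOpen_iff.1 hs _ hqs
    let e := OpenPartialHomeomorph.univBall q.1 ε
    have ht : e.target = Metric.ball q.1 ε := OpenPartialHomeomorph.univBall_target _ hε
    have hes : e.source = Set.univ := OpenPartialHomeomorph.univBall_source _ _
    have hO := (h (f := e) (fun y => hb (ht ▸ e.map_source (hes ▸ Set.mem_univ y)))
      OpenPartialHomeomorph.contDiff_univBall).1 i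
    have hc : ContinuousOn (fun q : Param n × Circle => (e.symm q.1, q.2))
        (Prod.fst ⁻¹' e.target) :=
      (e.continuousOn_symm.comp continuousOn_fst fun _ h => h).prodMk continuousOn_snd
    have hO' := hc.isOpen_inter_preimage (e.open_target.preimage continuous_fst) hO
    have hqt : q.1 ∈ e.target := ht ▸ Metric.mem_ball_self hε
    refine Filter.mem_of_superset (hO'.mem_nhds ⟨hqt, ?_⟩) ?_
    · change q.2 ∈ (p (e (e.symm q.1))).W.U i
      rw [e.right_inv hqt]; exact hq
    · rintro q' ⟨h1, h2⟩
      change q'.2 ∈ (p (e (e.symm q'.1))).W.U i at h2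
      rw [e.right_inv h1] at h2; exact h2
  · refine DiffeologicalSpace.locality fun b => ?_
    obtain ⟨s, hs, hbs, h⟩ := hp (r b).1.1
    have hr1 : IsPlot (fun a => (r a).1.1) := hr.1
    refine ⟨_, hs.preimage hr1.contDiff.continuous, hbs, fun {k c} hc hc' => ?_⟩
    exact (h (f := fun y => (r (c y)).1.1) hc (hr1.contDiff.comp hc')).2.1 i k
      (fun y => ⟨(y, (r (c y)).1.2), (r (c y)).2⟩) ⟨isPlot_id, isPlot_reparam hr.2 hc'⟩
  · refine DiffeologicalSpace.locality fun b => ?_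
    obtain ⟨s, hs, hbs, h⟩ := hp (r b).1.1
    have hr1 : IsPlot (fun a => (r a).1.1) := hr.1
    refine ⟨_, hs.preimage hr1.contDiff.continuous, hbs, fun {k c} hc hc' => ?_⟩
    exact (h (f := fun y => (r (c y)).1.1) hc (hr1.contDiff.comp hc')).2.2 i j k
      (fun y => ⟨(y, (r (c y)).1.2), (r (c y)).2⟩) ⟨isPlot_id, isPlot_reparam hr.2 hc'⟩

instance : DiffeologicalSpace (Loop G) where
  plots _ := {p | IsSmoothFamily p}
  constant_plots L := ⟨fun i => (L.W.isOpen i).preimage continuous_snd,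
    fun i m r hr => L.smooth_obj i m (fun a => ⟨(r a).1.2, (r a).2⟩) hr.2,
    fun i j m r hr => L.smooth_map i j m (fun a => ⟨(r a).1.2, (r a).2⟩) hr.2⟩
  plot_reparam {n m p f} hp hf := by
    refine ⟨fun i => ?_, fun i k r hr => ?_, fun i j k r hr => ?_⟩
    · exact (hp.1 i).preimage ((hf.continuous.comp continuous_fst).prodMk continuous_snd)
    · exact hp.2.1 i k (fun a => ⟨(f (r a).1.1, (r a).1.2), (r a).2⟩)
        ⟨(hf.comp (IsPlot.contDiff hr.1)).isPlot, hr.2⟩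
    · exact hp.2.2 i j k (fun a => ⟨(f (r a).1.1, (r a).1.2), (r a).2⟩)
        ⟨(hf.comp (IsPlot.contDiff hr.1)).isPlot, hr.2⟩
  locality := IsSmoothFamily.locality

/-- Smooth families of arrows of the loop groupoid over `ℝⁿ`: sources and targets are smooth
families of loops, and the natural transformations depend smoothly on the parameter and the point
of the circle. -/
def IsSmoothArrFamily {n : ℕ} (f : Param n → Arr (Loop G)) : Prop :=
  IsSmoothFamily (fun a => (f a).src) ∧ IsSmoothFamily (fun a => (f a).tgt) ∧
  ∀ i j, DSmooth (fun q : {q : Param n × Circle //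
      q.2 ∈ (f q.1).src.W.U i ∧ q.2 ∈ (f q.1).tgt.W.U j} =>
    (⟨_, _, Hom.app (f q.1.1).hom ⟨i, q.1.2, q.2.1⟩ ⟨j, q.1.2, q.2.2⟩ rfl⟩ : Arr G))

instance : DiffeologicalSpace (Arr (Loop G)) where
  plots _ := {p | IsSmoothArrFamily p}
  constant_plots f := ⟨isPlot_const (x := f.src), isPlot_const (x := f.tgt),
    fun i j m r hr => Hom.smooth f.hom i j m (fun a => ⟨(r a).1.2, (r a).2⟩) hr.2⟩
  plot_reparam {n m p f} hp hf := by
    refine ⟨isPlot_reparam (X := Loop G) (p := fun a => (p a).src) hp.1 hf,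
      isPlot_reparam (X := Loop G) (p := fun a => (p a).tgt) hp.2.1 hf,
      fun i j k r hr => ?_⟩
    exact hp.2.2 i j k (fun a => ⟨(f (r a).1.1, (r a).1.2), (r a).2⟩)
      ⟨(hf.comp (IsPlot.contDiff hr.1)).isPlot, hr.2⟩
  locality {n p} hp := by
    refine ⟨?_, ?_, fun i j m r hr => ?_⟩
    · refine IsSmoothFamily.locality fun x => ?_
      obtain ⟨s, hs, hx, h⟩ := hp x
      exact ⟨s, hs, hx, fun hf hf' => (h hf hf').1⟩
    · refine IsSmoothFamily.locality fun x => ?_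
      obtain ⟨s, hs, hx, h⟩ := hp x
      exact ⟨s, hs, hx, fun hf hf' => (h hf hf').2.1⟩
    · refine DiffeologicalSpace.locality fun b => ?_
      obtain ⟨s, hs, hbs, h⟩ := hp (r b).1.1
      have hr1 : IsPlot (fun a => (r a).1.1) := hr.1
      refine ⟨_, hs.preimage hr1.contDiff.continuous, hbs, fun {k c} hc hc' => ?_⟩
      exact (h (f := fun y => (r (c y)).1.1) hc (hr1.contDiff.comp hc')).2.2 i j k
        (fun y => ⟨(y, (r (c y)).1.2), (r (c y)).2⟩) ⟨isPlot_id, isPlot_reparam hr.2 hc'⟩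

/-- The loop groupoid `LG`. -/
instance : DiffeologicalGroupoid.{v} (Loop G) where
  obDiffeology := inferInstance
  arrDiffeology := inferInstance
  smooth_src _ _ hp := hp.1
  smooth_tgt _ _ hp := hp.2.1
  smooth_id _ _ hp := ⟨hp, hp, hp.2.2⟩
  smooth_inv n p hp := ⟨hp.2.1, hp.1, fun i j m r hr => DiffeologicalGroupoid.smooth_inv m _
    (hp.2.2 j i m (fun a => ⟨(r a).1, (r a).2.2, (r a).2.1⟩) hr)⟩
  smooth_comp {n L M N} f g hf hg := by
    refine ⟨hf.1, hg.2.1, fun i k m r hr => ?_⟩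
    have hr1 : IsPlot (fun a => (r a).1.1) := hr.1
    have hr2 : IsPlot (fun a => (r a).1.2) := hr.2
    refine isPlot_compApp (fun a => L (r a).1.1) (fun a => M (r a).1.1) (fun a => N (r a).1.1)
      (fun a => f (r a).1.1) (fun a => g (r a).1.1) (fun a => (r a).1.2) i k
      (fun a => (r a).2.1) (fun a => (r a).2.2)
      (fun j => (hf.2.1.1 j).preimage (hr1.contDiff.continuous.prodMk (plot_continuous hr2))) ?_ ?_
    · intro j l c hc hj
      exact hf.2.2 i j l (fun b => ⟨(r (c b)).1, (r (c b)).2.1, hj b⟩)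
        ⟨isPlot_reparam hr1 hc, isPlot_reparam hr2 hc⟩
    · intro j l c hc hj
      exact hg.2.2 j k l (fun b => ⟨(r (c b)).1, hj b, (r (c b)).2.2⟩)
        ⟨isPlot_reparam hr1 hc, isPlot_reparam hr2 hc⟩

/-- A loop is fixed by the circle action on the orbifold `LG` if each of its rotations is
isomorphic to it, that is, if its class in the orbit space of `LG` is a fixed point. -/
def IsFixed (L : Loop G) : Prop := ∀ θ : Circle, Nonempty ((rotation θ).obj L ⟶ L)

end Loop

/-- The fixed suborbifold `(LG)^{S¹}`: the full subgroupoid of `LG` on the fixed loops. -/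
abbrev FixedLoops (G : Type u) [DiffeologicalGroupoid.{v} G] : Type (max u v) :=
  FullSub (Loop.IsFixed (G := G))

/-! ### Constant loops with holonomy -/

/-- The cover of the circle by the arcs `S¹ ∖ {1}` and `S¹ ∖ {-1}`. -/
def arcs : CircleCover where
  U i := if i = 0 then {1}ᶜ else if i = 1 then {-1}ᶜ else ∅
  isOpen i := by
    split_ifs
    · exact isOpen_compl_singleton
    · exact isOpen_compl_singleton
    · exact isOpen_empty
  cover z := by
    by_cases h : z = 1
    · refine ⟨1, ?_⟩
      simp only [one_ne_zero, if_false, if_true, Set.mem_compl_iff, Set.mem_singleton_iff]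
      rw [h]
      intro h'
      have := congrArg (fun z : Circle => (z : ℂ).re) h'
      norm_num at this
    · exact ⟨0, by simpa using h⟩

namespace Inertia

variable {G : Type u} [DiffeologicalGroupoid.{v} G]

open Classical in
/-- The change of frame which is `v` on the lower half of the arc `S¹ ∖ {-1}` and the identity
everywhere else. -/
def frame (v : Inertia G) (i : ℕ) (z : Circle) : v.pt ⟶ v.pt :=
  if i = 1 ∧ (z : ℂ).im < 0 then v.loop else 𝟙 v.pt

theorem frame_locally_constant {v w : Inertia G} (α : v ⟶ w) (i j : ℕ) (z : Circle)
    (hi : z ∈ arcs.U i) (hj : z ∈ arcs.U j) :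
    ∃ (O : Set Circle) (β : v.pt ⟶ w.pt), IsOpen O ∧ z ∈ O ∧
      ∀ z' ∈ O, Groupoid.inv (v.frame i z') ≫ Hom.hom α ≫ w.frame j z' = β := by
  have him : Continuous (fun z : Circle => (z : ℂ).im) := by fun_prop
  have hα : Groupoid.inv v.loop ≫ Hom.hom α ≫ w.loop = Hom.hom α := by
    rw [← Hom.comm α, Groupoid.inv_eq_inv, IsIso.inv_hom_id_assoc]
  by_cases hij : i = j
  · subst hij
    refine ⟨Set.univ, Hom.hom α, isOpen_univ, trivial, fun z' _ => ?_⟩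
    unfold frame
    split_ifs
    · exact hα
    · simp
  · have hz : (z : ℂ).im ≠ 0 := by
      intro h0
      have hn := Complex.sq_norm (z : ℂ)
      rw [Circle.norm_coe, Complex.normSq_apply, h0] at hn
      have hre : (z : ℂ).re = 1 ∨ (z : ℂ).re = -1 := by
        rw [← sq_eq_one_iff]; nlinarith
      have h1 : z = 1 ∨ z = -1 := by
        rcases hre with h | h
        · left; apply Circle.ext; apply Complex.ext <;> simp [h, h0]
        · right; apply Circle.ext; apply Complex.ext <;> simp [h, h0]
      have hi' : i = 0 ∨ i = 1 := by
        by_contra hc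
        rw [not_or] at hc
        simp [arcs, hc.1, hc.2] at hi
      have hj' : j = 0 ∨ j = 1 := by
        by_contra hc
        rw [not_or] at hc
        simp [arcs, hc.1, hc.2] at hj
      rcases hi' with rfl | rfl <;> rcases hj' with rfl | rfl <;> simp [arcs] at hi hj hij <;>
        rcases h1 with h | h <;> contradiction
    rcases lt_or_gt_of_ne hz with h | h
    · refine ⟨{z' | (z' : ℂ).im < 0}, Groupoid.inv (v.frame i z) ≫ Hom.hom α ≫ w.frame j z,
         isOpen_lt him continuous_const, h, fun z' hz' => ?_⟩
      have hz'' : (z' : ℂ).im < 0 := hz'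
      have e1 : v.frame i z' = v.frame i z := by simp [frame, h, hz'']
      have e2 : w.frame j z' = w.frame j z := by simp [frame, h, hz'']
      rw [e1, e2]
    · refine ⟨{z' | 0 < (z' : ℂ).im}, Groupoid.inv (v.frame i z) ≫ Hom.hom α ≫ w.frame j z,
         isOpen_lt continuous_const him, h, fun z' hz' => ?_⟩
      have hz'' : 0 < (z' : ℂ).im := hz'
      have e1 : v.frame i z' = v.frame i z := by simp [frame, h.not_gt, hz''.not_gt]
      have e2 : w.frame j z' = w.frame j z := by simp [frame, h.not_gt, hz''.not_gt]
      rw [e1, e2]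

theorem frame_comp {a b c : G} (p : a ⟶ a) (α : a ⟶ b) (q : b ⟶ b) (β : b ⟶ c) (r : c ⟶ c) :
    Groupoid.inv p ≫ (α ≫ β) ≫ r = (Groupoid.inv p ≫ α ≫ q) ≫ (Groupoid.inv q ≫ β ≫ r) := by
  simp

theorem frame_smooth {v w : Inertia G} (α : v ⟶ w) (i j : ℕ) :
    DSmooth (fun z : {z : Circle // z ∈ arcs.U i ∧ z ∈ arcs.U j} =>
      (⟨v.pt, w.pt, Groupoid.inv (v.frame i z.1) ≫ Hom.hom α ≫ w.frame j z.1⟩ : Arr G)) := by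
  intro n p hp
  refine DiffeologicalSpace.locality fun a => ?_
  obtain ⟨O, β, hO, haO, h⟩ := frame_locally_constant α i j (p a).1 (p a).2.1 (p a).2.2
  refine ⟨_, hO.preimage (Loop.plot_continuous hp), haO, fun {m f} hf _ => ?_⟩
  refine (congrArg IsPlot (funext fun b => ?_)).mp (isPlot_const (x := (⟨v.pt, w.pt, β⟩ : Arr G)))
  exact congrArg (Arr.mk v.pt w.pt) (h _ (hf b)).symm

/-- The constant loop at `s(v) = t(v)` with holonomy `v`: the functor from the groupoid of the
cover by two arcs which is constant on objects, whose value on the arrow from `S¹ ∖ {1}` to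
`S¹ ∖ {-1}` is `v` over the lower half circle and the identity over the upper half circle. -/
def constLoop (v : Inertia G) : Loop G where
  W := arcs
  F :=
    { obj := fun _ => v.pt
      map := fun {x y} _ => Groupoid.inv (v.frame x.idx x.pt) ≫ v.frame y.idx y.pt
      map_id := fun _ => Groupoid.inv_comp _
      map_comp := fun _ _ => by simp }
  smooth_obj _ _ _ _ := isPlot_const
  smooth_map i j n p hp := by
    refine (congrArg IsPlot (funext fun a => ?_)).mp (frame_smooth (𝟙 v) i j n p hp)
    exact congrArg (Arr.mk v.pt v.pt) (congrArg (_ ≫ ·) (Category.id_comp _))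

variable (G) in
/-- The functor `∧G → LG` sending `v` to the constant loop with holonomy `v`. An arrow `α` of `∧G`
is sent to the transformation which is `α` between the values on the same arc. -/
def constLoops : Inertia G ⥤ Loop G where
  obj v := v.constLoop
  map {v w} α :=
    { app := fun x y _ => Groupoid.inv (v.frame x.idx x.pt) ≫ Hom.hom α ≫ w.frame y.idx y.pt
      natural := fun _ _ _ _ _ _ _ _ => by simp [constLoop]
      smooth := frame_smooth α }
  map_id v := Loop.Hom.ext <| by
    funext x y _
    exact congrArg (_ ≫ ·) (Category.id_comp _)
  map_comp {u v w} α β := Loop.Hom.ext <| by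
    funext x y h
    refine Eq.trans ?_ (Loop.compApp_eq (L := u.constLoop) (M := v.constLoop) (N := w.constLoop)
      _ _ x y h (v.constLoop.someOb x.pt) rfl).symm
    exact frame_comp (u.frame x.idx x.pt) (Hom.hom α)
      (v.frame (v.constLoop.someOb x.pt).idx (v.constLoop.someOb x.pt).pt) (Hom.hom β)
      (w.frame y.idx y.pt)

end Inertia

end Orb

end

noncomputable section

namespace Orb

/-! ### Local smoothness and local diffeomorphisms between diffeological spaces -/

section Diffeology

variable {X Y Z : Type*} [DiffeologicalSpace X] [DiffeologicalSpace Y] [DiffeologicalSpace Z]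

/-! Inertia groupoid. A local section of the source map through a loop `v` at `x`, followed by the
target map, is a smooth germ `φ` of `G₀` fixing `x`, and the loops near `v` are the fixed points of
`φ`. Since the anchor is proper and the source is a local diffeomorphism, isotropy groups are
torsion, so `φ` has finite order near `x`. Averaging linearizes `φ`, and its fixed points become a
linear subspace: this is `Inertia.exists_chart`. These charts extend to open sets of arrows of `G`,
so `∧G` has the subspace topology, and Hausdorffness, paracompactness and properness are inherited
from `G`.

Fixed loops. All values of a fixed loop are isomorphic, and orbits are discrete
(`IsOrbifoldGroupoid.eventually_orbit_eq`), so the loop is locally constant on objects; the source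
being a local diffeomorphism, its arrows are locally constant too. Such a loop is trivialized over
an interval longer than a full turn. Comparing the trivialization with its translate by `2π` gives a
constant arrow, the holonomy, and an isomorphism to a constant loop
(`Loop.IsFlat.exists_hom_constLoop`). A transformation between constant loops is constant on each
arc; naturality over the upper half circle identifies the two constants, and over the lower half
circle it says that they intertwine the holonomies (`Inertia.exists_map_eq`).

Local diffeomorphism. A transformation from a fixed loop `L` to a constant loop is determined by its
value at `-1`, and every arrow out of `L(-1)` occurs. So the map to be shown a local diffeomorphism
is modelled on the pullback of the source map of `G` along evaluation at `-1`. That the local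
inverse is smooth is `Inertia.isSmoothArrFamily_of_base`: smoothness in the parameter at one point
of the circle propagates to all points and to the holonomy. -/

theorem exists_univ_reparam {n : ℕ} {s : Set (Param n)} (hs : IsOpen s) {a : Param n}
    (ha : a ∈ s) : ∃ e : OpenPartialHomeomorph (Param n) (Param n),
      a ∈ e.target ∧ (∀ y, e y ∈ s) ∧ ContDiff ℝ ∞ e ∧ ContDiffOn ℝ ∞ e.symm e.target := by
  obtain ⟨ε, hε, hb⟩ := Metric.isOpen_iff.1 hs _ ha
  have ht := OpenPartialHomeomorph.univBall_target a hε
  refine ⟨OpenPartialHomeomorph.univBall a ε, ht ▸ Metric.mem_ball_self hε, fun y => ?_,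
    OpenPartialHomeomorph.contDiff_univBall, ?_⟩
  · refine hb (ht ▸ OpenPartialHomeomorph.map_source _ ?_)
    rw [OpenPartialHomeomorph.univBall_source]
    trivial
  · rw [ht]
    exact OpenPartialHomeomorph.contDiffOn_univBall_symm

/-- Plots have all of `ℝⁿ` as domain, so openness near a point is tested after reparametrizing onto
a small ball. The dependent form serves maps such as `L.F.obj`, whose argument contains a proof of
membership in the cover. -/
theorem isOpen_exists_mem {n : ℕ} {P : Param n → Prop} (hP : IsOpen {a | P a})
    (r : ∀ a, P a → X)
    (hr : ∀ c : Param n → Param n, ContDiff ℝ ∞ c → ∀ h : ∀ b, P (c b),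
      IsPlot (fun b => r (c b) (h b)))
    {V : Set X} (hV : IsOpen[dTopology] V) : IsOpen {a | ∃ h, r a h ∈ V} := by
  refine isOpen_iff_mem_nhds.2 fun a ⟨ha, haV⟩ => ?_
  obtain ⟨e, hae, hes, he, -⟩ := exists_univ_reparam hP ha
  have h1 := isOpen_iff_preimages_plots.1 hV _ _ (hr e he hes)
  refine Filter.mem_of_superset ((e.isOpen_inter_preimage_symm h1).mem_nhds ⟨hae, ?_⟩) ?_
  · change r (e (e.symm a)) _ ∈ V
    have : e (e.symm a) = a := e.right_inv hae
    simpa only [this] using haV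
  · rintro b ⟨hb, hb'⟩
    change r (e (e.symm b)) _ ∈ V at hb'
    have hbe : e (e.symm b) = b := e.right_inv hb
    exact ⟨hbe ▸ hes _, by simpa only [hbe] using hb'⟩

theorem isOpen_exists_mem_real {P : ℝ → Prop} (hP : IsOpen {t | P t})
    (r : ∀ t, P t → X)
    (hr : ∀ c : Param 1 → ℝ, ContDiff ℝ ∞ c → ∀ h : ∀ b, P (c b),
      IsPlot (fun b => r (c b) (h b)))
    {V : Set X} (hV : IsOpen[dTopology] V) : IsOpen {t | ∃ h, r t h ∈ V} := by
  have hc : ContDiff ℝ ∞ (fun a : Param 1 => a 0) := by fun_prop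
  have h1 := isOpen_exists_mem (P := fun a : Param 1 => P (a 0)) (hP.preimage hc.continuous)
    (fun a h => r (a 0) h) (fun c hc' h => hr (fun b => c b 0) (hc.comp hc') h) hV
  have hd : Continuous (fun t : ℝ => (WithLp.toLp 2 (fun _ => t) : Param 1)) := by fun_prop
  exact h1.preimage hd

theorem isPlot_of_eventually_eq {n : ℕ} {p : Param n → X}
    (h : ∀ a, ∀ᶠ b in 𝓝 a, p b = p a) : IsPlot p := by
  refine DiffeologicalSpace.locality fun a => ?_
  obtain ⟨s, hs, hso, ha⟩ := eventually_nhds_iff.1 (h a)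
  refine ⟨s, hso, ha, fun {m f} hf _ => ?_⟩
  have : p ∘ f = fun _ => p a := funext fun b => hs _ (hf b)
  rw [this]
  exact isPlot_const

/-- Smoothness of a map on a subset. -/
def SmoothOn (f : X → Y) (U : Set X) : Prop :=
  ∀ (n : ℕ) (p : Param n → X), IsPlot p → (∀ a, p a ∈ U) → IsPlot (f ∘ p)

theorem _root_.Diffeology.DSmooth.smoothOn {f : X → Y} (hf : DSmooth f) (U : Set X) :
    SmoothOn f U := fun n p hp _ => hf n p hp

theorem SmoothOn.isOpen_inter_preimage {f : X → Y} {U : Set X} (hf : SmoothOn f U)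
    (hU : IsOpen[dTopology] U) {V : Set Y} (hV : IsOpen[dTopology] V) :
    IsOpen[dTopology] (U ∩ f ⁻¹' V) := by
  refine isOpen_iff_preimages_plots.2 fun n p hp => ?_
  have := isOpen_exists_mem (P := fun a => p a ∈ U) (isOpen_iff_preimages_plots.1 hU n p hp)
    (fun a _ => f (p a)) (fun c hc h => hf _ _ (isPlot_reparam hp hc) h) hV
  simp only [exists_prop] at this
  exact this

theorem SmoothOn.comp {f : X → Y} {g : Y → Z} {U : Set X} {V : Set Y} (hg : SmoothOn g V)
    (hf : SmoothOn f U) (h : Set.MapsTo f U V) : SmoothOn (g ∘ f) U :=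
  fun n p hp hpU => hg n _ (hf n p hp hpU) fun a => h (hpU a)

theorem SmoothOn.mono {f : X → Y} {U V : Set X} (hf : SmoothOn f V) (h : U ⊆ V) :
    SmoothOn f U := fun n p hp hpU => hf n p hp fun a => h (hpU a)

theorem _root_.Diffeology.DSmooth.isOpen_preimage {f : X → Y} (hf : DSmooth f) {V : Set Y}
    (hV : IsOpen[dTopology] V) : IsOpen[dTopology] (f ⁻¹' V) :=
  isOpen_iff_preimages_plots.2 fun n p hp => isOpen_iff_preimages_plots.1 hV n _ (hf n p hp)

/-- Composition with a parametrization of a small ball is a plot; composing back with its smooth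
inverse gives ordinary smoothness at the point. -/
theorem SmoothOn.contDiffOn {k l : ℕ} {f : Param k → Param l} {U : Set (Param k)}
    (hf : SmoothOn f U) (hU : IsOpen U) : ContDiffOn ℝ ∞ f U := by
  intro a ha
  obtain ⟨e, hae, hes, he, he'⟩ := exists_univ_reparam hU ha
  have h1 : ContDiff ℝ ∞ (f ∘ e) := (hf k e he.isPlot hes).contDiff
  have h2 : ContDiffOn ℝ ∞ ((f ∘ e) ∘ e.symm) e.target := h1.comp_contDiffOn he'
  have h3 : ContDiffOn ℝ ∞ f e.target := h2.congr fun b hb => by simp [e.right_inv hb]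
  exact (h3.contDiffAt (e.open_target.mem_nhds hae)).contDiffWithinAt

variable (X Y) in
/-- Diffeomorphisms between open subsets. -/
structure LocalDiffeo extends PartialEquiv X Y where
  open_source : IsOpen[dTopology] source
  open_target : IsOpen[dTopology] target
  smooth : SmoothOn toFun source
  smooth_symm : SmoothOn invFun target

namespace LocalDiffeo

theorem image_isOpen (e : LocalDiffeo X Y) {N : Set X} (hN : IsOpen[dTopology] N) :
    IsOpen[dTopology] (e.target ∩ e.invFun ⁻¹' N) :=
  e.smooth_symm.isOpen_inter_preimage e.open_target hN

def trans (e : LocalDiffeo X Y) (e' : LocalDiffeo Y Z) : LocalDiffeo X Z where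
  toPartialEquiv := e.toPartialEquiv.trans e'.toPartialEquiv
  open_source := e.smooth.isOpen_inter_preimage e.open_source e'.open_source
  open_target := e'.smooth_symm.isOpen_inter_preimage e'.open_target e.open_target
  smooth := e'.smooth.comp (e.smooth.mono Set.inter_subset_left) fun _ h => h.2
  smooth_symm := e.smooth_symm.comp (e'.smooth_symm.mono Set.inter_subset_left) fun _ h => h.2

open Classical in
theorem exists_of_equiv {U : Set X} {V : Set Y} (hU : IsOpen[dTopology] U)
    (hV : IsOpen[dTopology] V) {x : X} (hx : x ∈ U) (φ : {x // x ∈ U} ≃ {y // y ∈ V})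
    (h : DSmooth φ) (h' : DSmooth φ.symm) :
    ∃ e : LocalDiffeo X Y, e.source = U ∧ e.target = V ∧ ∀ a, φ a = e.toFun a := by
  refine ⟨{ toFun := fun a => if ha : a ∈ U then φ ⟨a, ha⟩ else φ ⟨x, hx⟩
            invFun := fun b => if hb : b ∈ V then φ.symm ⟨b, hb⟩ else x
            source := U
            target := V
            map_source' := fun a ha => by simp [ha]
            map_target' := fun b hb => by simp [hb]
            left_inv' := fun a ha => by simp [ha]
            right_inv' := fun b hb => by simp [hb]
            open_source := hU
            open_target := hV
            smooth := fun n p hp hpU => ?_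
            smooth_symm := fun n p hp hpV => ?_ }, rfl, rfl, fun a => ?_⟩
  · have := h n (fun a => ⟨p a, hpU a⟩) hp
    refine (congrArg IsPlot (funext fun a => ?_)).mp
        (show IsPlot (fun a => (φ ⟨p a, hpU a⟩ : Y)) from this)
    simp [hpU a]
  · have := h' n (fun a => ⟨p a, hpV a⟩) hp
    refine (congrArg IsPlot (funext fun a => ?_)).mp
        (show IsPlot (fun a => (φ.symm ⟨p a, hpV a⟩ : X)) from this)
    simp [hpV a]
  · simp [a.2]

def equiv (e : LocalDiffeo X Y) : {x // x ∈ e.source} ≃ {y // y ∈ e.target} where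
  toFun a := ⟨e.toFun a, e.map_source a.2⟩
  invFun b := ⟨e.invFun b, e.map_target b.2⟩
  left_inv a := Subtype.ext (e.left_inv a.2)
  right_inv b := Subtype.ext (e.right_inv b.2)

theorem dSmooth_equiv (e : LocalDiffeo X Y) : DSmooth e.equiv :=
  fun n p hp => e.smooth n (fun a => (p a).1) hp fun a => (p a).2

theorem dSmooth_equiv_symm (e : LocalDiffeo X Y) : DSmooth e.equiv.symm :=
  fun n p hp => e.smooth_symm n (fun a => (p a).1) hp fun a => (p a).2

end LocalDiffeo

/-- Replaces bijections between subtypes by partial equivalences of total functions, which compose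
without carrying membership proofs. -/
theorem isEtale_iff {f : X → Y} : IsEtale f ↔
    DSmooth f ∧ ∀ x, ∃ e : LocalDiffeo X Y, x ∈ e.source ∧ ∀ a ∈ e.source, e.toFun a = f a := by
  refine and_congr_right fun _ => forall_congr' fun x => ⟨?_, ?_⟩
  · rintro ⟨U, V, hU, hV, hx, φ, h, h', hφ⟩
    obtain ⟨e, rfl, -, he⟩ := LocalDiffeo.exists_of_equiv hU hV hx φ h h'
    exact ⟨e, hx, fun a ha => (he ⟨a, ha⟩).symm.trans (hφ ⟨a, ha⟩)⟩
  · rintro ⟨e, hx, he⟩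
    exact ⟨e.source, e.target, e.open_source, e.open_target, hx, e.equiv, e.dSmooth_equiv,
      e.dSmooth_equiv_symm, fun a => he a a.2⟩

theorem IsSmoothManifold.exists_chart (hX : IsSmoothManifold X) (x : X) :
    ∃ (k : ℕ) (e : LocalDiffeo X (Param k)), x ∈ e.source := by
  obtain ⟨k, U, V, hU, hV, hx, φ, h, h'⟩ := hX.chart x
  obtain ⟨e, rfl, -, he⟩ := LocalDiffeo.exists_of_equiv hU hV hx φ h h'
  exact ⟨k, e, hx⟩

theorem isSmoothManifold_of_chart (h2 : @T2Space X dTopology) (hp : @ParacompactSpace X dTopology)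
    (h : ∀ x : X, ∃ (k : ℕ) (e : LocalDiffeo X (Param k)), x ∈ e.source) :
    IsSmoothManifold X where
  hausdorff := h2
  paracompact := hp
  chart x := by
    obtain ⟨k, e, he⟩ := h x
    exact ⟨k, e.source, e.target, e.open_source, e.open_target, he, e.equiv, e.dSmooth_equiv,
      e.dSmooth_equiv_symm⟩

theorem IsEtale.exists_nhds_injOn {f : X → Y} (hf : IsEtale f) (x : X) :
    ∃ U : Set X, IsOpen[dTopology] U ∧ x ∈ U ∧ Set.InjOn f U := by
  obtain ⟨e, hx, he⟩ := (isEtale_iff.1 hf).2 x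
  refine ⟨e.source, e.open_source, hx, fun a ha b hb hab => ?_⟩
  rw [← he a ha, ← he b hb] at hab
  exact e.toPartialEquiv.injOn ha hb hab

end Diffeology

/-- The preimage of a paracompact space under a proper map is paracompact. -/
theorem _root_.IsProperMap.paracompactSpace {X Y : Type u} [TopologicalSpace X]
    [TopologicalSpace Y] [ParacompactSpace Y] {f : X → Y} (hf : IsProperMap f) :
    ParacompactSpace X := by
  refine ⟨fun α s ho hc => ?_⟩
  have key : ∀ y, ∃ (t : Finset α) (V : Set Y), IsOpen V ∧ y ∈ V ∧ f ⁻¹' V ⊆ ⋃ i ∈ t, s i := by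
    intro y
    -- The compact fibre is covered by finitely many `s i`; as `f` is a closed map, the same members
    -- cover the preimage of a neighbourhood of `y`.
    obtain ⟨t, ht⟩ := (hf.isCompact_preimage (isCompact_singleton (x := y))).elim_finite_subcover s
      ho (by rw [hc]; exact Set.subset_univ _)
    have hO : IsOpen (⋃ i ∈ t, s i) := isOpen_biUnion fun i _ => ho i
    refine ⟨t, (f '' (⋃ i ∈ t, s i)ᶜ)ᶜ, (hf.isClosedMap _ hO.isClosed_compl).isOpen_compl, ?_, ?_⟩
    · rintro ⟨x, hx, hxy⟩
      exact hx (ht hxy)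
    · intro x hx
      by_contra hx'
      exact hx ⟨x, hx', rfl⟩
  choose t V hVo hyV hV using key
  obtain ⟨w, hwo, hwc, hwl, hwV⟩ := precise_refinement V hVo
    (Set.eq_univ_of_forall fun y => Set.mem_iUnion.2 ⟨y, hyV y⟩)
  -- Each pulled back set of the locally finite refinement is cut by finitely many `s i`, so local
  -- finiteness survives.
  refine ⟨Σ y, {i // i ∈ t y}, fun q => f ⁻¹' w q.1 ∩ s q.2, fun q =>
    ((hwo _).preimage hf.continuous).inter (ho _), ?_, ?_, fun q => ⟨q.2, Set.inter_subset_right⟩⟩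
  · refine Set.eq_univ_of_forall fun x => ?_
    obtain ⟨y, hy⟩ := Set.mem_iUnion.1 (hwc ▸ Set.mem_univ (f x))
    obtain ⟨i, hi, hxi⟩ := Set.mem_iUnion₂.1 (hV y (hwV y hy))
    exact Set.mem_iUnion.2 ⟨⟨y, i, hi⟩, hy, hxi⟩
  · intro x
    obtain ⟨N, hN, hfin⟩ := hwl (f x)
    refine ⟨f ⁻¹' N, hf.continuous.continuousAt hN, ?_⟩
    refine (hfin.biUnion fun y _ => Set.finite_range
      (fun i : {i // i ∈ t y} => (⟨y, i⟩ : Σ y, {i // i ∈ t y}))).subset ?_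
    rintro ⟨y, i⟩ ⟨x', ⟨hx1, _⟩, hx2⟩
    exact Set.mem_biUnion (show y ∈ {y | (w y ∩ N).Nonempty} from ⟨f x', hx1, hx2⟩) ⟨i, rfl⟩

/-! ### Linearization of finite-order germs -/

section Linearization

theorem iterate_tendsto {E : Type*} [TopologicalSpace E] {ψ : E → E} {p₀ : E}
    (hc : ContinuousAt ψ p₀) (h0 : ψ p₀ = p₀) (i : ℕ) :
    Filter.Tendsto ψ^[i] (𝓝 p₀) (𝓝 p₀) := by
  have h := hc.iterate h0 i
  have h' : ψ^[i] p₀ = p₀ := Function.iterate_fixed h0 i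
  rw [ContinuousAt, h'] at h
  exact h

variable {E : Type*} [NormedAddCommGroup E] [NormedSpace ℝ E]

theorem eventually_contDiffAt_iterate {ψ : E → E} {p₀ : E} (hc : ContinuousAt ψ p₀)
    (h0 : ψ p₀ = p₀) (h : ∀ᶠ p in 𝓝 p₀, ContDiffAt ℝ ∞ ψ p) (i : ℕ) :
    ∀ᶠ p in 𝓝 p₀, ContDiffAt ℝ ∞ ψ^[i] p := by
  induction i with
  | zero => exact .of_forall fun p => contDiffAt_id
  | succ i ih =>
    filter_upwards [ih, (iterate_tendsto hc h0 i).eventually h] with p h1 h2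
    rw [Function.iterate_succ']
    exact h2.comp p h1

/-- A smooth map with a fixed point near which it has finite order is linear in a suitable chart
(average an arbitrary chart); so its fixed points near the given one form a linear subspace. -/
theorem exists_linearizing_chart [CompleteSpace E] {ψ : E → E} {O : Set E} (hO : IsOpen O) {p₀ : E}
    (hp : p₀ ∈ O) (hψ : ContDiffOn ℝ ∞ ψ O) (h0 : ψ p₀ = p₀) {m : ℕ} (hm : 0 < m)
    (hit : ∀ᶠ p in 𝓝 p₀, ψ^[m] p = p) :
    ∃ (h : OpenPartialHomeomorph E E) (A : E →L[ℝ] E), p₀ ∈ h.source ∧ h.source ⊆ O ∧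
      ContDiffOn ℝ ∞ h h.source ∧ ContDiffOn ℝ ∞ h.symm h.target ∧
      ∀ p ∈ h.source, ψ p = p ↔ A (h p) = h p := by
  have hψ0 : ContDiffAt ℝ ∞ ψ p₀ := hψ.contDiffAt (hO.mem_nhds hp)
  have hev : ∀ᶠ p in 𝓝 p₀, ContDiffAt ℝ ∞ ψ p := by
    filter_upwards [hO.mem_nhds hp] with p hp'
    exact hψ.contDiffAt (hO.mem_nhds hp')
  set A : E →L[ℝ] E := fderiv ℝ ψ p₀ with hAdef
  have hA : HasFDerivAt ψ A p₀ := (hψ0.differentiableAt (by simp)).hasFDerivAt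
  have hAm : A ^ m = 1 := by
    refine (hA.iterate h0 m).unique ?_
    exact (hasFDerivAt_id p₀).congr_of_eventuallyEq hit
  -- Since `A ^ m = 1`, the factor `A ^ (m - i)` is inverse to `A ^ i`: `H` averages the identity
  -- chart over the iterates of `ψ`, and its derivative at `p₀` is the identity.
  let H : E → E := fun p => (m : ℝ)⁻¹ • ∑ i ∈ Finset.range m, (A ^ (m - i)) (ψ^[i] p)
  have hHψ : ∀ p, ψ^[m] p = p → H (ψ p) = A (H p) := by
    intro p hpm
    simp only [H, map_smul, map_sum]
    congr 1
    -- Up to the scalar, `H (ψ p)` and `A (H p)` sum the sequence `A ^ (m + 1 - j) (ψ^[j] p)` over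
    -- `1 ≤ j ≤ m` and over `0 ≤ j < m`; the extreme terms `j = 0` and `j = m` agree.
    have e1 : ∀ i ∈ Finset.range m, (A ^ (m - i)) (ψ^[i] (ψ p)) =
        (fun j => (A ^ (m + 1 - j)) (ψ^[j] p)) (i + 1) := by
      intro i hi
      rw [← Function.iterate_succ_apply]
      simp
    have e2 : ∀ i ∈ Finset.range m, A ((A ^ (m - i)) (ψ^[i] p)) =
        (fun j => (A ^ (m + 1 - j)) (ψ^[j] p)) i := by
      intro i hi
      have : m + 1 - i = (m - i) + 1 := by have := Finset.mem_range.1 hi; omega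
      simp only [this, pow_succ']
      rfl
    rw [Finset.sum_congr rfl e1, Finset.sum_congr rfl e2]
    have := Finset.sum_range_succ' (fun j => (A ^ (m + 1 - j)) (ψ^[j] p)) m
    rw [Finset.sum_range_succ] at this
    have e3 : (A ^ (m + 1 - m)) (ψ^[m] p) = (A ^ (m + 1 - 0)) (ψ^[0] p) := by
      rw [hpm, Nat.add_sub_cancel_left, Nat.sub_zero, pow_succ A m, hAm]
      simp
    rw [e3] at this
    exact (add_right_cancel this).symm
  have hHd : HasFDerivAt H ((ContinuousLinearEquiv.refl ℝ E : E ≃L[ℝ] E) : E →L[ℝ] E) p₀ := by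
    have h1 : HasFDerivAt H ((m : ℝ)⁻¹ • ∑ i ∈ Finset.range m, (A ^ (m - i)).comp (A ^ i)) p₀ :=
      (HasFDerivAt.fun_sum fun i _ =>
        (A ^ (m - i)).hasFDerivAt.comp p₀ (hA.iterate h0 i)).const_smul _
    convert h1 using 1
    have : ∀ i ∈ Finset.range m, (A ^ (m - i)).comp (A ^ i) = ContinuousLinearMap.id ℝ E := by
      intro i hi
      change A ^ (m - i) * A ^ i = 1
      rw [← pow_add, Nat.sub_add_cancel (Finset.mem_range.1 hi).le, hAm]
    rw [Finset.sum_congr rfl this, Finset.sum_const, Finset.card_range, ← Nat.cast_smul_eq_nsmul ℝ,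
      smul_smul, inv_mul_cancel₀ (by exact_mod_cast hm.ne'), one_smul]
    rfl
  have hHs : ∀ᶠ p in 𝓝 p₀, ContDiffAt ℝ ∞ H p := by
    have : ∀ᶠ p in 𝓝 p₀, ∀ i ∈ Finset.range m, ContDiffAt ℝ ∞ ψ^[i] p :=
      (Filter.eventually_all_finset _).2 fun i _ =>
        eventually_contDiffAt_iterate hψ0.continuousAt h0 hev i
    filter_upwards [this] with p hp'
    exact contDiffAt_const.smul (ContDiffAt.sum fun i hi =>
      (A ^ (m - i)).contDiff.contDiffAt.comp p (hp' i hi))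
  have hH0 : ContDiffAt ℝ ∞ H p₀ := hHs.self_of_nhds
  have hHe : ∀ᶠ p in 𝓝 p₀, ∃ e : E ≃L[ℝ] E, (e : E →L[ℝ] E) = fderiv ℝ H p := by
    have hc : ContinuousAt (fderiv ℝ H) p₀ := (hH0.fderiv_right (m := 0) (by simp)).continuousAt
    have := ContinuousLinearEquiv.nhds (ContinuousLinearEquiv.refl ℝ E)
    rw [← hHd.fderiv] at this
    exact hc this
  let g := hH0.toOpenPartialHomeomorph H hHd (by simp)
  have hg : ∀ p, g p = H p := fun p => rfl
  have hg0 : p₀ ∈ g.source := hH0.mem_toOpenPartialHomeomorph_source hHd (by simp)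
  have hgs : ∀ᶠ p in 𝓝 p₀, p ∈ g.source := g.open_source.mem_nhds hg0
  -- Injectivity of `H` will be applied to the pair `p`, `ψ p`, so `ψ p` has to lie in the source of
  -- `g` as well.
  have hall : ∀ᶠ p in 𝓝 p₀, p ∈ O ∧ ContDiffAt ℝ ∞ H p ∧
      (∃ e : E ≃L[ℝ] E, (e : E →L[ℝ] E) = fderiv ℝ H p) ∧ ψ^[m] p = p ∧ ψ p ∈ g.source :=
    (hO.eventually_mem hp).and (hHs.and (hHe.and (hit.and
      ((iterate_tendsto hψ0.continuousAt h0 1).eventually hgs))))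
  obtain ⟨N, hN, hNo, hN0⟩ := eventually_nhds_iff.1 hall
  refine ⟨g.restrOpen N hNo, A, ⟨hg0, hN0⟩, fun p hp' => (hN p hp'.2).1,
    fun p hp' => (hN p hp'.2).2.1.contDiffWithinAt, fun q hq => ?_, fun p hp' => ?_⟩
  · have hq' : (g.restrOpen N hNo).symm q ∈ (g.restrOpen N hNo).source :=
      (g.restrOpen N hNo).map_target hq
    obtain ⟨-, h1, ⟨e, he⟩, -⟩ := hN _ hq'.2
    refine ((g.restrOpen N hNo).contDiffAt_symm (f₀' := e) hq ?_ h1).contDiffWithinAt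
    rw [he]
    exact (h1.differentiableAt (by simp)).hasFDerivAt
  · obtain ⟨-, -, -, h1, h2⟩ := hN _ hp'.2
    change _ ↔ A (H p) = H p
    rw [← hHψ p h1]
    exact ⟨fun h => by rw [h], fun h => g.injOn h2 hp'.1 h⟩

end Linearization

/-- The neighbourhood filter of the D-topology. -/
abbrev dNhds {X : Type*} [DiffeologicalSpace X] (x : X) : Filter X := @nhds X dTopology x

theorem mem_dNhds {X : Type*} [DiffeologicalSpace X] {x : X} {s : Set X} :
    s ∈ dNhds x ↔ ∃ t ⊆ s, IsOpen[dTopology] t ∧ x ∈ t := by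
  let _ : TopologicalSpace X := dTopology
  exact mem_nhds_iff

theorem SmoothOn.tendsto {X Y : Type*} [DiffeologicalSpace X] [DiffeologicalSpace Y] {f : X → Y}
    {U : Set X} (hf : SmoothOn f U) (hU : IsOpen[dTopology] U) {x : X} (hx : x ∈ U) :
    Filter.Tendsto f (dNhds x) (dNhds (f x)) := by
  intro s hs
  obtain ⟨t, hts, ht, hxt⟩ := mem_dNhds.1 hs
  exact mem_dNhds.2 ⟨U ∩ f ⁻¹' t, fun y hy => hts hy.2, hf.isOpen_inter_preimage hU ht, hx, hxt⟩

theorem _root_.Diffeology.DSmooth.tendsto {X Y : Type*} [DiffeologicalSpace X]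
    [DiffeologicalSpace Y] {f : X → Y} (hf : DSmooth f) (x : X) :
    Filter.Tendsto f (dNhds x) (dNhds (f x)) :=
  (hf.smoothOn Set.univ).tendsto (@isOpen_univ X dTopology) trivial

/-! ### Consequences of properness: discrete orbits and torsion isotropy -/

section Groupoid

variable {G : Type u} [DiffeologicalGroupoid.{v} G]

open DiffeologicalGroupoid (smooth_src smooth_tgt smooth_id smooth_inv)

open Classical in
/-- Composition of arrows (with junk value if the arrows do not match). -/
def Arr.comp (f g : Arr G) : Arr G :=
  if h : f.tgt = g.src then ⟨f.src, g.tgt, f.hom ≫ eqToHom h ≫ g.hom⟩ else f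

@[simp] theorem Arr.comp_mk {x y z : G} (f : x ⟶ y) (g : y ⟶ z) :
    Arr.comp ⟨x, y, f⟩ ⟨y, z, g⟩ = ⟨x, z, f ≫ g⟩ := by simp [Arr.comp]

theorem Arr.comp_src {f g : Arr G} (h : f.tgt = g.src) : (f.comp g).src = f.src := by
  simp [Arr.comp, h]

theorem Arr.comp_tgt {f g : Arr G} (h : f.tgt = g.src) : (f.comp g).tgt = g.tgt := by
  simp [Arr.comp, h]

/-- The inverse arrow. -/
def Arr.inv (f : Arr G) : Arr G := ⟨f.tgt, f.src, Groupoid.inv f.hom⟩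

theorem isPlot_comp {n : ℕ} {f g : Param n → Arr G} (hf : IsPlot f) (hg : IsPlot g)
    (h : ∀ a, (f a).tgt = (g a).src) : IsPlot (fun a => (f a).comp (g a)) := by
  have h1 : IsPlot (fun a => Arr.mk (f a).tgt (g a).tgt (eqToHom (h a) ≫ (g a).hom)) := by
    refine (congrArg IsPlot (funext fun a => ?_)).mp hg
    generalize g a = k, h a = e
    obtain ⟨x, y, k⟩ := k
    dsimp only at e
    subst e
    simp
  have := DiffeologicalGroupoid.smooth_comp (fun a => (f a).hom) _ hf h1
  refine (congrArg IsPlot (funext fun a => ?_)).mp this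
  simp [Arr.comp, h a]

/-- Anchors converging along an ultrafilter lift to converging arrows. -/
theorem IsOrbifoldGroupoid.exists_limit (hG : IsOrbifoldGroupoid G) {ι : Type*} (l : Ultrafilter ι)
    (a : ι → Arr G) {x y : G} (hx : Filter.Tendsto (fun i => (a i).src) l (dNhds x))
    (hy : Filter.Tendsto (fun i => (a i).tgt) l (dNhds y)) :
    ∃ α : Arr G, α.src = x ∧ α.tgt = y ∧ Filter.Tendsto a l (dNhds α) := by
  let _ : TopologicalSpace G := dTopology
  let _ : TopologicalSpace (Arr G) := dTopology
  obtain ⟨α, hα, hl⟩ := (isProperMap_iff_ultrafilter.1 hG.proper).2 (𝒰 := l.map a) (y := (x, y))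
    (by
      rw [nhds_prod_eq]
      exact hx.prodMk hy)
  exact ⟨α, congrArg Prod.fst hα, congrArg Prod.snd hα, hl⟩

/-- The arrows converge by properness. The source map is injective near the limit and the sources
are eventually equal to `x`, so convergence becomes eventual equality. -/
theorem IsOrbifoldGroupoid.exists_limit_of_src_eq (hG : IsOrbifoldGroupoid G) {ι : Type*}
    (l : Ultrafilter ι) (a : ι → Arr G) {x y : G} (hx : ∀ᶠ i in (l : Filter ι), (a i).src = x)
    (hy : Filter.Tendsto (fun i => (a i).tgt) l (dNhds y)) :
    ∃ α : Arr G, α.src = x ∧ α.tgt = y ∧ ∀ᶠ i in (l : Filter ι), a i = α := by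
  obtain ⟨α, hα, hα', hl⟩ := hG.exists_limit l a (x := x) (y := y)
    (by
      let _ : TopologicalSpace G := dTopology
      exact (tendsto_const_nhds (x := x)).congr' (hx.mono fun _ h => h.symm)) hy
  obtain ⟨U, hU, hαU, hinj⟩ := hG.etale_src.exists_nhds_injOn α
  refine ⟨α, hα, hα', ?_⟩
  filter_upwards [hx, hl (mem_dNhds.2 ⟨U, subset_rfl, hU, hαU⟩)] with i h1 h2
  exact hinj h2 hαU (h1.trans hα.symm)

/-- Orbits of an orbifold groupoid are closed and discrete. -/
theorem IsOrbifoldGroupoid.eventually_orbit_eq (hG : IsOrbifoldGroupoid G) (x₀ x : G) :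
    ∀ᶠ y in dNhds x, Nonempty (x₀ ⟶ y) → y = x := by
  by_contra hcon
  rw [Filter.not_eventually] at hcon
  have := Filter.frequently_iff_neBot.1 hcon
  -- If the claim fails, orbit points other than `x` converge to `x` along an ultrafilter. Arrows
  -- from `x₀` to them are eventually one single arrow ending at `x`, a contradiction.
  obtain ⟨l, hl⟩ := Ultrafilter.exists_le (dNhds x ⊓ Filter.principal
      {y | ¬(Nonempty (x₀ ⟶ y) → y = x)})
  have h1 : ∀ᶠ y in (l : Filter G), ¬(Nonempty (x₀ ⟶ y) → y = x) :=
    hl (Filter.mem_inf_of_right (Filter.mem_principal_self _))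
  classical
  -- Off the orbit the identity is a default, so that the target is `y` in every case.
  let a : G → Arr G := fun y => if h : Nonempty (x₀ ⟶ y) then ⟨x₀, y, h.some⟩ else ⟨y, y, 𝟙 y⟩
  have hat : ∀ y, (a y).tgt = y := fun y => by
    by_cases h : Nonempty (x₀ ⟶ y) <;> simp [a, h]
  have has : ∀ y, Nonempty (x₀ ⟶ y) → (a y).src = x₀ := fun y h => by simp [a, h]
  obtain ⟨α, -, hα, hl'⟩ := hG.exists_limit_of_src_eq l a (x := x₀) (y := x)
    (h1.mono fun y hy => has y (Classical.not_imp.1 hy).1)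
    (by simp only [hat]; exact hl.trans inf_le_left)
  obtain ⟨y, hy, hy'⟩ := (h1.and hl').exists
  exact (Classical.not_imp.1 hy).2 ((hat y).symm.trans (hy' ▸ hα))

/-- Isotropy groups of an orbifold groupoid are torsion (in fact finite). -/
theorem IsOrbifoldGroupoid.exists_pow_eq_one (hG : IsOrbifoldGroupoid G) {x : G} (f : End x) :
    ∃ m, 0 < m ∧ f ^ m = 1 := by
  -- All powers of `f` have the same anchor, so along a nonprincipal ultrafilter they are eventually
  -- equal to one arrow; hence two different exponents give the same power.
  obtain ⟨α, -, -, hl⟩ := hG.exists_limit_of_src_eq (Filter.hyperfilter ℕ)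
    (fun n => ⟨x, x, f ^ n⟩) (x := x) (y := x) (.of_forall fun _ => rfl)
    (by
      let _ : TopologicalSpace G := dTopology
      exact tendsto_const_nhds)
  obtain ⟨n, hn⟩ := hl.exists
  obtain ⟨n', hn', hne⟩ := (hl.and (Filter.compl_mem_hyperfilter_of_finite
    (Set.finite_singleton n))).exists
  have h : f ^ n = f ^ n' := by
    have := hn.trans hn'.symm
    injection this
  rcases lt_or_gt_of_ne (show n' ≠ n from hne) with hlt | hlt
  · exact ⟨n - n', by omega, by rw [pow_sub f hlt.le, h, mul_inv_cancel]⟩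
  · exact ⟨n' - n, by omega, by rw [pow_sub f hlt.le, h, mul_inv_cancel]⟩

end Groupoid

section Groupoid

variable {G : Type u} [DiffeologicalGroupoid.{v} G]

open DiffeologicalGroupoid (smooth_src smooth_tgt smooth_id smooth_inv)

/-- Iterates of the local diffeomorphism `t ∘ s⁻¹` at a loop are induced by the powers of
the loop. -/
theorem exists_iterate_section {σ : G → Arr G} {V : Set G} (hV : IsOpen[dTopology] V)
    (hσ : SmoothOn σ V) (hσs : ∀ y ∈ V, (σ y).src = y) {x : G} (hx : x ∈ V) (f : End x)
    (hf : σ x = ⟨x, x, f⟩) (i : ℕ) :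
    ∃ (N : Set G) (τ : G → Arr G), IsOpen[dTopology] N ∧ x ∈ N ∧ SmoothOn τ N ∧
      (∀ y ∈ N, (τ y).src = y ∧ (τ y).tgt = (fun y => (σ y).tgt)^[i] y) ∧
      τ x = ⟨x, x, f ^ i⟩ := by
  induction i with
  | zero => exact ⟨Set.univ, fun y => ⟨y, y, 𝟙 y⟩, @isOpen_univ _ dTopology, trivial,
      smooth_id.smoothOn _, fun y _ => ⟨rfl, rfl⟩, rfl⟩
  | succ i ih =>
    obtain ⟨N, τ, hN, hxN, hτ, hτs, hτx⟩ := ih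
    have hst : ∀ y ∈ N ∩ (fun y => (τ y).tgt) ⁻¹' V, (τ y).tgt = (σ (τ y).tgt).src :=
      fun y hy => (hσs _ hy.2).symm
    refine ⟨N ∩ (fun y => (τ y).tgt) ⁻¹' V, fun y => (τ y).comp (σ (τ y).tgt),
      (((smooth_tgt.smoothOn Set.univ).comp hτ fun _ _ => trivial)).isOpen_inter_preimage hN hV,
      ⟨hxN, by simpa [hτx] using hx⟩, ?_, ?_, ?_⟩
    · intro n p hp hpN
      have h1 := hτ n p hp fun a => (hpN a).1
      exact isPlot_comp h1 (hσ n _ (smooth_tgt n _ h1) fun a => (hpN a).2) fun a => hst _ (hpN a)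
    · intro y hy
      refine ⟨(Arr.comp_src (hst y hy)).trans (hτs y hy.1).1, (Arr.comp_tgt (hst y hy)).trans ?_⟩
      rw [Function.iterate_succ_apply', (hτs y hy.1).2]
    · dsimp only
      rw [hτx]
      dsimp only
      rw [hf, Arr.comp_mk, pow_succ']
      rfl

/-- Some power `f ^ m` is the identity. The section through it and the unit section then meet at
`x`, and local injectivity of the source map makes them coincide near `x`; the targets give the
claim. -/
theorem IsOrbifoldGroupoid.exists_iterate_eq (hG : IsOrbifoldGroupoid G) {σ : G → Arr G} {V : Set G}
    (hV : IsOpen[dTopology] V) (hσ : SmoothOn σ V) (hσs : ∀ y ∈ V, (σ y).src = y) {x : G}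
    (hx : x ∈ V) (f : End x) (hf : σ x = ⟨x, x, f⟩) :
    ∃ m, 0 < m ∧ ∀ᶠ y in dNhds x, (fun y => (σ y).tgt)^[m] y = y := by
  obtain ⟨m, hm, hfm⟩ := hG.exists_pow_eq_one f
  obtain ⟨N, τ, hN, hxN, hτ, hτs, hτx⟩ := exists_iterate_section hV hσ hσs hx f hf m
  refine ⟨m, hm, ?_⟩
  obtain ⟨U, hU, hxU, hinj⟩ := hG.etale_src.exists_nhds_injOn ⟨x, x, 𝟙 x⟩
  have h1 : ∀ᶠ y in dNhds x, τ y ∈ U := by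
    refine (hτ.tendsto hN hxN) (mem_dNhds.2 ⟨U, subset_rfl, hU, ?_⟩)
    rw [hτx, hfm]
    exact hxU
  have h2 : ∀ᶠ y in dNhds x, Arr.mk y y (𝟙 y) ∈ U :=
    smooth_id.tendsto x (mem_dNhds.2 ⟨U, subset_rfl, hU, hxU⟩)
  filter_upwards [h1, h2, mem_dNhds.2 ⟨N, subset_rfl, hN, hxN⟩] with y h1 h2 h3
  rw [← (hτs y h3).2, hinj h1 h2 (hτs y h3).1]

/-- Coordinates on a subspace, with `r` induced by the orthogonal projection: a chart of a fixed
locus has to take values in some `Param l`. -/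
theorem exists_retraction {k : ℕ} (S : Submodule ℝ (Param k)) :
    ∃ (l : ℕ) (i : Param l →L[ℝ] Param k) (r : Param k →L[ℝ] Param l),
      (∀ x, r (i x) = x) ∧ (∀ x, i x ∈ S) ∧ ∀ y ∈ S, i (r y) = y := by
  let b := (stdOrthonormalBasis ℝ S).repr.toContinuousLinearEquiv
  refine ⟨_, S.subtypeL.comp b.symm.toContinuousLinearMap,
    b.toContinuousLinearMap.comp S.orthogonalProjectionOnto, fun x => ?_, fun x => ?_,
        fun y hy => ?_⟩
  · simp
  · simp
  · simpa using (Submodule.starProjection_eq_self_iff (K := S)).2 hy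

/-! ### Charts and topology on the objects of the inertia groupoid -/

namespace Inertia

theorem toArr_injective : Function.Injective (toArr (G := G)) := by
  rintro ⟨x, f⟩ ⟨y, g⟩ h
  simp only [toArr] at h
  injection h with h1 h2 h3
  subst h1
  rw [eq_of_heq h3]

theorem exists_toArr {α : Arr G} (h : α.src = α.tgt) : ∃ w : Inertia G, w.toArr = α := by
  obtain ⟨x, y, f⟩ := α
  dsimp only at h
  subst h
  exact ⟨⟨x, f⟩, rfl⟩

theorem dSmooth_toArr : DSmooth (toArr (G := G)) := fun _ _ hp => hp

theorem dSmooth_pt : DSmooth (pt : Inertia G → G) := smooth_src.comp dSmooth_toArr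

/-- Near an object of the inertia groupoid, local coordinates extending to the arrows of `G`. -/
theorem exists_chart (hG : IsOrbifoldGroupoid G) (v : Inertia G) :
    ∃ (l : ℕ) (e : LocalDiffeo (Inertia G) (Param l)) (F : Arr G → Param l) (U : Set (Arr G)),
      v ∈ e.source ∧ IsOpen[dTopology] U ∧ SmoothOn F U ∧ e.source = toArr ⁻¹' U ∧
      ∀ w, e.toFun w = F w.toArr := by
  obtain ⟨s, hvs, hs⟩ := (isEtale_iff.1 hG.etale_src).2 v.toArr
  obtain ⟨k, c, hc⟩ := hG.manifold_ob.exists_chart v.pt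
  set σ := s.invFun with hσ
  have hss : ∀ y ∈ s.target, (σ y).src = y := fun y hy =>
    (hs _ (s.map_target hy)).symm.trans (s.right_inv hy)
  have hsx : s.toFun v.toArr = v.pt := hs _ hvs
  have hxV : v.pt ∈ s.target := hsx ▸ s.map_source hvs
  have hσx : σ v.pt = ⟨v.pt, v.pt, v.loop⟩ :=
    (congrArg σ hsx.symm).trans (s.left_inv hvs)
  -- The loops near `v` are the arrows `σ y` at the fixed points `y` of `φ`.
  let φ : G → G := fun y => (σ y).tgt
  have hφx : φ v.pt = v.pt := by simp only [φ]; rw [hσx]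
  have hφ : SmoothOn φ s.target := (smooth_tgt.smoothOn Set.univ).comp
      s.smooth_symm fun _ _ => trivial
  obtain ⟨m, hm, hφm⟩ := hG.exists_iterate_eq s.open_target s.smooth_symm hss hxV v.loop hσx
  let ψ : Param k → Param k := fun p => c.toFun (φ (c.invFun p))
  let p₀ := c.toFun v.pt
  have hcx : c.invFun p₀ = v.pt := c.left_inv hc
  let O₁ : Set G := s.target ∩ φ ⁻¹' c.source
  have hO₁ : IsOpen[dTopology] O₁ := hφ.isOpen_inter_preimage s.open_target c.open_source
  let O : Set (Param k) := c.target ∩ c.invFun ⁻¹' O₁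
  have hO : IsOpen O := c.smooth_symm.isOpen_inter_preimage c.open_target hO₁
  have hpO : p₀ ∈ O := ⟨c.map_source hc, by
    rw [Set.mem_preimage, hcx]; exact ⟨hxV, by rw [Set.mem_preimage, hφx]; exact hc⟩⟩
  have hψ : ContDiffOn ℝ ∞ ψ O := by
    refine SmoothOn.contDiffOn ?_ hO
    intro n p hp hpO
    exact c.smooth n _ (hφ n _ (c.smooth_symm n p hp fun a => (hpO a).1) fun a => (hpO a).2.1)
      fun a => (hpO a).2.2
  have hψ0 : ψ p₀ = p₀ := by simp only [ψ]; rw [hcx, hφx]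
  have hct : Filter.Tendsto c.invFun (𝓝 p₀) (dNhds v.pt) := by
    have := c.smooth_symm.tendsto c.open_target (c.map_source hc)
    rwa [hcx] at this
  have hφt : ∀ i, Filter.Tendsto φ^[i] (dNhds v.pt) (dNhds v.pt) := by
    let _ : TopologicalSpace G := dTopology
    refine fun i => iterate_tendsto ?_ hφx i
    exact hφ.tendsto s.open_target hxV
  have hcs : ∀ᶠ y in dNhds v.pt, y ∈ c.source := mem_dNhds.2 ⟨_, subset_rfl, c.open_source, hc⟩
  -- Iterates in coordinates agree with iterates on `G₀` only near `p₀`, where the intermediate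
  -- points stay in the domain of `c`.
  have hit : ∀ i, ∀ᶠ p in 𝓝 p₀, ψ^[i] p = c.toFun (φ^[i] (c.invFun p)) := by
    intro i
    induction i with
    | zero =>
      filter_upwards [(c.open_target : IsOpen c.target).eventually_mem (c.map_source hc)] with p hp
      exact (c.right_inv hp).symm
    | succ i ih =>
      filter_upwards [ih, hct.eventually ((hφt i).eventually hcs)] with p h1 h2
      rw [Function.iterate_succ_apply', Function.iterate_succ_apply', h1]
      simp only [ψ]
      rw [show c.invFun (c.toFun (φ^[i] (c.invFun p))) = _ from c.left_inv h2]
  have hitm : ∀ᶠ p in 𝓝 p₀, ψ^[m] p = p := by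
    filter_upwards [hit m, hit 0, hct.eventually hφm] with p h1 h2 h3
    rw [h1, h3]
    exact h2.symm
  -- In the coordinates `h` the fixed points of `ψ` lie in the kernel of `A - 1`, which `ι`
  -- parametrizes by `Param l`.
  obtain ⟨h, A, hp₀, hhO, hh, hh', hfix⟩ := exists_linearizing_chart hO hpO hψ hψ0 hm hitm
  obtain ⟨l, ι, r, hrι, hιS, hιr⟩ := exists_retraction
      (LinearMap.ker (A - 1 : Param k →L[ℝ] Param k).toLinearMap)
  have hS : ∀ y, y ∈ LinearMap.ker (A - 1 : Param k →L[ℝ] Param k).toLinearMap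
      ↔ A y = y := fun y => by
    simp [sub_eq_zero]
  let U : Set (Arr G) := s.source ∩ Arr.src ⁻¹' (c.source ∩ c.toFun ⁻¹' h.source)
  have hU : IsOpen[dTopology] U := by
    have h1 := smooth_src.isOpen_preimage
      (c.smooth.isOpen_inter_preimage c.open_source
          (show IsOpen[dTopology] h.source from h.open_source))
    let _ : TopologicalSpace (Arr G) := dTopology
    exact IsOpen.inter s.open_source h1
  -- The coordinates are defined on all arrows in `U`, not only on loops; this extension is what
  -- later identifies the D-topology with the subspace topology.
  let F : Arr G → Param l := fun α => r (h (c.toFun α.src))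
  have hF : SmoothOn F U := by
    intro n p hp hpU
    have h1 : IsPlot (fun a => c.toFun (p a).src) :=
      c.smooth n _ (smooth_src n p hp) fun a => (hpU a).2.1
    exact (r.contDiff.comp (hh.comp_contDiff h1.contDiff fun a => (hpU a).2.2)).isPlot
  have fixed_of_mem : ∀ w : Inertia G, w.toArr ∈ U → A (h (c.toFun w.pt)) = h (c.toFun w.pt) := by
    rintro w ⟨hw1, hw2, hw3⟩
    refine (hfix _ hw3).1 ?_
    have h1 : σ w.pt = w.toArr := by
      have := s.left_inv hw1
      rwa [show s.toFun w.toArr = w.pt from hs _ hw1] at this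
    change c.toFun (φ (c.invFun (c.toFun w.pt))) = _
    rw [show c.invFun (c.toFun w.pt) = w.pt from c.left_inv hw2]
    simp only [φ]
    rw [h1]
    rfl
  have inv_exists : ∀ y : Param l, ι y ∈ h.target →
      ∃ w : Inertia G, w.toArr = σ (c.invFun (h.symm (ι y))) ∧ w.toArr ∈ U ∧
        h (c.toFun w.pt) = ι y := by
    intro y hy
    have h1 := h.map_target hy
    have h2 := hhO h1
    have h3 := (hfix _ h1).2 (by rw [h.right_inv hy]; exact (hS _).1 (hιS y))
    have h4 : φ (c.invFun (h.symm (ι y))) = c.invFun (h.symm (ι y)) := by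
      have := c.left_inv h2.2.2
      rw [← this]
      exact congrArg c.invFun h3
    obtain ⟨w, hw⟩ := exists_toArr ((hss _ h2.2.1).trans h4.symm)
    have hwpt : w.pt = c.invFun (h.symm (ι y)) := (congrArg Arr.src hw).trans (hss _ h2.2.1)
    have hcw : c.toFun w.pt = h.symm (ι y) := by rw [hwpt]; exact c.right_inv h2.1
    refine ⟨w, hw, ⟨hw ▸ s.map_target h2.2.1, ?_, ?_⟩, ?_⟩
    · change w.pt ∈ c.source
      rw [hwpt]
      exact c.map_target h2.1
    · change c.toFun w.pt ∈ h.source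
      rwa [hcw]
    · rw [hcw, h.right_inv hy]
  classical
  let inv : Param l → Inertia G := fun y =>
      if hy : ι y ∈ h.target then (inv_exists y hy).choose else v
  have hinv : ∀ y, ι y ∈ h.target → (inv y).toArr = σ (c.invFun (h.symm (ι y))) ∧
      (inv y).toArr ∈ U ∧ h (c.toFun (inv y).pt) = ι y := fun y hy => by
    simp only [inv, hy, dif_pos]
    exact (inv_exists y hy).choose_spec
  have hFι : ∀ w : Inertia G, w.toArr ∈ U → ι (F w.toArr) = h (c.toFun w.pt) := fun w hw =>
    hιr _ ((hS _).2 (fixed_of_mem w hw))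
  let e : LocalDiffeo (Inertia G) (Param l) :=
    { toFun := fun w => F w.toArr
      invFun := inv
      source := toArr ⁻¹' U
      target := ι ⁻¹' h.target
      map_source' := fun w hw => by
        rw [Set.mem_preimage, hFι w hw]
        exact h.map_source hw.2.2
      map_target' := fun y hy => (hinv y hy).2.1
      left_inv' := fun w hw => by
        have hy : ι (F w.toArr) ∈ h.target := by
          rw [hFι w hw]
          exact h.map_source hw.2.2
        apply toArr_injective
        rw [(hinv _ hy).1, hFι w hw, show h.symm (h (c.toFun w.pt)) = c.toFun w.pt from
            h.left_inv hw.2.2,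
          show c.invFun (c.toFun w.pt) = w.pt from c.left_inv hw.2.1]
        have := s.left_inv hw.1
        rwa [show s.toFun w.toArr = w.pt from hs _ hw.1] at this
      right_inv' := fun y hy => by
        change r (h (c.toFun (inv y).pt)) = y
        rw [(hinv y hy).2.2, hrι]
      open_source := dSmooth_toArr.isOpen_preimage hU
      open_target := h.open_target.preimage ι.continuous
      smooth := hF.comp (dSmooth_toArr.smoothOn _) fun _ h => h
      smooth_symm := fun n p hp hpV => by
        have h1 : IsPlot (fun a => h.symm (ι (p a))) :=
          (hh'.comp_contDiff (ι.contDiff.comp hp.contDiff) hpV).isPlot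
        have h2 := s.smooth_symm n _ (c.smooth_symm n _ h1 fun a => (hhO (h.map_target (hpV a))).1)
          fun a => (hhO (h.map_target (hpV a))).2.1
        change IsPlot (fun a => (inv (p a)).toArr)
        refine (congrArg IsPlot (funext fun a => ?_)).mp
          (show IsPlot (fun a => σ (c.invFun (h.symm (ι (p a))))) from h2)
        exact (hinv _ (hpV a)).1.symm }
  exact ⟨l, e, F, U, ⟨hvs, hc, hp₀⟩, hU, hF, rfl, fun w => rfl⟩

/-- The D-topology of the inertia groupoid is the subspace topology. -/
theorem dNhds_eq_comap (hG : IsOrbifoldGroupoid G) (v : Inertia G) :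
    dNhds v = (dNhds v.toArr).comap toArr := by
  refine le_antisymm (dSmooth_toArr.tendsto v).le_comap fun N hN => ?_
  obtain ⟨t, htN, ht, hvt⟩ := mem_dNhds.1 hN
  obtain ⟨l, e, F, U, hve, hU, hF, heU, heF⟩ := exists_chart hG v
  have h1 := e.image_isOpen ht
  -- The chart image of `t` is open, and its preimage under the extension `F` is an open set of
  -- arrows whose loops all lie in `t`.
  refine ⟨U ∩ F ⁻¹' (e.target ∩ e.invFun ⁻¹' t), mem_dNhds.2 ⟨_, subset_rfl,
    hF.isOpen_inter_preimage hU h1, heU.subset hve, ?_⟩, ?_⟩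
  · rw [Set.mem_preimage, ← heF]
    refine ⟨e.map_source hve, ?_⟩
    rwa [Set.mem_preimage, show e.invFun (e.toFun v) = v from e.left_inv hve]
  · rintro w ⟨hw1, hw2⟩
    rw [Set.mem_preimage, ← heF] at hw2
    have hw : w ∈ e.source := heU.symm.subset hw1
    have := hw2.2
    rw [Set.mem_preimage, show e.invFun (e.toFun w) = w from e.left_inv hw] at this
    exact htN this

end Inertia

end Groupoid

section Groupoid

variable {G : Type u} [DiffeologicalGroupoid.{v} G]

open DiffeologicalGroupoid (smooth_src smooth_tgt smooth_id smooth_inv)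

theorem Arr.inv_inv (f : Arr G) : f.inv.inv = f := by
  obtain ⟨x, y, f⟩ := f
  simp [Arr.inv]

theorem isEtale_tgt_of_src (h : IsEtale (Arr.src : Arr G → G)) :
    IsEtale (Arr.tgt : Arr G → G) := by
  refine isEtale_iff.2 ⟨smooth_tgt, fun a => ?_⟩
  let i : LocalDiffeo (Arr G) (Arr G) :=
    { toFun := Arr.inv
      invFun := Arr.inv
      source := Set.univ
      target := Set.univ
      map_source' := fun _ _ => trivial
      map_target' := fun _ _ => trivial
      left_inv' := fun f _ => f.inv_inv
      right_inv' := fun f _ => f.inv_inv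
      open_source := @isOpen_univ _ dTopology
      open_target := @isOpen_univ _ dTopology
      smooth := smooth_inv.smoothOn _
      smooth_symm := smooth_inv.smoothOn _ }
  obtain ⟨e, he, he'⟩ := (isEtale_iff.1 h).2 a.inv
  exact ⟨i.trans e, ⟨trivial, he⟩, fun b hb => he' _ hb.2⟩

theorem tendsto_dNhds_unique {X : Type*} [DiffeologicalSpace X] (h2 : @T2Space X dTopology)
    {ι : Type*} {l : Filter ι} [l.NeBot] {f : ι → X} {x y : X}
    (hx : Filter.Tendsto f l (dNhds x)) (hy : Filter.Tendsto f l (dNhds y)) : x = y :=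
  @tendsto_nhds_unique X ι dTopology h2 f l x y _ hx hy

/-! ### The inertia groupoid is an orbifold groupoid -/

namespace Inertia

theorem manifold_ob (hG : IsOrbifoldGroupoid G) : IsSmoothManifold (Inertia G) := by
  let _ : TopologicalSpace (Inertia G) := dTopology
  let _ : TopologicalSpace (Arr G) := dTopology
  have hc : Continuous (toArr : Inertia G → Arr G) := dSmooth_toArr.continuous
  have := hG.manifold_arr.hausdorff
  have := hG.manifold_arr.paracompact
  refine isSmoothManifold_of_chart (T2Space.of_injective_continuous toArr_injective hc) ?_ ?_
  -- `toArr` is proper: source and target of a limit of loops agree because `G₀` is Hausdorff, so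
  -- the limit is again a loop.
  · refine IsProperMap.paracompactSpace (f := toArr)
      (isProperMap_iff_ultrafilter.2 ⟨hc, fun {l α} hl => ?_⟩)
    have h1 : Filter.Tendsto (fun w : Inertia G => w.toArr.src) l (dNhds α.src) :=
      (smooth_src.tendsto α).comp hl
    have h2 : Filter.Tendsto (fun w : Inertia G => w.toArr.tgt) l (dNhds α.tgt) :=
      (smooth_tgt.tendsto α).comp hl
    obtain ⟨w, rfl⟩ := exists_toArr (tendsto_dNhds_unique hG.manifold_ob.hausdorff h1 h2)
    refine ⟨w, rfl, ?_⟩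
    change (l : Filter (Inertia G)) ≤ dNhds w
    rw [dNhds_eq_comap hG]
    exact Filter.tendsto_iff_comap.1 hl
  · intro v
    obtain ⟨l, e, -, -, hv, -⟩ := exists_chart hG v
    exact ⟨l, e, hv⟩

/-- The arrow of `G` underlying an arrow of the inertia groupoid. -/
def arrow (a : Arr (Inertia G)) : Arr G := ⟨a.src.pt, a.tgt.pt, Hom.hom a.hom⟩

theorem dSmooth_arrow : DSmooth (arrow (G := G)) := fun _ _ hp => hp.2

/-- The relation `v · α = α · w` solves to `w = α⁻¹ · v · α`. Hence equality and smoothness of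
arrows of `∧G` can be tested on the source loop and on `α` alone. -/
theorem tgt_toArr (a : Arr (Inertia G)) :
    a.tgt.toArr = (arrow a).inv.comp (a.src.toArr.comp (arrow a)) := by
  obtain ⟨x, y, f⟩ := a
  have hf : x.loop ≫ Hom.hom f = Hom.hom f ≫ y.loop := Hom.comm f
  simp only [arrow, Arr.inv, toArr, Arr.comp_mk, hf]
  simp

theorem arr_ext {a b : Arr (Inertia G)} (h : a.src = b.src) (h' : arrow a = arrow b) : a = b := by
  have ht : a.tgt = b.tgt := toArr_injective (by rw [tgt_toArr, tgt_toArr, h, h'])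
  obtain ⟨x, y, f⟩ := a
  obtain ⟨x', y', f'⟩ := b
  dsimp only at h ht
  subst h ht
  congr 1
  apply Hom.ext
  simp only [arrow] at h'
  injection h'

theorem exists_arr {w : Inertia G} {α : Arr G} (h : α.src = w.pt) :
    ∃ a : Arr (Inertia G), a.src = w ∧ arrow a = α := by
  obtain ⟨x, y, f⟩ := α
  obtain ⟨x', g⟩ := w
  dsimp only at h
  subst h
  exact ⟨⟨⟨x, g⟩, ⟨y, Groupoid.inv f ≫ g ≫ f⟩, ⟨f, by simp⟩⟩, rfl, rfl⟩

theorem isPlot_arr {n : ℕ} {p : Param n → Arr (Inertia G)} (h : IsPlot (fun a => (p a).src))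
    (h' : IsPlot (fun a => arrow (p a))) : IsPlot p := by
  refine ⟨⟨h, ?_⟩, h'⟩
  have h1 : IsPlot (fun a => (p a).src.toArr.comp (arrow (p a))) :=
    isPlot_comp (show IsPlot (fun a => (p a).src.toArr) from h) h' fun a => rfl
  have h2 := isPlot_comp (f := fun a => (arrow (p a)).inv) (smooth_inv n _ h') h1
    fun a => (Arr.comp_src (f := (p a).src.toArr) (g := arrow (p a)) rfl).symm
  refine (congrArg IsPlot (funext fun a => ?_)).mp h2
  exact (tgt_toArr (p a)).symm

/-- An arrow of `∧G` amounts to a loop and an arrow of `G` out of its base point, so local sections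
of the source map of `G` lift. The domain is a preimage under `arrow`, so that membership is visible
on the underlying arrow, as `dNhds_arr` requires. -/
theorem exists_localDiffeo_src (hG : IsOrbifoldGroupoid G) (a : Arr (Inertia G)) :
    ∃ (e : LocalDiffeo (Arr (Inertia G)) (Inertia G)) (U : Set (Arr G)), IsOpen[dTopology] U ∧
      arrow a ∈ U ∧ e.source = arrow ⁻¹' U ∧ ∀ b, e.toFun b = b.src := by
  obtain ⟨s, has, hs⟩ := (isEtale_iff.1 hG.etale_src).2 (arrow a)
  have hss : ∀ y ∈ s.target, (s.invFun y).src = y := fun y hy =>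
    (hs _ (s.map_target hy)).symm.trans (s.right_inv hy)
  classical
  let inv : Inertia G → Arr (Inertia G) := fun w =>
    if h : w.pt ∈ s.target then (exists_arr (hss _ h)).choose else a
  have hinv : ∀ w : Inertia G, w.pt ∈ s.target → (inv w).src = w ∧ arrow (inv w) =
      s.invFun w.pt := by
    intro w h
    simp only [inv, h, dif_pos]
    exact (exists_arr (hss _ h)).choose_spec
  refine ⟨{ toFun := Arr.src
            invFun := inv
            source := arrow ⁻¹' s.source
            target := pt ⁻¹' s.target
            map_source' := fun b hb => ?_
            map_target' := fun w hw => ?_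
            left_inv' := fun b hb => ?_
            right_inv' := fun w hw => (hinv w hw).1
            open_source := dSmooth_arrow.isOpen_preimage s.open_source
            open_target := dSmooth_pt.isOpen_preimage s.open_target
            smooth := smooth_src.smoothOn _
            smooth_symm := fun n p hp hpV => ?_ }, s.source, s.open_source, has, rfl, fun b => rfl⟩
  · have := s.map_source hb
    rwa [show s.toFun (arrow b) = b.src.pt from hs _ hb] at this
  · rw [Set.mem_preimage, (hinv w hw).2]
    exact s.map_target hw
  · have h1 : s.toFun (arrow b) = b.src.pt := hs _ hb
    have h2 : b.src.pt ∈ s.target := h1 ▸ s.map_source hb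
    refine arr_ext (hinv _ h2).1 ((hinv _ h2).2.trans ?_)
    rw [← h1]
    exact s.left_inv hb
  · refine isPlot_arr ?_ ?_
    · exact (congrArg IsPlot (funext fun b => (hinv _ (hpV b)).1)).mpr hp
    · exact (congrArg IsPlot (funext fun b => (hinv _ (hpV b)).2)).mpr
        (s.smooth_symm n _ (dSmooth_pt n p hp) hpV)

theorem etale_src (hG : IsOrbifoldGroupoid G) :
    IsEtale (Arr.src : Arr (Inertia G) → Inertia G) := by
  refine isEtale_iff.2 ⟨smooth_src, fun a => ?_⟩
  obtain ⟨e, U, -, haU, heU, he⟩ := exists_localDiffeo_src hG a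
  exact ⟨e, heU.symm.subset haU, fun b _ => he b⟩

/-- On a domain `arrow ⁻¹' U` the source is a diffeomorphism onto its image, so closeness of sources
there forces closeness of arrows. Limits in `Arr (Inertia G)` can thus be found componentwise. -/
theorem dNhds_arr (hG : IsOrbifoldGroupoid G) (a : Arr (Inertia G)) :
    (dNhds a.src).comap Arr.src ⊓ (dNhds (arrow a)).comap arrow ≤ dNhds a := by
  intro N hN
  obtain ⟨t, htN, ht, hat⟩ := mem_dNhds.1 hN
  obtain ⟨e, U, hU, haU, heU, he⟩ := exists_localDiffeo_src hG a
  have hae : a ∈ e.source := heU.symm.subset haU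
  refine Filter.mem_of_superset (Filter.inter_mem_inf
    (Filter.preimage_mem_comap (mem_dNhds.2 ⟨_, subset_rfl, e.image_isOpen ht, ?_⟩))
    (Filter.preimage_mem_comap (mem_dNhds.2 ⟨_, subset_rfl, hU, haU⟩))) ?_
  · rw [← he]
    exact ⟨e.map_source hae, by
      rw [Set.mem_preimage, show e.invFun (e.toFun a) = a from e.left_inv hae]; exact hat⟩
  · rintro b ⟨⟨-, hb⟩, hb'⟩
    have hbe : b ∈ e.source := heU.symm.subset hb'
    rw [Set.mem_preimage, ← he, show e.invFun (e.toFun b) = b from e.left_inv hbe] at hb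
    exact htN hb

theorem manifold_arr (hG : IsOrbifoldGroupoid G) : IsSmoothManifold (Arr (Inertia G)) := by
  let _ : TopologicalSpace (Inertia G) := dTopology
  let _ : TopologicalSpace (Arr G) := dTopology
  let _ : TopologicalSpace (Arr (Inertia G)) := dTopology
  have hc : Continuous (arrow : Arr (Inertia G) → Arr G) := dSmooth_arrow.continuous
  have hc' : Continuous (Arr.src : Arr (Inertia G) → Inertia G) := smooth_src.continuous
  have := hG.manifold_arr.hausdorff
  have := hG.manifold_arr.paracompact
  have := (manifold_ob hG).hausdorff
  refine isSmoothManifold_of_chart (T2Space.of_injective_continuous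
    (f := fun a : Arr (Inertia G) => (a.src, arrow a)) (fun a b h =>
      arr_ext (congrArg Prod.fst h) (congrArg Prod.snd h)) (hc'.prodMk hc)) ?_ fun a => ?_
  · refine IsProperMap.paracompactSpace (f := arrow)
      (isProperMap_iff_ultrafilter.2 ⟨hc, fun {l α} hl => ?_⟩)
    -- Properness of `arrow`: when the underlying arrows converge, so do the base points of the
    -- source loops, and properness of the anchor of `G` provides a limit of these loops.
    have h1 : Filter.Tendsto (fun a : Arr (Inertia G) => a.src.pt) l (dNhds α.src) :=
      (smooth_src.tendsto α).comp hl
    obtain ⟨β, hβ, hβ', hlβ⟩ := hG.exists_limit l (fun a => a.src.toArr) h1 h1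
    obtain ⟨w, rfl⟩ := exists_toArr (hβ.trans hβ'.symm)
    obtain ⟨a, rfl, rfl⟩ := exists_arr (w := w) (α := α) hβ.symm
    refine ⟨a, rfl, le_trans (le_inf ?_ (Filter.tendsto_iff_comap.1 hl)) (dNhds_arr hG a)⟩
    rw [dNhds_eq_comap hG, Filter.comap_comap]
    exact Filter.tendsto_iff_comap.1 hlβ
  · obtain ⟨e, he, -⟩ := (isEtale_iff.1 (etale_src hG)).2 a
    obtain ⟨k, c, hc⟩ := (manifold_ob hG).exists_chart (e.toFun a)
    exact ⟨k, e.trans c, he, hc⟩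

theorem isOrbifoldGroupoid (hG : IsOrbifoldGroupoid G) : IsOrbifoldGroupoid (Inertia G) where
  manifold_ob := manifold_ob hG
  manifold_arr := manifold_arr hG
  etale_src := etale_src hG
  etale_tgt := isEtale_tgt_of_src (etale_src hG)
  proper := by
    let _ : TopologicalSpace (Inertia G) := dTopology
    let _ : TopologicalSpace (Arr (Inertia G)) := dTopology
    have hc : Continuous (Arr.src : Arr (Inertia G) → Inertia G) := smooth_src.continuous
    have hc' : Continuous (Arr.tgt : Arr (Inertia G) → Inertia G) := smooth_tgt.continuous
    refine isProperMap_iff_ultrafilter.2 ⟨hc.prodMk hc', fun {l q} hl => ?_⟩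
    obtain ⟨v, w⟩ := q
    rw [nhds_prod_eq] at hl
    have hv : Filter.Tendsto Arr.src (l : Filter (Arr (Inertia G))) (dNhds v) := hl.fst
    have hw : Filter.Tendsto Arr.tgt (l : Filter (Arr (Inertia G))) (dNhds w) := hl.snd
    -- Base points converge, so the underlying arrows have a limit in `G`. It lifts to an arrow out
    -- of `v`, whose target is `w` by uniqueness of limits.
    obtain ⟨α, hα, -, hlα⟩ := hG.exists_limit l arrow ((dSmooth_pt.tendsto v).comp hv)
      ((dSmooth_pt.tendsto w).comp hw)
    obtain ⟨a, rfl, rfl⟩ := exists_arr hα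
    have hla : (l : Filter (Arr (Inertia G))) ≤ dNhds a :=
      le_trans (le_inf (Filter.tendsto_iff_comap.1 hv) (Filter.tendsto_iff_comap.1 hlα))
        (dNhds_arr hG a)
    refine ⟨a, Prod.ext rfl ?_, hla⟩
    exact tendsto_dNhds_unique (manifold_ob hG).hausdorff ((smooth_tgt.tendsto a).mono_left hla) hw

end Inertia

end Groupoid

/-! ### Angle coordinates on the two arcs -/

section CircleCoordinates

/-- The argument of a point of the circle in `[0, 2π)`. -/
def angle (z : Circle) : ℝ :=
  if (z : ℂ).im < 0 then Complex.arg z + 2 * Real.pi else Complex.arg z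

/-- The coordinate on the arc with index `j`. -/
def arcAngle (j : ℕ) (z : Circle) : ℝ :=
  if j = 1 ∧ (z : ℂ).im < 0 then angle z - 2 * Real.pi else angle z

theorem angle_nonneg (z : Circle) : 0 ≤ angle z := by
  unfold angle
  split_ifs with h
  · linarith [Complex.neg_pi_lt_arg (z : ℂ), Real.pi_pos]
  · exact Complex.arg_nonneg_iff.2 (not_lt.1 h)

theorem angle_lt (z : Circle) : angle z < 2 * Real.pi := by
  unfold angle
  split_ifs with h
  · linarith [Complex.arg_neg_iff.2 h]
  · linarith [Complex.arg_le_pi (z : ℂ), Real.pi_pos]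

theorem exp_angle (z : Circle) : Circle.exp (angle z) = z := by
  unfold angle
  split_ifs
  · rw [Circle.exp_add, Circle.exp_two_pi, mul_one, Circle.exp_arg]
  · exact Circle.exp_arg z

theorem exp_arcAngle (j : ℕ) (z : Circle) : Circle.exp (arcAngle j z) = z := by
  unfold arcAngle
  split_ifs
  · rw [Circle.exp_sub, Circle.exp_two_pi, div_one, exp_angle]
  · exact exp_angle z

theorem arcAngle_one (z : Circle) : arcAngle 1 z = Complex.arg z := by
  unfold arcAngle angle
  split_ifs with h1 h2 h2 <;> simp_all

theorem arcAngle_of_ne_one {j : ℕ} (hj : j ≠ 1) (z : Circle) : arcAngle j z = angle z := by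
  simp [arcAngle, hj]

theorem arcAngle_mem (j : ℕ) (z : Circle) :
    arcAngle j z ∈ Set.Ioo (-Real.pi) (2 * Real.pi) := by
  by_cases hj : j = 1
  · subst hj
    rw [arcAngle_one]
    exact ⟨Complex.neg_pi_lt_arg _, by linarith [Complex.arg_le_pi (z : ℂ), Real.pi_pos]⟩
  · rw [arcAngle_of_ne_one hj]
    exact ⟨by linarith [angle_nonneg z, Real.pi_pos], angle_lt z⟩

theorem mem_arcs {j : ℕ} {z : Circle} :
    z ∈ arcs.U j ↔ (j = 0 ∧ z ≠ 1) ∨ (j = 1 ∧ z ≠ -1) := by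
  by_cases h0 : j = 0
  · simp [arcs, h0]
  · by_cases h1 : j = 1 <;> simp [arcs, h0, h1]

theorem eq_one_or_eq_neg_one {z : Circle} (h : (z : ℂ).im = 0) : z = 1 ∨ z = -1 := by
  have hn := Complex.sq_norm (z : ℂ)
  rw [Circle.norm_coe, Complex.normSq_apply, h] at hn
  have hre : (z : ℂ).re = 1 ∨ (z : ℂ).re = -1 := by
    rw [← sq_eq_one_iff]; nlinarith
  rcases hre with h' | h'
  · left; apply Circle.ext; apply Complex.ext <;> simp [h, h']
  · right; apply Circle.ext; apply Complex.ext <;> simp [h, h']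

/-- The principal argument of `-z` has its cut at `z = 1`, which gives continuity of the angle on
`S¹ ∖ {1}`. -/
theorem angle_eq_arg_neg {z : Circle} (hz : z ≠ 1) :
    angle z = Complex.arg (-(z : ℂ)) + Real.pi := by
  unfold angle
  rcases lt_trichotomy (z : ℂ).im 0 with h | h | h
  · rw [if_pos h, Complex.arg_neg_eq_arg_add_pi_of_im_neg h]
    ring
  · rw [if_neg (by simp [h]), (eq_one_or_eq_neg_one h).resolve_left hz]
    simp
  · rw [if_neg (by linarith), Complex.arg_neg_eq_arg_sub_pi_of_im_pos h]
    ring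

theorem continuousAt_arcAngle {j : ℕ} {z : Circle} (hz : z ∈ arcs.U j) :
    ContinuousAt (arcAngle j) z := by
  have slit : ∀ w : Circle, w ≠ -1 → (w : ℂ) ∈ Complex.slitPlane := by
    intro w hw
    rw [Complex.mem_slitPlane_iff]
    by_contra! hcon
    rcases eq_one_or_eq_neg_one hcon.2 with h | h
    · subst h
      norm_num at hcon
    · exact hw h
  rcases mem_arcs.1 hz with ⟨rfl, h⟩ | ⟨rfl, h⟩
  · have h1 : ContinuousAt (fun w : Circle => Complex.arg (-(w : ℂ)) + Real.pi) z := by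
      have h2 : ContinuousAt Complex.arg (((-z : Circle) : ℂ)) :=
        Complex.continuousAt_arg (slit (-z) (by simpa using h))
      have h3 : ContinuousAt (fun w : Circle => ((-w : Circle) : ℂ)) z := by fun_prop
      have h4 := ContinuousAt.comp (f := fun w : Circle => ((-w : Circle) : ℂ)) h2 h3
      have h5 := h4.add (continuousAt_const (y := Real.pi))
      simp only [Circle.coe_neg] at h5
      exact h5
    refine h1.congr ?_
    filter_upwards [isOpen_compl_singleton.eventually_mem h] with w hw
    rw [arcAngle_of_ne_one zero_ne_one, angle_eq_arg_neg hw]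
  · have h1 : ContinuousAt (fun w : Circle => Complex.arg (w : ℂ)) z :=
      ContinuousAt.comp (f := fun w : Circle => (w : ℂ)) (Complex.continuousAt_arg (slit z h))
        (by fun_prop)
    exact h1.congr (.of_forall fun w => (arcAngle_one w).symm)

theorem angle_exp (t : ℝ) : angle (Circle.exp t) = t - ⌊t / (2 * Real.pi)⌋ * (2 * Real.pi) := by
  obtain ⟨m, hm⟩ := Circle.exp_eq_exp.1 (exp_angle (Circle.exp t))
  have hpi := Real.two_pi_pos
  have h0 := angle_nonneg (Circle.exp t)
  have h1 := angle_lt (Circle.exp t)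
  rw [hm] at h0 h1 ⊢
  have : ⌊t / (2 * Real.pi)⌋ = -m := by
    rw [Int.floor_eq_iff, le_div_iff₀ hpi, div_lt_iff₀ hpi]
    push_cast
    constructor <;> nlinarith
  rw [this]
  push_cast
  ring

end CircleCoordinates

/-! ### Trivializations over the line and holonomy -/

section Frames

variable {G : Type u} [DiffeologicalGroupoid.{v} G]

/-- Trivializations of a loop, pulled back to a subset `I` of the universal cover of the circle, by
a locally constant family of arrows to a fixed object. -/
structure Frame (L : Loop G) (b : G) (I : Set ℝ) where
  k : ∀ t ∈ I, ∀ x : CechOb L.W, Circle.exp t = x.pt → (L.F.obj x ⟶ b)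
  nat : ∀ t ht (x x' : CechOb L.W) h h',
    L.F.map (CechOb.arrow (h.symm.trans h') : x ⟶ x') ≫ k t ht x' h' = k t ht x h
  -- Equality in `Arr G` includes equality of the sources, so the objects of the loop are locally
  -- constant too.
  loc : ∀ i t₀ (ht₀ : t₀ ∈ I) (h₀ : Circle.exp t₀ ∈ L.W.U i), ∀ᶠ t in 𝓝 t₀,
    ∀ (ht : t ∈ I) (h : Circle.exp t ∈ L.W.U i),
      Arr.mk _ _ (k t ht ⟨i, Circle.exp t, h⟩ rfl) =
          Arr.mk _ _ (k t₀ ht₀ ⟨i, Circle.exp t₀, h₀⟩ rfl)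

theorem Frame.arr_eq {L : Loop G} {b : G} {I : Set ℝ} (K : Frame L b I) {t : ℝ} (ht : t ∈ I)
    {i : ℕ} {z : Circle} (h : Circle.exp t = z) (hz : z ∈ L.W.U i) :
    Arr.mk _ _ (K.k t ht ⟨i, z, hz⟩ h) = Arr.mk _ _ (K.k t ht ⟨i, Circle.exp t, h ▸ hz⟩ rfl) := by
  subst h
  rfl

namespace Inertia

/-- An equivariant trivialization over an interval identifies a loop with a constant loop with
holonomy. -/
def homOfFrame {L : Loop G} {v : Inertia G}
    (K : Frame L v.pt (Set.Ioo (-Real.pi) (2 * Real.pi)))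
    (hK : ∀ t ht ht' x h h', K.k (t + 2 * Real.pi) ht' x h' ≫ v.loop = K.k t ht x h) :
    Loop.Hom L v.constLoop :=
  -- `arcAngle j z` and `angle z` differ by a full turn exactly where `frame` is the holonomy, so
  -- equivariance of `K` produces `frame` as the correction.
  have key : ∀ (x : CechOb L.W) (j : ℕ) (z : Circle) (h : x.pt = z),
      K.k (arcAngle j z) (arcAngle_mem j z) x ((exp_arcAngle j z).trans h.symm) =
        K.k (angle z) (arcAngle_of_ne_one zero_ne_one z ▸ arcAngle_mem 0 z) x
          ((exp_angle z).trans h.symm) ≫ v.frame j z := by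
    intro x j z h
    by_cases hc : j = 1 ∧ (z : ℂ).im < 0
    · have h1 : angle z = arcAngle j z + 2 * Real.pi := by simp [arcAngle, hc]
      have h2 : v.frame j z = v.loop := by simp [frame, hc]
      rw [h2]
      simp only [h1]
      exact (hK _ _ _ _ _ _).symm
    · have h1 : angle z = arcAngle j z := by simp only [arcAngle, if_neg hc]
      have h2 : v.frame j z = 𝟙 _ := by simp only [frame, if_neg hc]
      rw [h2, Category.comp_id]
      simp only [h1]
  { app := fun x y h => K.k (arcAngle y.idx y.pt) (arcAngle_mem _ _) x
      ((exp_arcAngle _ _).trans h.symm)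
    natural := fun x x' y y' h h' f g => by
      obtain ⟨j, z, hz⟩ := y
      obtain ⟨j', z', hz'⟩ := y'
      obtain rfl : z = z' := g.down
      change L.F.map f ≫ K.k (arcAngle j' z) _ x' _ = K.k (arcAngle j z) _ x _ ≫
        (Groupoid.inv (v.frame j z) ≫ v.frame j' z)
      rw [key x' j' z h', key x j z h, ← Category.assoc]
      have := K.nat (angle z) (arcAngle_of_ne_one zero_ne_one z ▸ arcAngle_mem 0 z) x x'
        ((exp_angle z).trans h.symm) ((exp_angle z).trans h'.symm)
      rw [show L.F.map f ≫ K.k (angle z) _ x' _ = _ from this]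
      simp
    -- The coordinate is continuous on its arc, so local constancy of `K` makes the components
    -- locally constant.
    smooth := fun i j m p hp => isPlot_of_eventually_eq fun a => by
      have hc : ContinuousAt (fun b => arcAngle j (p b).1) a :=
        ContinuousAt.comp (f := fun b => (p b).1) (continuousAt_arcAngle (p a).2.2)
          (Loop.plot_continuous hp).continuousAt
      filter_upwards [hc (K.loc i (arcAngle j (p a).1) (arcAngle_mem _ _)
        ((exp_arcAngle j (p a).1).symm ▸ (p a).2.1))] with b hb
      have := hb (arcAngle_mem _ _) ((exp_arcAngle j (p b).1).symm ▸ (p b).2.1)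
      exact (K.arr_eq _ _ _).trans (this.trans (K.arr_eq _ _ _).symm) }

theorem frame_eq_zpow (v : Inertia G) (i : ℕ) (z : Circle) :
    v.frame i z = v.loop ^ (if i = 1 ∧ (z : ℂ).im < 0 then 1 else 0 : ℤ) := by
  unfold frame
  split_ifs
  · exact (zpow_one _).symm
  · exact (zpow_zero _).symm

theorem inv_comp_comp_inv_comp {a b c d : G} (p : b ⟶ a) (q : b ⟶ c) (r : b ⟶ d) :
    (Groupoid.inv p ≫ q) ≫ (Groupoid.inv q ≫ r) = Groupoid.inv p ≫ r := by
  simp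

/-- The trivialization of a rotated constant loop. -/
def rotFrame (v : Inertia G) (τ : ℝ) (I : Set ℝ) :
    Frame ((Loop.rotation (Circle.exp τ)).obj v.constLoop) v.pt I where
  -- The exponent counts the full turns in `τ + t`; the jump of the floor inside an arc is cancelled
  -- by the jump of `frame`.
  k t _ x _ := Groupoid.inv (v.frame x.idx (Circle.exp τ * x.pt)) ≫
    v.loop ^ (-⌊(τ + t) / (2 * Real.pi)⌋)
  nat t _ x x' h h' := by
    exact inv_comp_comp_inv_comp (v.frame x.idx (Circle.exp τ * x.pt))
      (v.frame x'.idx (Circle.exp τ * x'.pt)) _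
  loc i t₀ _ h₀ := by
    let e : ℝ → ℤ := fun t => -⌊(τ + t) / (2 * Real.pi)⌋ -
      (if i = 1 ∧ ((Circle.exp (τ + t) : Circle) : ℂ).im < 0 then 1 else 0)
    have he : ∀ t, (e t : ℝ) * (2 * Real.pi) = arcAngle i (Circle.exp (τ + t)) - (τ + t) := by
      intro t
      simp only [e, arcAngle, angle_exp]
      split_ifs <;> push_cast <;> ring
    have hk : ∀ t, (Groupoid.inv (v.frame i (Circle.exp τ * Circle.exp t)) ≫
        v.loop ^ (-⌊(τ + t) / (2 * Real.pi)⌋)) = v.loop ^ e t := by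
      intro t
      rw [show e t = -(if i = 1 ∧ ((Circle.exp (τ + t) : Circle) : ℂ).im < 0 then 1 else 0) +
        -⌊(τ + t) / (2 * Real.pi)⌋ by simp only [e]; ring, zpow_add, zpow_neg v.loop (ite _ _ _),
        ← frame_eq_zpow, Circle.exp_add]
      rfl
    have h₀' : Circle.exp (τ + t₀) ∈ arcs.U i := by
      rw [Circle.exp_add]
      exact h₀
    -- The total exponent, times `2π`, is the arc coordinate minus `τ + t`. It is continuous at `t₀`
    -- with values in `2πℤ`, hence locally constant.
    have hc : ContinuousAt (fun t => (e t : ℝ) * (2 * Real.pi)) t₀ := by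
      simp only [he]
      refine ContinuousAt.sub ?_ (by fun_prop)
      exact ContinuousAt.comp (f := fun t => Circle.exp (τ + t)) (continuousAt_arcAngle h₀')
        (by fun_prop)
    have hev : ∀ᶠ t in 𝓝 t₀, e t = e t₀ := by
      filter_upwards [hc (Metric.ball_mem_nhds _ Real.two_pi_pos)] with t ht
      rw [Set.mem_preimage, Metric.mem_ball, Real.dist_eq, ← sub_mul, abs_mul,
        abs_of_pos Real.two_pi_pos] at ht
      have h1 : |((e t - e t₀ : ℤ) : ℝ)| < 1 := by
        push_cast
        by_contra! hcon
        nlinarith [Real.two_pi_pos]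
      have h2 : |e t - e t₀| < 1 := by exact_mod_cast h1
      exact sub_eq_zero.1 (Int.abs_lt_one_iff.1 h2)
    filter_upwards [hev] with t ht _ h
    exact congrArg (Arr.mk v.pt v.pt) ((hk t).trans ((congrArg _ ht).trans (hk t₀).symm))

/-- A full turn raises the floor in `rotFrame` by one, so the rotated loop is trivialized over the
line with the same holonomy `v`. -/
theorem isFixed_constLoop (v : Inertia G) : Loop.IsFixed v.constLoop := by
  intro θ
  obtain ⟨τ, rfl⟩ : ∃ τ, Circle.exp τ = θ := ⟨_, Circle.exp_arg θ⟩
  refine ⟨homOfFrame (v.rotFrame τ _) fun t ht ht' x h h' => ?_⟩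
  have h1 : ⌊(τ + (t + 2 * Real.pi)) / (2 * Real.pi)⌋ = ⌊(τ + t) / (2 * Real.pi)⌋ + 1 := by
    rw [← Int.floor_add_one]
    congr 1
    field_simp
    ring
  simp only [rotFrame, Category.assoc, h1]
  congr 1
  exact (zpow_add_one v.loop _).symm.trans (congrArg _ (by ring))

end Inertia

end Frames

/-- A locally constant function on a preconnected set is constant. -/
theorem eq_of_isPreconnected {S : Set ℝ} (hS : _root_.IsPreconnected S) {X : Type*} (r : ∀ t ∈ S, X)
    (hr : ∀ t₀ h₀, ∀ᶠ t in 𝓝 t₀, ∀ h : t ∈ S, r t h = r t₀ h₀) {t t' : ℝ} (ht : t ∈ S)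
    (ht' : t' ∈ S) : r t ht = r t' ht' := by
  have := isPreconnected_iff_preconnectedSpace.1 hS
  have h1 : IsLocallyConstant (fun t : S => r t.1 t.2) := by
    refine (IsLocallyConstant.iff_eventually_eq _).2 fun t₀ => ?_
    filter_upwards [continuousAt_subtype_val (hr t₀.1 t₀.2)] with t ht
    exact ht t.2
  exact h1.apply_eq_of_preconnectedSpace ⟨t, ht⟩ ⟨t', ht'⟩

theorem isPlot_exp {n : ℕ} {c : Param n → ℝ} (hc : ContDiff ℝ ∞ c) :
    IsPlot (fun a => Circle.exp (c a)) := by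
  let _ := NormedSpace.toDiffeology ℂ
  change ContDiff ℝ ∞ (fun a => ((Circle.exp (c a) : Circle) : ℂ))
  simp only [Circle.coe_exp]
  have h1 : ContDiff ℝ ∞ (fun a => (c a : ℂ)) := Complex.ofRealCLM.contDiff.comp hc
  exact (h1.mul contDiff_const).cexp

/-! ### Fixed loops are flat, and flat loops are constant loops with holonomy -/

section Flat

variable {G : Type u} [DiffeologicalGroupoid.{v} G]

/-- Loops that are locally constant on objects. -/
def Loop.IsFlat (L : Loop G) : Prop :=
  ∀ i t₀ (h₀ : Circle.exp t₀ ∈ L.W.U i), ∀ᶠ t in 𝓝 t₀, ∀ h : Circle.exp t ∈ L.W.U i,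
    L.F.obj ⟨i, Circle.exp t, h⟩ = L.F.obj ⟨i, Circle.exp t₀, h₀⟩

theorem Loop.isOpen_exp (L : Loop G) (i : ℕ) : IsOpen {t | Circle.exp t ∈ L.W.U i} :=
  (L.W.isOpen i).preimage Circle.exp.continuous

/-- The rotation by `x.pt / y.pt` moves the value over `x.pt` to `y.pt`, where an isomorphism from
the rotated loop can be evaluated. -/
theorem Loop.IsFixed.nonempty_hom {L : Loop G} (hL : L.IsFixed) (x y : CechOb L.W) :
    Nonempty (L.F.obj x ⟶ L.F.obj y) := by
  obtain ⟨f⟩ := hL (x.pt / y.pt)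
  let y' := ((rotation (x.pt / y.pt)).obj L).someOb y.pt
  have h : x.pt = x.pt / y.pt * y.pt := (div_mul_cancel _ _).symm
  exact ⟨L.F.map (CechOb.arrow (y := ⟨y'.idx, x.pt / y.pt * y.pt, y'.mem⟩) h) ≫
    Loop.Hom.app f y' y rfl⟩

/-- The loop stays in one orbit, and by `eventually_orbit_eq` a point has a neighbourhood meeting
that orbit in no other point; continuity does the rest. -/
theorem Loop.IsFixed.isFlat (hG : IsOrbifoldGroupoid G) {L : Loop G} (hL : L.IsFixed) :
    L.IsFlat := by
  intro i t₀ h₀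
  obtain ⟨N, hN, hNo, hxN⟩ := mem_dNhds.1 (hG.eventually_orbit_eq
    (L.F.obj ⟨i, Circle.exp t₀, h₀⟩) (L.F.obj ⟨i, Circle.exp t₀, h₀⟩))
  have h1 := isOpen_exists_mem_real (L.isOpen_exp i)
    (fun t h => L.F.obj ⟨i, Circle.exp t, h⟩)
    (fun c hc h => L.smooth_obj i _ (fun b => ⟨Circle.exp (c b), h b⟩) (isPlot_exp hc)) hNo
  filter_upwards [h1.eventually_mem ⟨h₀, hxN⟩] with t ht h
  exact hN ht.2 (hL.nonempty_hom _ _)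

theorem isFlat_constLoop (v : Inertia G) : v.constLoop.IsFlat :=
  fun _ _ _ => .of_forall fun _ _ => rfl

/-- Arrows out of flat loops are locally constant. -/
theorem Loop.IsFlat.app_eventually_eq (hG : IsOrbifoldGroupoid G) {L M : Loop G} (hL : L.IsFlat)
    (f : Loop.Hom L M) (i j : ℕ) (t₀ : ℝ) (hi₀ : Circle.exp t₀ ∈ L.W.U i)
    (hj₀ : Circle.exp t₀ ∈ M.W.U j) :
    ∀ᶠ t in 𝓝 t₀, ∀ (hi : Circle.exp t ∈ L.W.U i) (hj : Circle.exp t ∈ M.W.U j),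
      Arr.mk _ _ (f.app ⟨i, Circle.exp t, hi⟩ ⟨j, Circle.exp t, hj⟩ rfl) =
        Arr.mk _ _ (f.app ⟨i, Circle.exp t₀, hi₀⟩ ⟨j, Circle.exp t₀, hj₀⟩ rfl) := by
  -- By flatness the sources are locally constant, and near the given arrow an arrow is determined
  -- by its source.
  obtain ⟨U, hU, hxU, hinj⟩ := hG.etale_src.exists_nhds_injOn
    (Arr.mk _ _ (f.app ⟨i, Circle.exp t₀, hi₀⟩ ⟨j, Circle.exp t₀, hj₀⟩ rfl))
  have h1 := isOpen_exists_mem_real ((L.isOpen_exp i).inter (M.isOpen_exp j))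
    (fun t h => Arr.mk _ _ (f.app ⟨i, Circle.exp t, h.1⟩ ⟨j, Circle.exp t, h.2⟩ rfl))
    (fun c hc h => f.smooth i j _ (fun b => ⟨Circle.exp (c b), h b⟩) (isPlot_exp hc)) hU
  filter_upwards [h1.eventually_mem ⟨⟨hi₀, hj₀⟩, hxU⟩, hL i t₀ hi₀] with t ht ht' hi hj
  exact hinj ht.2 hxU (ht' hi)

theorem Loop.IsFlat.app_eq (hG : IsOrbifoldGroupoid G) {L M : Loop G} (hL : L.IsFlat)
    (f : Loop.Hom L M) (i j : ℕ) {S : Set ℝ} (hS : _root_.IsPreconnected S)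
    (hi : ∀ t ∈ S, Circle.exp t ∈ L.W.U i) (hj : ∀ t ∈ S, Circle.exp t ∈ M.W.U j) {t t' : ℝ}
    (ht : t ∈ S) (ht' : t' ∈ S) :
    Arr.mk _ _ (f.app ⟨i, Circle.exp t, hi t ht⟩ ⟨j, Circle.exp t, hj t ht⟩ rfl) =
      Arr.mk _ _ (f.app ⟨i, Circle.exp t', hi t' ht'⟩ ⟨j, Circle.exp t', hj t' ht'⟩ rfl) :=
  eq_of_isPreconnected hS
    (fun t ht => Arr.mk _ _ (f.app ⟨i, Circle.exp t, hi t ht⟩ ⟨j, Circle.exp t, hj t ht⟩ rfl))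
    (fun t₀ h₀ => (hL.app_eventually_eq hG f i j t₀ (hi t₀ h₀) (hj t₀ h₀)).mono
      fun t h ht => h (hi t ht) (hj t ht)) ht ht'

theorem Arr.mk_comp_eqToHom {x y z : G} (f : x ⟶ y) (h : y = z) :
    Arr.mk x z (f ≫ eqToHom h) = Arr.mk x y f := by
  subst h
  simp

theorem Arr.inv_comp_eq {x x' y z : G} {f : x ⟶ y} {f' : x' ⟶ y} {g : x ⟶ z} {g' : x' ⟶ z}
    (h : Arr.mk x y f = Arr.mk x' y f') (h' : Arr.mk x z g = Arr.mk x' z g') :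
    Groupoid.inv f ≫ g = Groupoid.inv f' ≫ g' := by
  cases h
  cases h'
  rfl

namespace Frame

variable {L : Loop G} {b b₁ b₂ : G} {I I₁ I₂ : Set ℝ}

/-- Over a connected set inside one member of the cover the loop is constant, so its transition
arrows into that member form a frame. -/
theorem nonempty_of_mem (hG : IsOrbifoldGroupoid G) (hL : L.IsFlat) {i : ℕ}
    (hI : _root_.IsPreconnected I) (hi : ∀ t ∈ I, Circle.exp t ∈ L.W.U i) {t₁ : ℝ} (ht₁ : t₁ ∈ I) :
    Nonempty (Frame L (L.F.obj ⟨i, Circle.exp t₁, hi t₁ ht₁⟩) I) := by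
  -- The components of the identity transformation are the transition arrows of `L`; their constancy
  -- contains that of the objects.
  have hc : ∀ t (ht : t ∈ I), L.F.obj ⟨i, Circle.exp t, hi t ht⟩ =
      L.F.obj ⟨i, Circle.exp t₁, hi t₁ ht₁⟩ := fun t ht =>
    congrArg Arr.src (hL.app_eq hG (𝟙 L : L ⟶ L) i i hI hi hi ht ht₁)
  refine ⟨{ k := fun t ht x h => L.F.map (CechOb.arrow h.symm) ≫ eqToHom (hc t ht)
            nat := fun t ht x x' h h' => ?_
            loc := fun j t₀ ht₀ h₀ => ?_ }⟩
  · rw [← Category.assoc, ← L.F.map_comp]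
    rfl
  · filter_upwards [hL.app_eventually_eq hG (𝟙 L : L ⟶ L) j i t₀ h₀ (hi t₀ ht₀)] with t ht h h'
    rw [Arr.mk_comp_eqToHom, Arr.mk_comp_eqToHom]
    exact ht h' (hi t h)

/-- The quotient of the two frames is independent of the object over the point by naturality and
locally constant in `t`, hence constant on the connected overlap. For a frame and its translate by a
full turn, `c` is the holonomy. -/
theorem exists_comparison (K₁ : Frame L b₁ I₁) (K₂ : Frame L b₂ I₂)
    (hI : _root_.IsPreconnected (I₁ ∩ I₂)) (hne : (I₁ ∩ I₂).Nonempty) :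
    ∃ c : b₂ ⟶ b₁, ∀ t h₁ h₂ x h, K₁.k t h₁ x h = K₂.k t h₂ x h ≫ c := by
  let r : ∀ t ∈ I₁ ∩ I₂, (b₂ ⟶ b₁) := fun t ht =>
    Groupoid.inv (K₂.k t ht.2 (L.someOb (Circle.exp t)) rfl) ≫
      K₁.k t ht.1 (L.someOb (Circle.exp t)) rfl
  have hr : ∀ t (ht : t ∈ I₁ ∩ I₂) x h,
      r t ht = Groupoid.inv (K₂.k t ht.2 x h) ≫ K₁.k t ht.1 x h := by
    intro t ht x h
    simp only [r]
    rw [← K₁.nat t ht.1 (L.someOb (Circle.exp t)) x rfl h,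
      ← K₂.nat t ht.2 (L.someOb (Circle.exp t)) x rfl h]
    simp
  have hrc : ∀ t₀ h₀, ∀ᶠ t in 𝓝 t₀, ∀ h : t ∈ I₁ ∩ I₂, r t h = r t₀ h₀ := by
    intro t₀ h₀
    obtain ⟨i, hi⟩ := L.W.cover (Circle.exp t₀)
    filter_upwards [K₁.loc i t₀ h₀.1 hi, K₂.loc i t₀ h₀.2 hi, (L.isOpen_exp i).eventually_mem hi]
      with t h1 h2 h3 ht
    rw [hr t ht ⟨i, Circle.exp t, h3⟩ rfl, hr t₀ h₀ ⟨i, Circle.exp t₀, hi⟩ rfl]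
    exact Arr.inv_comp_eq (h2 ht.2 h3) (h1 ht.1 h3)
  obtain ⟨t₁, ht₁⟩ := hne
  refine ⟨r t₁ ht₁, fun t h₁ h₂ x h => ?_⟩
  rw [← eq_of_isPreconnected hI r hrc ⟨h₁, h₂⟩ ht₁, hr t ⟨h₁, h₂⟩ x h]
  simp

theorem Arr.mk_comp_eq {x x' y z : G} {f : x ⟶ y} {f' : x' ⟶ y} (g : y ⟶ z)
    (h : Arr.mk x y f = Arr.mk x' y f') : Arr.mk x z (f ≫ g) = Arr.mk x' z (f' ≫ g) := by
  cases h
  rfl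

open Classical in
-- Once `K₂` is corrected by the constant comparison arrow, the frames agree on the overlap;
-- openness lets local constancy be checked on either piece.
theorem nonempty_union (K₁ : Frame L b₁ I₁) (K₂ : Frame L b₂ I₂) (h₁ : IsOpen I₁) (h₂ : IsOpen I₂)
    (hI : _root_.IsPreconnected (I₁ ∩ I₂)) (hne : (I₁ ∩ I₂).Nonempty) :
    Nonempty (Frame L b₁ (I₁ ∪ I₂)) := by
  obtain ⟨c, hc⟩ := exists_comparison K₁ K₂ hI hne
  let k : ∀ t ∈ I₁ ∪ I₂, ∀ x : CechOb L.W, Circle.exp t = x.pt → (L.F.obj x ⟶ b₁) :=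
    fun t ht x h => if h1 : t ∈ I₁ then K₁.k t h1 x h else K₂.k t (ht.resolve_left h1) x h ≫ c
  have hk1 : ∀ t ht x h (h1 : t ∈ I₁), k t ht x h = K₁.k t h1 x h := fun t ht x h h1 => by
    simp [k, h1]
  have hk2 : ∀ t ht x h (h2 : t ∈ I₂), k t ht x h = K₂.k t h2 x h ≫ c := fun t ht x h h2 => by
    by_cases h1 : t ∈ I₁
    · rw [hk1 t ht x h h1, hc t h1 h2]
    · simp [k, h1]
  refine ⟨{ k := k, nat := fun t ht x x' h h' => ?_, loc := fun i t₀ ht₀ h₀ => ?_ }⟩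
  · rcases id ht with h1 | h2
    · rw [hk1 t ht x' h' h1, hk1 t ht x h h1, K₁.nat]
    · rw [hk2 t ht x' h' h2, hk2 t ht x h h2, ← Category.assoc, K₂.nat]
  · rcases id ht₀ with h1 | h2
    · filter_upwards [K₁.loc i t₀ h1 h₀, h₁.eventually_mem h1] with t ht ht1 ht' h
      rw [hk1 t₀ ht₀ _ _ h1, hk1 t ht' _ _ ht1]
      exact ht ht1 h
    · filter_upwards [K₂.loc i t₀ h2 h₀, h₂.eventually_mem h2] with t ht ht2 ht' h
      rw [hk2 t₀ ht₀ _ _ h2, hk2 t ht' _ _ ht2]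
      exact Arr.mk_comp_eq c (ht ht2 h)

/-- Translation of a frame by a full turn. -/
def shift (K : Frame L b I) : Frame L b ((fun t => t + 2 * Real.pi) ⁻¹' I) where
  k t ht x h := K.k (t + 2 * Real.pi) ht x (by rw [Circle.exp_add, Circle.exp_two_pi, mul_one, h])
  nat t ht x x' h h' := K.nat _ _ _ _ _ _
  loc i t₀ ht₀ h₀ := by
    have he : ∀ t, Circle.exp (t + 2 * Real.pi) = Circle.exp t := fun t => by
      rw [Circle.exp_add, Circle.exp_two_pi, mul_one]
    have hc : ContinuousAt (fun t => t + 2 * Real.pi) t₀ := by fun_prop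
    filter_upwards [hc (K.loc i _ ht₀ (by rw [he]; exact h₀))] with t h1 ht h
    have := h1 ht (by rw [he]; exact h)
    exact (K.arr_eq ht (he t) h).trans (this.trans (K.arr_eq ht₀ (he t₀) h₀).symm)

/-- Short intervals lie over one member of the cover by the Lebesgue number lemma and carry frames,
which are glued from left to right. -/
theorem exists_Ioo (hG : IsOrbifoldGroupoid G) (hL : L.IsFlat) {A B : ℝ} (hAB : A < B) :
    ∃ b, Nonempty (Frame L b (Set.Ioo A B)) := by
  obtain ⟨δ, hδ, hball⟩ := lebesgue_number_lemma_of_metric (isCompact_Icc (a := A) (b := B))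
    L.isOpen_exp fun t _ => Set.mem_iUnion.2 (L.W.cover (Circle.exp t))
  have step : ∀ n : ℕ, ∀ B', A < B' → B' ≤ B → B' ≤ A + (n + 1) * (δ / 2) →
      ∃ b, Nonempty (Frame L b (Set.Ioo A B')) := by
    intro n
    induction n with
    | zero =>
      intro B' h1 h2 h3
      obtain ⟨i, hi⟩ := hball A ⟨le_rfl, hAB.le⟩
      refine ⟨_, nonempty_of_mem hG hL (i := i) isPreconnected_Ioo (fun t ht => hi ?_)
        (t₁ := (A + B') / 2) ⟨by linarith, by linarith⟩⟩
      rw [Real.ball_eq_Ioo]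
      exact ⟨by linarith [ht.1], by norm_num at h3; linarith [ht.2]⟩
    | succ n ih =>
      intro B' h1 h2 h3
      push_cast at h3
      by_cases hc : B' ≤ A + (n + 1) * (δ / 2)
      · exact ih B' h1 h2 hc
      push Not at hc
      have hn : 0 ≤ (n : ℝ) * (δ / 2) := by positivity
      obtain ⟨b, ⟨K₁⟩⟩ := ih (B' - δ / 2) (by linarith) (by linarith) (by linarith)
      obtain ⟨i, hi⟩ := hball B' ⟨h1.le, h2⟩
      have hlt : max A (B' - δ) < B' - δ / 2 := max_lt (by linarith) (by linarith)
      -- The new piece stays within `δ` of `B'`, hence in one member, and overlaps the old one,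
      -- which stops only at `B' - δ / 2`.
      obtain ⟨K₂⟩ := nonempty_of_mem hG hL (i := i) (I := Set.Ioo (max A (B' - δ)) B')
        isPreconnected_Ioo (fun t ht => hi (by
          rw [Real.ball_eq_Ioo]
          exact ⟨lt_of_le_of_lt (le_max_right _ _) ht.1, by linarith [ht.2]⟩))
        (t₁ := B' - δ / 2) ⟨hlt, by linarith⟩
      have hint : Set.Ioo A (B' - δ / 2) ∩ Set.Ioo (max A (B' - δ)) B' =
          Set.Ioo (max A (B' - δ)) (B' - δ / 2) := by
        rw [Set.Ioo_inter_Ioo, ← max_assoc, max_self, min_eq_left (by linarith)]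
      have huni : Set.Ioo A (B' - δ / 2) ∪ Set.Ioo (max A (B' - δ)) B' = Set.Ioo A B' := by
        ext t
        simp only [Set.mem_union, Set.mem_Ioo, max_lt_iff]
        constructor
        · rintro (⟨h, h'⟩ | ⟨⟨h, -⟩, h'⟩)
          · exact ⟨h, by linarith⟩
          · exact ⟨h, h'⟩
        · rintro ⟨h, h'⟩
          by_cases ht : t < B' - δ / 2
          · exact Or.inl ⟨h, ht⟩
          · exact Or.inr ⟨⟨h, by linarith⟩, h'⟩
      have := nonempty_union K₁ K₂ isOpen_Ioo isOpen_Ioo (hint ▸ isPreconnected_Ioo)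
        (hint ▸ Set.nonempty_Ioo.2 hlt)
      rw [huni] at this
      exact ⟨b, this⟩
  obtain ⟨n, hn⟩ := exists_nat_gt ((B - A) / (δ / 2))
  rw [div_lt_iff₀ (by positivity)] at hn
  exact step n B hAB le_rfl (by nlinarith)

end Frame

/-- Flat loops are isomorphic to constant loops with holonomy. -/
theorem Loop.IsFlat.exists_hom_constLoop (hG : IsOrbifoldGroupoid G) {L : Loop G}
    (hL : L.IsFlat) : ∃ v : Inertia G, Nonempty (L ⟶ v.constLoop) := by
  have hpi := Real.pi_pos
  -- The interval exceeds a full turn by `π`: it meets its translate in `(-π, 0)`, over the lower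
  -- half circle, and the comparison arrow there is the holonomy.
  obtain ⟨b, ⟨K⟩⟩ := Frame.exists_Ioo hG hL (A := -Real.pi) (B := 2 * Real.pi) (by linarith)
  have hint : Set.Ioo (-Real.pi) (2 * Real.pi) ∩
      (fun t => t + 2 * Real.pi) ⁻¹' Set.Ioo (-Real.pi) (2 * Real.pi) = Set.Ioo (-Real.pi) 0 := by
    ext t
    simp only [Set.mem_inter_iff, Set.mem_preimage, Set.mem_Ioo]
    constructor
    · rintro ⟨⟨h1, h2⟩, h3, h4⟩
      exact ⟨h1, by linarith⟩
    · rintro ⟨h1, h2⟩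
      exact ⟨⟨h1, by linarith⟩, by linarith, by linarith⟩
  obtain ⟨c, hc⟩ := Frame.exists_comparison K K.shift (hint ▸ isPreconnected_Ioo)
    (hint ▸ Set.nonempty_Ioo.2 (by linarith))
  exact ⟨⟨b, c⟩, ⟨Inertia.homOfFrame (v := ⟨b, c⟩) K fun t ht ht' x h h' => (hc t ht ht' x h).symm⟩⟩

end Flat

/-! ### Parametrizing intervals of the two arcs -/

/-- The interval parametrizing the arc with index `j`. -/
def arcInterval (j : ℕ) : Set ℝ :=
  if j = 0 then Set.Ioo 0 (2 * Real.pi) else Set.Ioo (-Real.pi) Real.pi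

theorem exp_pi : Circle.exp Real.pi = -1 :=
  Circle.ext (by simp [Circle.coe_exp, Complex.exp_pi_mul_I])

theorem isPreconnected_arcInterval (j : ℕ) : _root_.IsPreconnected (arcInterval j) := by
  unfold arcInterval
  split_ifs <;> exact isPreconnected_Ioo

theorem arcAngle_mem_arcInterval {j : ℕ} {z : Circle} (hz : z ∈ arcs.U j) :
    arcAngle j z ∈ arcInterval j := by
  rcases mem_arcs.1 hz with ⟨rfl, h⟩ | ⟨rfl, h⟩
  · rw [arcAngle_of_ne_one zero_ne_one]
    refine ⟨lt_of_le_of_ne (angle_nonneg z) fun h0 => h ?_, angle_lt z⟩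
    rw [← exp_angle z, ← h0, Circle.exp_zero]
  · rw [arcAngle_one]
    refine ⟨Complex.neg_pi_lt_arg _, lt_of_le_of_ne (Complex.arg_le_pi _) fun h0 => h ?_⟩
    rw [← Circle.exp_arg z, h0, exp_pi]

theorem exp_mem_arcs {j : ℕ} (hj : j = 0 ∨ j = 1) {t : ℝ} (ht : t ∈ arcInterval j) :
    Circle.exp t ∈ arcs.U j := by
  rcases hj with rfl | rfl
  · refine mem_arcs.2 (Or.inl ⟨rfl, fun h => ?_⟩)
    obtain ⟨m, hm⟩ := Circle.exp_eq_one.1 h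
    have h1 : 0 < t := ht.1
    have h2 : t < 2 * Real.pi := ht.2
    rw [hm] at h1 h2
    have h3 : (0 : ℝ) < m := by nlinarith [Real.two_pi_pos]
    have h4 : (m : ℝ) < 1 := by nlinarith [Real.two_pi_pos]
    have h5 : 0 < m := by exact_mod_cast h3
    have h6 : m < 1 := by exact_mod_cast h4
    omega
  · refine mem_arcs.2 (Or.inr ⟨rfl, fun h => ?_⟩)
    rw [← exp_pi] at h
    obtain ⟨m, hm⟩ := Circle.exp_eq_exp.1 h
    have h1 : -Real.pi < t := ht.1
    have h2 : t < Real.pi := ht.2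
    rw [hm] at h1 h2
    have h3 : (-1 : ℝ) < m := by nlinarith [Real.two_pi_pos]
    have h4 : (m : ℝ) < 0 := by nlinarith [Real.two_pi_pos]
    have h5 : -1 < m := by exact_mod_cast h3
    have h6 : m < 0 := by exact_mod_cast h4
    omega

theorem eq_zero_or_one_of_mem_arcs {j : ℕ} {z : Circle} (hz : z ∈ arcs.U j) : j = 0 ∨ j = 1 :=
  (mem_arcs.1 hz).imp And.left And.left

theorem exists_exp_eq {j : ℕ} {z : Circle} (hz : z ∈ arcs.U j) :
    ∃ t ∈ arcInterval j, Circle.exp t = z :=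
  ⟨_, arcAngle_mem_arcInterval hz, exp_arcAngle j z⟩

theorem mem_arcs_of_im_ne_zero {j : ℕ} (hj : j = 0 ∨ j = 1) {z : Circle} (hz : (z : ℂ).im ≠ 0) :
    z ∈ arcs.U j := by
  refine mem_arcs.2 (hj.imp (fun h => ⟨h, ?_⟩) fun h => ⟨h, ?_⟩) <;>
  · rintro rfl
    simp at hz

theorem exp_pi_mem : Circle.exp Real.pi ∈ arcs.U 0 :=
  exp_mem_arcs (Or.inl rfl) ⟨Real.pi_pos, by linarith [Real.pi_pos]⟩

theorem im_exp (t : ℝ) : ((Circle.exp t : Circle) : ℂ).im = Real.sin t := by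
  rw [Circle.coe_exp, Complex.exp_ofReal_mul_I_im]

/-! ### The constant-loop functor is smooth and fully faithful -/

section Groupoid

variable {G : Type u} [DiffeologicalGroupoid.{v} G]

open DiffeologicalGroupoid (smooth_src smooth_tgt smooth_id smooth_inv)

namespace Inertia

theorem frame_of_ne_one (v : Inertia G) {i : ℕ} (hi : i ≠ 1) (z : Circle) :
    v.frame i z = 𝟙 _ := by simp [frame, hi]

theorem frame_of_nonneg (v : Inertia G) (i : ℕ) {z : Circle} (hz : 0 ≤ (z : ℂ).im) :
    v.frame i z = 𝟙 _ := by simp [frame, hz]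

theorem frame_of_neg (v : Inertia G) {z : Circle} (hz : (z : ℂ).im < 0) :
    v.frame 1 z = v.loop := by simp [frame, hz]

theorem comm_frame {v w : Inertia G} (α : v ⟶ w) (i : ℕ) (z : Circle) :
    v.frame i z ≫ Hom.hom α = Hom.hom α ≫ w.frame i z := by
  unfold frame
  split_ifs
  · exact Hom.comm α
  · simp

theorem inv_frame_comp {v w : Inertia G} (α : v ⟶ w) (i : ℕ) (z : Circle) :
    Groupoid.inv (v.frame i z) ≫ Hom.hom α ≫ w.frame i z = Hom.hom α := by
  rw [← comm_frame]
  simp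

theorem isPlot_frame_of_sign {m : ℕ} {v : Param m → Inertia G} (hv : IsPlot v)
    {z : Param m → Circle} (hz : (∀ a, (z a : ℂ).im < 0) ∨ ∀ a, 0 ≤ (z a : ℂ).im) (i : ℕ) :
    IsPlot (fun a => Arr.mk _ _ ((v a).frame i (z a))) := by
  by_cases h : i = 1 ∧ ∀ a, (z a : ℂ).im < 0
  · obtain ⟨rfl, h⟩ := h
    refine (congrArg IsPlot (funext fun a => ?_)).mp (show IsPlot (fun a => (v a).toArr) from hv)
    rw [frame_of_neg _ (h a)]
    rfl
  · refine (congrArg IsPlot (funext fun a => ?_)).mp (smooth_id m _ (dSmooth_pt m v hv))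
    by_cases hi : i = 1
    · have h' := hz.resolve_left fun h' => h ⟨hi, h'⟩
      rw [frame_of_nonneg _ _ (h' a)]
      rfl
    · rw [frame_of_ne_one _ hi]
      rfl

/-- On a single arc the frames cancel. On two different arcs the point avoids `±1`, so it stays
locally in one half circle, where each frame is either the holonomy or the identity throughout. -/
theorem isPlot_frame {m : ℕ} {f : Param m → Arr (Inertia G)} (hf : IsPlot f)
    {z : Param m → Circle} (hz : IsPlot z) (i j : ℕ) (hi : ∀ a, z a ∈ arcs.U i)
    (hj : ∀ a, z a ∈ arcs.U j) :
    IsPlot (fun a => Arr.mk _ _ (Groupoid.inv ((f a).src.frame i (z a)) ≫ Hom.hom (f a).hom ≫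
      (f a).tgt.frame j (z a))) := by
  by_cases hij : i = j
  · subst hij
    refine (congrArg IsPlot (funext fun a => ?_)).mp (dSmooth_arrow m f hf)
    rw [inv_frame_comp]
    rfl
  have him : Continuous (fun a => (z a : ℂ).im) :=
    Complex.continuous_im.comp (continuous_subtype_val.comp (Loop.plot_continuous hz))
  have key : ∀ {k : ℕ} (c : Param k → Param m), ContDiff ℝ ∞ c →
      ((∀ a, (z (c a) : ℂ).im < 0) ∨ ∀ a, 0 ≤ (z (c a) : ℂ).im) →
      IsPlot (fun a => Arr.mk _ _ (Groupoid.inv ((f (c a)).src.frame i (z (c a))) ≫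
        Hom.hom (f (c a)).hom ≫ (f (c a)).tgt.frame j (z (c a)))) := by
    intro k c hc hs
    have hfc : IsPlot (fun a => f (c a)) := isPlot_reparam hf hc
    have h1 := smooth_inv k _ (isPlot_frame_of_sign (smooth_src k _ hfc) hs i)
    have h2 := isPlot_frame_of_sign (smooth_tgt k _ hfc) hs j
    have h3 := DiffeologicalGroupoid.smooth_comp _ _ (dSmooth_arrow k _ hfc) h2
    exact DiffeologicalGroupoid.smooth_comp _ _ h1 h3
  refine DiffeologicalSpace.locality fun a => ?_
  have hne : (z a : ℂ).im ≠ 0 := by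
    intro h0
    rcases mem_arcs.1 (hi a) with ⟨h1, h2⟩ | ⟨h1, h2⟩ <;>
      rcases mem_arcs.1 (hj a) with ⟨h3, h4⟩ | ⟨h3, h4⟩ <;>
      first
      | exact hij (h1.trans h3.symm)
      | rcases eq_one_or_eq_neg_one h0 with h | h <;> contradiction
  rcases lt_or_gt_of_ne hne with h | h
  · exact ⟨{b | (z b : ℂ).im < 0}, isOpen_lt him continuous_const, h,
      fun {k c} hc hc' => key c hc' (Or.inl hc)⟩
  · exact ⟨{b | 0 < (z b : ℂ).im}, isOpen_lt continuous_const him, h,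
      fun {k c} hc hc' => key c hc' (Or.inr fun a => (hc a).le)⟩

theorem isSmoothFamily_constLoop {n : ℕ} {v : Param n → Inertia G} (hv : IsPlot v) :
    Loop.IsSmoothFamily (fun a => (v a).constLoop) := by
  refine ⟨fun i => (arcs.isOpen i).preimage continuous_snd, fun i m r hr =>
    dSmooth_pt m _ (isPlot_reparam hv (IsPlot.contDiff hr.1)), fun i j m r hr => ?_⟩
  have h1 := isPlot_frame (smooth_id m _ (isPlot_reparam hv (IsPlot.contDiff hr.1))) hr.2 i j
    (fun a => (r a).2.1) (fun a => (r a).2.2)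
  refine (congrArg IsPlot (funext fun a => ?_)).mp h1
  exact congrArg (Arr.mk _ _) (congrArg (_ ≫ ·) (Category.id_comp _))

theorem isSmoothArrFamily_map {n : ℕ} {f : Param n → Arr (Inertia G)} (hf : IsPlot f) :
    Loop.IsSmoothArrFamily (fun a => mapArr (constLoops G) (f a)) :=
  ⟨isSmoothFamily_constLoop (smooth_src n f hf), isSmoothFamily_constLoop (smooth_tgt n f hf),
    fun i j _ r hr => isPlot_frame (isPlot_reparam hf (IsPlot.contDiff hr.1)) hr.2 i j
      (fun a => (r a).2.1) (fun a => (r a).2.2)⟩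

/-- The object over `-1` used to evaluate transformations. -/
def baseOb : CechOb arcs := ⟨0, Circle.exp Real.pi, exp_pi_mem⟩

/-- Evaluation at `-1` recovers the arrow: this gives faithfulness and, in families, smoothness of
lifts. -/
theorem map_app_baseOb {v w : Inertia G} (α : v ⟶ w) :
    Loop.Hom.app (L := v.constLoop) (M := w.constLoop) ((constLoops G).map α) baseOb baseOb rfl =
      Hom.hom α := by
  exact inv_frame_comp α 0 (Circle.exp Real.pi)

theorem comp_eq_of_inv_id_comp {a b : G} {p q : a ⟶ b} {l : a ⟶ a} {r : b ⟶ b}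
    (h : (Groupoid.inv (𝟙 a) ≫ l) ≫ p = q ≫ (Groupoid.inv (𝟙 b) ≫ r)) : l ≫ p = q ≫ r := by
  simpa using h

/-- Constant loops are flat, so the components are locally constant, and the arc is connected. -/
theorem app_diag_eq (hG : IsOrbifoldGroupoid G) {v w : Inertia G}
    (f : Loop.Hom v.constLoop w.constLoop) {j : ℕ} {z z' : Circle} (hz : z ∈ arcs.U j)
    (hz' : z' ∈ arcs.U j) :
    (f.app ⟨j, z, hz⟩ ⟨j, z, hz⟩ rfl : v.pt ⟶ w.pt) = f.app ⟨j, z', hz'⟩ ⟨j, z', hz'⟩ rfl := by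
  obtain ⟨t, ht, rfl⟩ := exists_exp_eq hz
  obtain ⟨t', ht', rfl⟩ := exists_exp_eq hz'
  have hj := eq_zero_or_one_of_mem_arcs hz
  have h := (isFlat_constLoop v).app_eq hG f j j (isPreconnected_arcInterval j)
    (fun t ht => exp_mem_arcs hj ht) (fun t ht => exp_mem_arcs hj ht) ht ht'
  injection h

/-- The functor from the inertia groupoid to the loop groupoid is full. -/
theorem exists_map_eq (hG : IsOrbifoldGroupoid G) {v w : Inertia G}
    (f : v.constLoop ⟶ w.constLoop) : ∃ α : v ⟶ w, (constLoops G).map α = f := by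
  let f' : Loop.Hom v.constLoop w.constLoop := f
  let β : v.pt ⟶ w.pt := f'.app baseOb baseOb rfl
  have h0 : ∀ z (hz : z ∈ arcs.U 0), f'.app ⟨0, z, hz⟩ ⟨0, z, hz⟩ rfl = β :=
    fun z hz => app_diag_eq hG f' hz exp_pi_mem
  have nat : ∀ z (h0 : z ∈ arcs.U 0) (h1 : z ∈ arcs.U 1),
      (Groupoid.inv (v.frame 0 z) ≫ v.frame 1 z) ≫
          (f'.app ⟨1, z, h1⟩ ⟨1, z, h1⟩ rfl : v.pt ⟶ w.pt) =
        (f'.app ⟨0, z, h0⟩ ⟨0, z, h0⟩ rfl : v.pt ⟶ w.pt) ≫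
          (Groupoid.inv (w.frame 0 z) ≫ w.frame 1 z) := fun z h0 h1 =>
    f'.natural ⟨0, z, h0⟩ ⟨1, z, h1⟩ ⟨0, z, h0⟩ ⟨1, z, h1⟩ rfl rfl (CechOb.arrow rfl)
      (CechOb.arrow rfl)
  have hpos : 0 < ((Circle.exp (Real.pi / 2) : Circle) : ℂ).im := by rw [im_exp]; simp
  have hneg : ((Circle.exp (-(Real.pi / 2)) : Circle) : ℂ).im < 0 := by rw [im_exp]; simp
  have h1 : ∀ z (hz : z ∈ arcs.U 1), f'.app ⟨1, z, hz⟩ ⟨1, z, hz⟩ rfl = β := by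
    intro z hz
    -- Over the upper half circle the transition arrows are identities, so the constants on the two
    -- arcs agree.
    have := nat _ (mem_arcs_of_im_ne_zero (Or.inl rfl) hpos.ne')
      (mem_arcs_of_im_ne_zero (Or.inr rfl) hpos.ne')
    rw [frame_of_nonneg v _ hpos.le, frame_of_nonneg v _ hpos.le, frame_of_nonneg w _ hpos.le,
      frame_of_nonneg w _ hpos.le, h0] at this
    refine (app_diag_eq hG f' hz (mem_arcs_of_im_ne_zero (Or.inr rfl) hpos.ne')).trans ?_
    exact (Category.id_comp _).symm.trans ((comp_eq_of_inv_id_comp this).trans (Category.comp_id _))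
  have hβ : v.loop ≫ β = β ≫ w.loop := by
    -- Over the lower half circle they are the holonomies, so naturality is the relation defining
    -- arrows of `∧G`.
    have := nat _ (mem_arcs_of_im_ne_zero (Or.inl rfl) hneg.ne)
      (mem_arcs_of_im_ne_zero (Or.inr rfl) hneg.ne)
    rw [frame_of_ne_one v zero_ne_one, frame_of_ne_one w zero_ne_one, frame_of_neg v hneg,
      frame_of_neg w hneg, h0, h1] at this
    exact comp_eq_of_inv_id_comp this
  let α : v ⟶ w := (⟨β, hβ⟩ : Hom v w)
  refine ⟨α, Loop.Hom.ext (funext fun x => funext fun y => funext fun h => ?_)⟩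
  obtain ⟨i, z, hz⟩ := x
  obtain ⟨j, z', hz'⟩ := y
  obtain rfl : z = z' := h
  have hd : f'.app ⟨i, z, hz⟩ ⟨i, z, hz⟩ rfl = β := by
    rcases eq_zero_or_one_of_mem_arcs hz with rfl | rfl
    · exact h0 z hz
    · exact h1 z hz
  -- Components between different arcs are determined by the diagonal ones through naturality.
  have hn := f'.natural ⟨i, z, hz⟩ ⟨i, z, hz⟩ ⟨i, z, hz⟩ ⟨j, z, hz'⟩ rfl rfl (𝟙 _)
    (CechOb.arrow rfl)
  rw [v.constLoop.F.map_id, Category.id_comp, hd] at hn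
  refine Eq.trans ?_ hn.symm
  change Groupoid.inv (v.frame i z) ≫ β ≫ w.frame j z =
      β ≫ (Groupoid.inv (w.frame i z) ≫ w.frame j z)
  have hc : v.frame i z ≫ β = β ≫ w.frame i z := comm_frame α i z
  have hc' : Groupoid.inv (v.frame i z) ≫ β = β ≫ Groupoid.inv (w.frame i z) := by
    rw [Groupoid.inv_eq_inv, Groupoid.inv_eq_inv, IsIso.inv_comp_eq, ← Category.assoc, hc]
    simp
  rw [← Category.assoc, hc', Category.assoc]

theorem map_injective {v w : Inertia G} {α β : v ⟶ w}
    (h : (constLoops G).map α = (constLoops G).map β) : α = β := by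
  apply Hom.ext
  rw [← map_app_baseOb α, ← map_app_baseOb β, h]

variable (G) in
/-- The functor from the inertia groupoid to the fixed loops. -/
abbrev fixedConstLoops : Inertia G ⥤ FixedLoops G :=
  FullSub.lift Loop.IsFixed (constLoops G) isFixed_constLoop

/-- Full faithfulness gives a unique pointwise lift; it is smooth because its underlying arrow is
the value of `g` at `-1`. -/
theorem cartesian_fixedConstLoops (hG : IsOrbifoldGroupoid G) {n : ℕ} (x y : Param n → Inertia G)
    (g : Param n → Arr (FixedLoops G)) (hx : IsPlot x) (hg : IsPlot g)
    (hs : ∀ a, (g a).src = (fixedConstLoops G).obj (x a))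
    (ht : ∀ a, (g a).tgt = (fixedConstLoops G).obj (y a)) :
    ∃! f : Param n → Arr (Inertia G), IsPlot f ∧
      ∀ a, (f a).src = x a ∧ (f a).tgt = y a ∧ mapArr (fixedConstLoops G) (f a) = g a := by
  have key : ∀ a, ∃! f : Arr (Inertia G), f.src = x a ∧ f.tgt = y a ∧
      mapArr (fixedConstLoops G) f = g a := by
    intro a
    have hsa := hs a
    have hta := ht a
    generalize g a = k at hsa hta
    obtain ⟨s, t, k⟩ := k
    dsimp only at hsa hta
    subst hsa hta
    obtain ⟨α, hα⟩ := exists_map_eq hG k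
    refine ⟨⟨x a, y a, α⟩, ⟨rfl, rfl, congrArg (Arr.mk _ _) hα⟩, ?_⟩
    rintro ⟨s, t, β⟩ ⟨h1, h2, h3⟩
    dsimp only at h1 h2
    subst h1 h2
    have h4 : (fixedConstLoops G).map β = k := by
      injection h3
    exact congrArg (Arr.mk _ _) (map_injective (h4.trans hα.symm))
  choose f hf hfu using key
  dsimp only at hf hfu
  refine ⟨f, ⟨?_, hf⟩, fun f' hf' => funext fun a => hfu a _ (hf'.2 a)⟩
  obtain rfl : (fun a => mapArr (fixedConstLoops G) (f a)) = g := funext fun a => (hf a).2.2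
  refine isPlot_arr ((congrArg IsPlot (funext fun a => (hf a).1)).mpr hx) ?_
  have h1 := hg.2.2 0 0 n (fun a => ⟨(a, Circle.exp Real.pi), exp_pi_mem, exp_pi_mem⟩)
    ⟨isPlot_id, isPlot_const⟩
  refine (congrArg IsPlot (funext fun a => ?_)).mp h1
  exact congrArg (Arr.mk _ _) (map_app_baseOb (f a).hom)

end Inertia

end Groupoid

/-! ### Smooth families of transformations to constant loops -/

section Groupoid

variable {G : Type u} [DiffeologicalGroupoid.{v} G]

open DiffeologicalGroupoid (smooth_src smooth_tgt smooth_id smooth_inv)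

/-- The value of a transformation of loops at a point of the circle. -/
def Loop.Hom.arr {L M : Loop G} (f : Loop.Hom L M) (i j : ℕ) (z : Circle) (hi : z ∈ L.W.U i)
    (hj : z ∈ M.W.U j) : Arr G :=
  ⟨_, _, f.app ⟨i, z, hi⟩ ⟨j, z, hj⟩ rfl⟩

theorem Loop.Hom.arr_left {L M : Loop G} (f : Loop.Hom L M) (i i' j : ℕ) (z : Circle)
    (hi : z ∈ L.W.U i) (hi' : z ∈ L.W.U i') (hj : z ∈ M.W.U j) :
    f.arr i' j z hi' hj = (Arr.mk _ _ (L.F.map (CechOb.arrow (x := ⟨i', z, hi'⟩)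
      (y := ⟨i, z, hi⟩) rfl))).comp (f.arr i j z hi hj) := by
  have := f.natural ⟨i', z, hi'⟩ ⟨i, z, hi⟩ ⟨j, z, hj⟩ ⟨j, z, hj⟩ rfl rfl (CechOb.arrow rfl) (𝟙 _)
  rw [M.F.map_id, Category.comp_id] at this
  simp only [Loop.Hom.arr, Arr.comp_mk, this]

namespace Inertia

/-- Naturality in the target. Over the lower half circle it expresses the holonomy through the
components on the two arcs. -/
theorem app_change_arc {L : Loop G} {v : Inertia G} (f : Loop.Hom L v.constLoop) {i j j' : ℕ}
    {z : Circle} (hi : z ∈ L.W.U i) (hj : z ∈ arcs.U j) (hj' : z ∈ arcs.U j') :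
    (f.app ⟨i, z, hi⟩ ⟨j', z, hj'⟩ rfl : L.F.obj ⟨i, z, hi⟩ ⟶ v.pt) =
      (f.app ⟨i, z, hi⟩ ⟨j, z, hj⟩ rfl : L.F.obj ⟨i, z, hi⟩ ⟶ v.pt) ≫
        (Groupoid.inv (v.frame j z) ≫ v.frame j' z) := by
  have hn := f.natural ⟨i, z, hi⟩ ⟨i, z, hi⟩ ⟨j, z, hj⟩ ⟨j', z, hj'⟩ rfl rfl (𝟙 _)
    (CechOb.arrow rfl)
  rw [L.F.map_id, Category.id_comp] at hn
  exact hn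

theorem inv_comp_comp_inv_id {a b : G} (p : a ⟶ b) (q : b ⟶ b) :
    Groupoid.inv p ≫ p ≫ (Groupoid.inv (𝟙 b) ≫ q) = q := by
  simp

section Transport

variable {n : ℕ} {L : Param n → Loop G} {v : Param n → Inertia G}
  (f : ∀ a, Loop.Hom (L a) (v a).constLoop)

/-- Smoothness in the parameter, near `a₀`, of the values of a family of transformations at a
point of the circle. -/
def SmoothAt (a₀ : Param n) (i j : ℕ) (z : Circle) : Prop :=
  ∃ O : Set (Param n), IsOpen O ∧ a₀ ∈ O ∧ ∀ (m : ℕ) (c : Param m → Param n), ContDiff ℝ ∞ c →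
    (∀ b, c b ∈ O) → ∀ (hi : ∀ b, z ∈ (L (c b)).W.U i) (hj : z ∈ arcs.U j),
      IsPlot (fun b => (f (c b)).arr i j z (hi b) hj)

theorem isOpen_mem_cover (hL : Loop.IsSmoothFamily L) (i : ℕ) (z : Circle) :
    IsOpen {a | z ∈ (L a).W.U i} :=
  (hL.1 i).preimage (Continuous.prodMk_left z)

variable {f} in
theorem SmoothAt.change_index (hL : Loop.IsSmoothFamily L) {a₀ : Param n} {i j : ℕ} {z : Circle}
    (h : SmoothAt f a₀ i j z) (hi : z ∈ (L a₀).W.U i) (i' : ℕ) : SmoothAt f a₀ i' j z := by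
  obtain ⟨O, hO, haO, h⟩ := h
  refine ⟨O ∩ {a | z ∈ (L a).W.U i}, hO.inter (isOpen_mem_cover hL i z), ⟨haO, hi⟩,
    fun m c hc hcO hi' hj => ?_⟩
  have h1 := h m c hc (fun b => (hcO b).1) (fun b => (hcO b).2) hj
  have h2 := hL.2.2 i' i m (fun b => ⟨(c b, z), hi' b, (hcO b).2⟩) ⟨hc.isPlot, isPlot_const⟩
  refine (congrArg IsPlot (funext fun b => ?_)).mp (isPlot_comp h2 h1 fun b => rfl)
  exact ((f (c b)).arr_left i i' j z _ _ _).symm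

variable {f} in
-- Over the upper half circle the transition between the arcs is the identity. Elsewhere it could
-- involve the holonomy, whose smooth dependence on the parameter is still to be proved.
theorem SmoothAt.change_arc {a₀ : Param n} {i : ℕ} {z : Circle} (hz : 0 < (z : ℂ).im)
    (h : SmoothAt f a₀ i 0 z) : SmoothAt f a₀ i 1 z := by
  obtain ⟨O, hO, haO, h⟩ := h
  refine ⟨O, hO, haO, fun m c hc hcO hi hj => ?_⟩
  have hj0 := mem_arcs_of_im_ne_zero (Or.inl rfl) hz.ne'
  refine (congrArg IsPlot (funext fun b => ?_)).mp (h m c hc hcO hi hj0)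
  refine congrArg (Arr.mk _ _) (Eq.symm ?_)
  refine (app_change_arc (f (c b)) (hi b) hj0 hj).trans ?_
  rw [frame_of_nonneg _ _ hz.le, frame_of_nonneg _ _ hz.le]
  exact (congrArg (_ ≫ ·) (Groupoid.inv_comp _)).trans (Category.comp_id _)

/-- Near each point, transformations are constant along the circle, uniformly in the parameter. -/
theorem exists_tube (hG : IsOrbifoldGroupoid G) (hL : Loop.IsSmoothFamily L)
    (hflat : ∀ a, (L a).IsFlat) (a₀ : Param n) {t₀ : ℝ} {i j : ℕ}
    (hi : Circle.exp t₀ ∈ (L a₀).W.U i) (hj : Circle.exp t₀ ∈ arcs.U j) :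
    ∃ (A : Set (Param n)) (T : Set ℝ), IsOpen A ∧ IsOpen T ∧ a₀ ∈ A ∧ t₀ ∈ T ∧
      (∀ a ∈ A, ∀ t ∈ T, Circle.exp t ∈ (L a).W.U i) ∧ (∀ t ∈ T, Circle.exp t ∈ arcs.U j) ∧
      ∀ a ∈ A, ∀ t ∈ T, ∀ t' ∈ T, ∀ hi hj hi' hj',
        (f a).arr i j (Circle.exp t) hi hj = (f a).arr i j (Circle.exp t') hi' hj' := by
  have h1 : IsOpen {q : Param n × ℝ | Circle.exp q.2 ∈ (L q.1).W.U i} :=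
    (hL.1 i).preimage (continuous_fst.prodMk (Circle.exp.continuous.comp continuous_snd))
  obtain ⟨A, T₁, hA, hT₁, ha, ht₁, hAT⟩ := isOpen_prod_iff.1 h1 a₀ t₀ hi
  have h2 : IsOpen (T₁ ∩ {t | Circle.exp t ∈ arcs.U j}) :=
    hT₁.inter ((arcs.isOpen j).preimage Circle.exp.continuous)
  obtain ⟨ε, hε, hb⟩ := Metric.isOpen_iff.1 h2 t₀ ⟨ht₁, hj⟩
  have hAT' : ∀ a ∈ A, ∀ t ∈ Metric.ball t₀ ε, Circle.exp t ∈ (L a).W.U i :=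
    fun a ha t ht => @hAT (a, t) ⟨ha, (hb ht).1⟩
  refine ⟨A, Metric.ball t₀ ε, hA, Metric.isOpen_ball, ha, Metric.mem_ball_self hε, hAT',
    fun t ht => (hb ht).2, ?_⟩
  intro a ha t ht t' ht' _ _ _ _
  -- Shrinking is needed only for membership in the covers; constancy holds on the whole ball by
  -- connectedness, so one `T` serves every parameter in `A`.
  have hpre : _root_.IsPreconnected (Metric.ball t₀ ε) := (convex_ball t₀ ε).isPreconnected
  exact (hflat a).app_eq hG (f a) i j hpre (hAT' a ha)
    (fun t ht => (hb ht).2) ht ht'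

/-- Smoothness in the parameter propagates along the arcs. -/
theorem smoothAt_of_smoothAt (hG : IsOrbifoldGroupoid G) (hL : Loop.IsSmoothFamily L)
    (hflat : ∀ a, (L a).IsFlat) (a₀ : Param n) {j : ℕ} {z z' : Circle} (hz : z ∈ arcs.U j)
    (hz' : z' ∈ arcs.U j) (h : ∀ i, SmoothAt f a₀ i j z) (i : ℕ) : SmoothAt f a₀ i j z' := by
  obtain ⟨t, ht, rfl⟩ := exists_exp_eq hz
  obtain ⟨t', ht', rfl⟩ := exists_exp_eq hz'
  have hj := eq_zero_or_one_of_mem_arcs hz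
  -- Smoothness at `exp t` for all `i` is treated as a `Prop`-valued function of `t`: being locally
  -- constant, it is constant on the arc.
  refine (eq_of_isPreconnected (isPreconnected_arcInterval j)
    (fun t _ => ∀ i, SmoothAt f a₀ i j (Circle.exp t)) (fun t₀ ht₀ => ?_) ht ht').mp h i
  obtain ⟨i₀, hi₀⟩ := (L a₀).W.cover (Circle.exp t₀)
  obtain ⟨A, T, hA, hT, haA, htT, hAT, hTj, heq⟩ := exists_tube f hG hL hflat a₀ hi₀
    (exp_mem_arcs hj ht₀)
  have step : ∀ t ∈ T, ∀ t' ∈ T, (∀ i, SmoothAt f a₀ i j (Circle.exp t)) →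
      ∀ i, SmoothAt f a₀ i j (Circle.exp t') := by
    intro t ht t' ht' h
    refine SmoothAt.change_index hL (i := i₀) ?_ (hAT a₀ haA t' ht')
    obtain ⟨O, hO, haO, h⟩ := h i₀
    refine ⟨O ∩ A, hO.inter hA, ⟨haO, haA⟩, fun m c hc hcO hi' hj' => ?_⟩
    refine (congrArg IsPlot (funext fun b => ?_)).mp (h m c hc (fun b => (hcO b).1)
      (fun b => hAT _ (hcO b).2 t ht) (hTj t ht))
    exact heq _ (hcO b).2 t ht t' ht' _ _ _ _
  filter_upwards [hT.eventually_mem htT] with t ht _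
  exact propext ⟨step t ht t₀ htT, step t₀ htT t ht⟩

/-- A family of transformations to constant loops that is smooth at one point of the circle is
smooth, and so are the holonomies. -/
theorem isSmoothArrFamily_of_base (hG : IsOrbifoldGroupoid G) (hL : Loop.IsSmoothFamily L)
    (hflat : ∀ a, (L a).IsFlat) (j₀ : ℕ) (h0 : ∀ a, Circle.exp Real.pi ∈ (L a).W.U j₀)
    (hε : IsPlot (fun a => (f a).arr j₀ 0 (Circle.exp Real.pi) (h0 a) exp_pi_mem)) :
    IsPlot v ∧ Loop.IsSmoothArrFamily (fun a => ⟨L a, (v a).constLoop, f a⟩) := by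
  have hpos : 0 < ((Circle.exp (Real.pi / 2) : Circle) : ℂ).im := by rw [im_exp]; simp
  have hneg : ((Circle.exp (-(Real.pi / 2)) : Circle) : ℂ).im < 0 := by rw [im_exp]; simp
  have hz0 : ∀ a₀ i z, z ∈ arcs.U 0 → SmoothAt f a₀ i 0 z := by
    intro a₀ i z hz
    refine smoothAt_of_smoothAt f hG hL hflat a₀ exp_pi_mem hz ?_ i
    exact SmoothAt.change_index hL ⟨Set.univ, isOpen_univ, trivial,
      fun m c hc _ _ _ => isPlot_reparam hε hc⟩ (h0 a₀)
  -- The second arc is entered at `exp (π / 2)`, in the upper half circle.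
  have hz1 : ∀ a₀ i z, z ∈ arcs.U 1 → SmoothAt f a₀ i 1 z := by
    intro a₀ i z hz
    refine smoothAt_of_smoothAt f hG hL hflat a₀ (mem_arcs_of_im_ne_zero (Or.inr rfl) hpos.ne') hz
      (fun i => ?_) i
    exact (hz0 a₀ i _ (mem_arcs_of_im_ne_zero (Or.inl rfl) hpos.ne')).change_arc hpos
  have hall : ∀ a₀ i j z, z ∈ arcs.U j → SmoothAt f a₀ i j z := by
    intro a₀ i j z hz
    rcases eq_zero_or_one_of_mem_arcs hz with rfl | rfl
    · exact hz0 a₀ i z hz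
    · exact hz1 a₀ i z hz
  -- At `exp (-π / 2)` the components on the two arcs differ by the holonomy, which is therefore a
  -- quotient of smooth families.
  have hv : IsPlot v := by
    change IsPlot (fun a => (v a).toArr)
    refine DiffeologicalSpace.locality fun a₀ => ?_
    set z := Circle.exp (-(Real.pi / 2))
    have hj0 : z ∈ arcs.U 0 := mem_arcs_of_im_ne_zero (Or.inl rfl) hneg.ne
    have hj1 : z ∈ arcs.U 1 := mem_arcs_of_im_ne_zero (Or.inr rfl) hneg.ne
    obtain ⟨i, hi⟩ := (L a₀).W.cover z
    obtain ⟨O, hO, haO, h⟩ := hz0 a₀ i z hj0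
    obtain ⟨O', hO', haO', h'⟩ := hz1 a₀ i z hj1
    refine ⟨O ∩ O' ∩ {a | z ∈ (L a).W.U i}, (hO.inter hO').inter (isOpen_mem_cover hL i z),
      ⟨⟨haO, haO'⟩, hi⟩, fun {m c} hcO hc => ?_⟩
    have h1 := smooth_inv m _ (h m c hc (fun b => (hcO b).1.1) (fun b => (hcO b).2) hj0)
    have h2 := h' m c hc (fun b => (hcO b).1.2) (fun b => (hcO b).2) hj1
    refine (congrArg IsPlot (funext fun b => ?_)).mp (isPlot_comp h1 h2 fun b => rfl)
    refine (Arr.comp_mk _ _).trans (congrArg (Arr.mk _ _) ?_)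
    refine (congrArg (_ ≫ ·) (app_change_arc (f (c b)) (hcO b).2 hj0 hj1)).trans ?_
    rw [frame_of_ne_one _ zero_ne_one, frame_of_neg _ hneg]
    exact inv_comp_comp_inv_id _ _
  refine ⟨hv, hL, isSmoothFamily_constLoop hv, fun i j m r hr => ?_⟩
  have hr1 : IsPlot (fun b => (r b).1.1) := hr.1
  have hr2 : IsPlot (fun b => (r b).1.2) := hr.2
  refine DiffeologicalSpace.locality fun b₀ => ?_
  have hj : (r b₀).1.2 ∈ arcs.U j := (r b₀).2.2
  have hez : ∀ z, Circle.exp (arcAngle j z) = z := exp_arcAngle j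
  -- The tube replaces the moving point of the circle by the one at `b₀`, which reduces joint
  -- smoothness to smoothness in the parameter.
  obtain ⟨A, T, hA, hT, haA, htT, hAT, hTj, heq⟩ := exists_tube f hG hL hflat (r b₀).1.1
    (t₀ := arcAngle j (r b₀).1.2) (i := i) (j := j) ((hez _).symm ▸ (r b₀).2.1) ((hez _).symm ▸ hj)
  obtain ⟨O, hO, haO, h⟩ := hall (r b₀).1.1 i j (r b₀).1.2 hj
  have hc1 : ContinuousAt (fun b => (r b).1.1) b₀ := hr1.contDiff.continuous.continuousAt
  have hc2 : ContinuousAt (fun b => arcAngle j (r b).1.2) b₀ :=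
    ContinuousAt.comp (f := fun b => (r b).1.2) (continuousAt_arcAngle hj)
      (Loop.plot_continuous hr2).continuousAt
  have hev : ∀ᶠ b in 𝓝 b₀, (r b).1.1 ∈ O ∩ A ∧ arcAngle j (r b).1.2 ∈ T :=
    (hc1.eventually_mem ((hO.inter hA).mem_nhds ⟨haO, haA⟩)).and
      (hc2.eventually_mem (hT.mem_nhds htT))
  obtain ⟨N, hN, hNo, hbN⟩ := eventually_nhds_iff.1 hev
  refine ⟨N, hNo, hbN, fun {k c} hcN hc => ?_⟩
  have hi' : ∀ b, (r b₀).1.2 ∈ (L (r (c b)).1.1).W.U i := fun b => by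
    rw [← hez (r b₀).1.2]
    exact hAT _ (hN _ (hcN b)).1.2 _ htT
  have h1 := h k (fun b => (r (c b)).1.1) (hr1.contDiff.comp hc)
      (fun b => (hN _ (hcN b)).1.1) hi' hj
  refine (congrArg IsPlot (funext fun b => ?_)).mp h1
  have harr : ∀ (a : Param n) (z z' : Circle) (hzz : z = z') (hi hj hi' hj'),
      (f a).arr i j z hi hj = (f a).arr i j z' hi' hj' := by
    rintro a z _ rfl _ _ _ _
    rfl
  have hTb := (hN _ (hcN b)).2
  have h2 := heq _ (hN _ (hcN b)).1.2 _ htT _ hTb (hAT _ (hN _ (hcN b)).1.2 _ htT)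
    (hTj _ htT) (hAT _ (hN _ (hcN b)).1.2 _ hTb) (hTj _ hTb)
  exact (harr _ _ _ (hez _).symm _ _ _ _).trans (h2.trans (harr _ _ _ (hez _) _ _ _ (r (c b)).2.2))

end Transport

end Inertia

end Groupoid

/-! ### The local diffeomorphism condition and the Morita morphism -/

section Groupoid

variable {G : Type u} [DiffeologicalGroupoid.{v} G]

open DiffeologicalGroupoid (smooth_src smooth_tgt smooth_id smooth_inv)

namespace Inertia

theorem app_comp_map {L : Loop G} {v w : Inertia G} (f : L ⟶ v.constLoop) (α : v ⟶ w) {j : ℕ}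
    (h : Circle.exp Real.pi ∈ L.W.U j) :
    (Loop.Hom.app (L := L) (M := w.constLoop) (f ≫ (constLoops G).map α) ⟨j, _, h⟩ baseOb rfl :
      L.F.obj ⟨j, _, h⟩ ⟶ w.pt) =
    (Loop.Hom.app (L := L) (M := v.constLoop) f ⟨j, _, h⟩ baseOb rfl :
      L.F.obj ⟨j, _, h⟩ ⟶ v.pt) ≫ Hom.hom α :=
  (Loop.compApp_eq (L := L) (M := v.constLoop) (N := w.constLoop) f ((constLoops G).map α)
    ⟨j, _, h⟩ baseOb rfl baseOb rfl).trans (congrArg (_ ≫ ·) (map_app_baseOb α))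

/-- Transformations to constant loops may be prescribed at one point. -/
theorem exists_hom_arr_eq {L : Loop G} {v' : Inertia G} (f' : L ⟶ v'.constLoop) {j : ℕ}
    (h : Circle.exp Real.pi ∈ L.W.U j) (g : Arr G) (hg : g.src = L.F.obj ⟨j, _, h⟩) :
    ∃ (v : Inertia G) (f : L ⟶ v.constLoop),
        Loop.Hom.arr (M := v.constLoop) f j 0 _ h exp_pi_mem = g := by
  obtain ⟨s, t, g⟩ := g
  dsimp only at hg
  subst hg
  let e : L.F.obj ⟨j, _, h⟩ ⟶ v'.pt :=
    Loop.Hom.app (L := L) (M := v'.constLoop) f' ⟨j, _, h⟩ baseOb rfl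
  let β : v'.pt ⟶ t := Groupoid.inv e ≫ g
  -- Conjugating the holonomy makes `β` an arrow of `∧G`; composing with it changes the value `e`
  -- into `g`.
  let v : Inertia G := ⟨t, Groupoid.inv β ≫ v'.loop ≫ β⟩
  have hβ : v'.loop ≫ β = β ≫ (Groupoid.inv β ≫ v'.loop ≫ β) := by
    rw [Groupoid.inv_eq_inv, IsIso.hom_inv_id_assoc]
  let α : v' ⟶ v := (⟨β, hβ⟩ : Hom v' v)
  have he : e ≫ β = g := by simp [β]
  exact ⟨v, f' ≫ (constLoops G).map α, congrArg (Arr.mk _ _) ((app_comp_map f' α h).trans he)⟩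

/-- Transformations to constant loops are determined by their value at one point. -/
theorem sigma_eq_of_arr_eq (hG : IsOrbifoldGroupoid G) {L : Loop G} {v v' : Inertia G}
    (f : L ⟶ v.constLoop) (f' : L ⟶ v'.constLoop) {j : ℕ} (h : Circle.exp Real.pi ∈ L.W.U j)
    (he : Loop.Hom.arr (M := v.constLoop) f j 0 _ h exp_pi_mem =
      Loop.Hom.arr (M := v'.constLoop) f' j 0 _ h exp_pi_mem) :
    (⟨v, f⟩ : Σ v : Inertia G, L ⟶ v.constLoop) = ⟨v', f'⟩ := by
  -- By fullness the two transformations differ by an arrow `α` of `∧G`. Equal values at `-1` make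
  -- its underlying arrow an identity, and then the holonomies agree as well.
  obtain ⟨α, hα⟩ := exists_map_eq hG (Groupoid.inv f ≫ f')
  have hf : f' = f ≫ (constLoops G).map α := by simp [hα]
  subst hf
  have hpt : v.pt = v'.pt := congrArg Arr.tgt he
  obtain ⟨x, v⟩ := v
  obtain ⟨x', v'⟩ := v'
  dsimp only at hpt
  subst hpt
  have happ := app_comp_map f α h
  have hα1 : Hom.hom α = 𝟙 x := by
    injection he with _ _ h1
    have h2 := h1.trans happ
    exact (cancel_epi (Loop.Hom.app (L := L) (M := constLoop ⟨x, v⟩) f ⟨j, _, h⟩ baseOb rfl :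
      L.F.obj ⟨j, _, h⟩ ⟶ x)).1 (h2.symm.trans (Category.comp_id _).symm)
  have hv : v = v' := by
    have := Hom.comm α
    rw [hα1] at this
    exact (Category.comp_id v).symm.trans (this.trans (Category.id_comp v'))
  subst hv
  have : α = 𝟙 _ := Hom.ext hα1
  subst this
  exact congrArg (Sigma.mk _)
    ((congrArg (f ≫ ·) ((constLoops G).map_id _)).trans (Category.comp_id f)).symm

variable (G) in
/-- Transformations from a fixed loop to a constant loop. -/
abbrev ToConst : Type _ :=
  {q : Inertia G × Arr (FixedLoops G) // (fixedConstLoops G).obj q.1 = q.2.tgt}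

namespace ToConst

def mk (L : FixedLoops G) {v : Inertia G} (f : L.1 ⟶ v.constLoop) : ToConst G :=
  ⟨(v, ⟨L, (fixedConstLoops G).obj v, f⟩), rfl⟩

theorem exists_eq_mk (q : ToConst G) :
    ∃ (L : FixedLoops G) (v : Inertia G) (f : L.1 ⟶ v.constLoop), q = mk L f := by
  obtain ⟨⟨v, ⟨L, M, f⟩⟩, h⟩ := q
  dsimp only at h
  subst h
  exact ⟨L, v, f, rfl⟩

theorem exp_pi_mem_tgt (q : ToConst G) : Circle.exp Real.pi ∈ q.1.2.tgt.1.W.U 0 := by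
  rw [← q.2]
  exact exp_pi_mem

/-- The value of a transformation at a point. -/
def val (q : ToConst G) (j : ℕ) (h : Circle.exp Real.pi ∈ q.1.2.src.1.W.U j) : Arr G :=
  Loop.Hom.arr (FullSub.arrVal _ q.1.2).hom j 0 _ h q.exp_pi_mem_tgt

theorem isPlot_val {n : ℕ} {q : Param n → ToConst G} (hq : IsPlot q) (j : ℕ)
    (h : ∀ a, Circle.exp Real.pi ∈ (q a).1.2.src.1.W.U j) :
    IsPlot (fun a => (q a).val j (h a)) :=
  hq.2.2.2 j 0 n (fun a => ⟨(a, Circle.exp Real.pi), h a, (q a).exp_pi_mem_tgt⟩)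
    ⟨isPlot_id, isPlot_const⟩

theorem eq_of_val_eq (hG : IsOrbifoldGroupoid G) {q q' : ToConst G}
    (hs : q.1.2.src = q'.1.2.src) {j : ℕ} (h : Circle.exp Real.pi ∈ q.1.2.src.1.W.U j)
    (h' : Circle.exp Real.pi ∈ q'.1.2.src.1.W.U j) (he : q.val j h = q'.val j h') : q = q' := by
  obtain ⟨L, v, f, rfl⟩ := q.exists_eq_mk
  obtain ⟨L', v', f', rfl⟩ := q'.exists_eq_mk
  obtain rfl : L = L' := hs
  have h1 := sigma_eq_of_arr_eq hG f f' h he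
  cases h1
  rfl

theorem exists_val_eq (hG : IsOrbifoldGroupoid G) (L : FixedLoops G) {j : ℕ}
    (h : Circle.exp Real.pi ∈ L.1.W.U j) (g : Arr G) (hg : g.src = L.1.F.obj ⟨j, _, h⟩) :
    ∃ (v : Inertia G) (f : L.1 ⟶ v.constLoop), (mk L f).val j h = g := by
  obtain ⟨v', ⟨f'⟩⟩ := (L.2.isFlat hG).exists_hom_constLoop hG
  exact exists_hom_arr_eq f' h g hg

theorem isOpen_val {j : ℕ} {S : Set (Arr G)} (hS : IsOpen[dTopology] S) :
    IsOpen[dTopology] {q : ToConst G | ∃ h, q.val j h ∈ S} :=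
  isOpen_iff_preimages_plots.2 fun _ q hq =>
    isOpen_exists_mem (P := fun a => Circle.exp Real.pi ∈ (q a).1.2.src.1.W.U j)
      (isOpen_mem_cover (L := fun a => (q a).1.2.src.1) hq.2.1 j _) (fun a h => (q a).val j h)
      (fun _ hc h => isPlot_val (isPlot_reparam hq hc) j h) hS

theorem isPlot_obj {n : ℕ} {L : Param n → FixedLoops G} (hL : IsPlot L) (j : ℕ) (z : Circle)
    (h : ∀ a, z ∈ (L a).1.W.U j) : IsPlot (fun a => (L a).1.F.obj ⟨j, z, h a⟩) :=
  hL.2.1 j n (fun a => ⟨(a, z), h a⟩) ⟨isPlot_id, isPlot_const⟩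

theorem isOpen_obj (j : ℕ) (z : Circle) {S : Set G} (hS : IsOpen[dTopology] S) :
    IsOpen[dTopology] {L : FixedLoops G | ∃ h, L.1.F.obj ⟨j, z, h⟩ ∈ S} :=
  isOpen_iff_preimages_plots.2 fun _ L hL =>
    isOpen_exists_mem (P := fun a => z ∈ (L a).1.W.U j)
      (isOpen_mem_cover (L := fun a => (L a).1) hL j _) (fun a h => (L a).1.F.obj ⟨j, z, h⟩)
      (fun _ hc h => isPlot_obj (isPlot_reparam hL hc) j z h) hS

variable (G) in
theorem dSmooth_src : DSmooth (fun q : ToConst G => q.1.2.src) := fun _ _ hq => hq.2.1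

open Classical in
-- An element of `ToConst G` amounts to a fixed loop `L` and an arrow out of `L(-1)`, by
-- `eq_of_val_eq` and `exists_val_eq`. A local section of the source map of `G`, pulled back along
-- evaluation at `-1`, therefore gives the local inverse.
theorem isEtale_src (hG : IsOrbifoldGroupoid G) : IsEtale (fun q : ToConst G => q.1.2.src) := by
  refine isEtale_iff.2 ⟨dSmooth_src G, fun q₀ => ?_⟩
  obtain ⟨j, hj⟩ := q₀.1.2.src.1.W.cover (Circle.exp Real.pi)
  obtain ⟨s, hs, hs'⟩ := (isEtale_iff.1 hG.etale_src).2 (q₀.val j hj)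
  have hsrc : ∀ (L : FixedLoops G) (h : ∃ h, L.1.F.obj ⟨j, Circle.exp Real.pi, h⟩ ∈ s.target),
      (s.invFun (L.1.F.obj ⟨j, Circle.exp Real.pi, h.1⟩)).src = L.1.F.obj ⟨j, _, h.1⟩ :=
    fun L h => (hs' _ (s.map_target h.2)).symm.trans (s.right_inv h.2)
  choose v f hf using fun (L : FixedLoops G)
    (h : ∃ h, L.1.F.obj ⟨j, Circle.exp Real.pi, h⟩ ∈ s.target) =>
      exists_val_eq hG L h.1 _ (hsrc L h)
  -- The default `q₀` occurs only off the target.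
  let r : FixedLoops G → ToConst G := fun L => if h : _ then mk L (f L h) else q₀
  have hr : ∀ L h, r L = mk L (f L h) := fun L h => dif_pos h
  let e : LocalDiffeo (ToConst G) (FixedLoops G) :=
    { toFun := fun q => q.1.2.src
      invFun := r
      source := {q | ∃ h, q.val j h ∈ s.source}
      target := {L | ∃ h, L.1.F.obj ⟨j, Circle.exp Real.pi, h⟩ ∈ s.target}
      map_source' := ?_
      map_target' := ?_
      left_inv' := ?_
      right_inv' := ?_
      open_source := isOpen_val s.open_source
      open_target := isOpen_obj j _ s.open_target
      smooth := (dSmooth_src G).smoothOn _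
      smooth_symm := ?_ }
  · exact ⟨e, ⟨hj, hs⟩, fun _ _ => rfl⟩
  · rintro q ⟨h, hq⟩
    exact ⟨h, Set.mem_of_eq_of_mem (hs' _ hq).symm (s.map_source hq)⟩
  · rintro L h
    rw [hr L h]
    exact ⟨h.1, Set.mem_of_eq_of_mem (hf L h) (s.map_target h.2)⟩
  · rintro q ⟨h, hq⟩
    have hL : ∃ h, q.1.2.src.1.F.obj ⟨j, Circle.exp Real.pi, h⟩ ∈ s.target :=
      ⟨h, Set.mem_of_eq_of_mem (hs' _ hq).symm (s.map_source hq)⟩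
    refine (hr _ hL).trans (eq_of_val_eq hG rfl h h ((hf _ hL).trans ?_))
    refine Eq.trans ?_ (s.left_inv hq)
    exact congrArg s.invFun (hs' _ hq).symm
  · rintro L h
    rw [hr L h]
    rfl
  · intro n L hL hLt
    -- The values at `-1` are smooth by construction; `isSmoothArrFamily_of_base` extends this to
    -- the whole circle and to the holonomies.
    have hε : IsPlot (fun a => (mk (L a) (f (L a) (hLt a))).val j (hLt a).1) := by
      refine (congrArg IsPlot (funext fun a => hf (L a) (hLt a))).mpr ?_
      exact s.smooth_symm n _ (isPlot_obj hL j _ fun a => (hLt a).1) fun a => (hLt a).2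
    have h1 := isSmoothArrFamily_of_base (L := fun a => (L a).1) (fun a => f (L a) (hLt a)) hG hL
      (fun a => (L a).2.isFlat hG) j (fun a => (hLt a).1) hε
    refine (congrArg IsPlot (funext fun a => ?_)).mp
      (show IsPlot (fun a => mk (L a) (f (L a) (hLt a))) from h1)
    exact (hr (L a) (hLt a)).symm

end ToConst

theorem isMorita_fixedConstLoops (hG : IsOrbifoldGroupoid G) : IsMorita (fixedConstLoops G) where
  smooth_obj _ _ hv := isSmoothFamily_constLoop hv
  smooth_arr _ _ hf := isSmoothArrFamily_map hf
  cartesian x y g hx _ hg hs ht := cartesian_fixedConstLoops hG x y g hx hg hs ht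
  surjective L := by
    obtain ⟨v, ⟨f⟩⟩ := (L.2.isFlat hG).exists_hom_constLoop hG
    exact ⟨ToConst.mk L f, rfl⟩
  etale := ToConst.isEtale_src hG

end Inertia

end Groupoid

end Orb

end

theorem mainTheorem5 {G : Type u} [Orb.DiffeologicalGroupoid.{v} G]
    (hG : Orb.IsOrbifoldGroupoid G) :
    Orb.IsOrbifoldGroupoid (Orb.Inertia G) ∧
    ∃ h : ∀ x : Orb.Inertia G, Orb.Loop.IsFixed ((Orb.Inertia.constLoops G).obj x),
      Orb.IsMorita (C := Orb.Inertia G) (D := Orb.FixedLoops G)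
        (Orb.FullSub.lift Orb.Loop.IsFixed (Orb.Inertia.constLoops G) h) :=
  ⟨Orb.Inertia.isOrbifoldGroupoid hG, Orb.Inertia.isFixed_constLoop,
    Orb.Inertia.isMorita_fixedConstLoops hG⟩
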